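/- Let $r,c\ge 1$ be integers, $n=r+c$, and for a permutation $\varphi$ of $\{0,1\}^{n}$ let $\mathsf{Sp}^\varphi:(\{0,1\}^r)^*\to\{0,1\}^r$ be the sponge with a single squeezing round: starting from the state $0^{r}\|0^{c}$, for each block $x_i\in\{0,1\}^r$ of the message $m=x_1\|\dots\|x_p$ in turn, XOR $x_i$ into the first $r$ bits of the state and apply $\varphi$ to the whole state; $\mathsf{Sp}^\varphi(m)$ is the first $r$ bits of the final state (so the empty message is mapped to $0^r$). A quantum algorithm with $q'$ quantum queries to $\varphi$ and $\varphi^{-1}$ starts in a fixed unit vector of a finite-dimensional Hilbert space spanned by $|b\rangle|x\rangle|y\rangle|w\rangle$ with $b\in\{0,1\}$, $x,y\in\{0,1\}^n$ and $w$ in an arbitrary finite set, applies arbitrary unitaries that do not depend on $\varphi$, interleaved with $q'$ applications of the query unitary $|b\rangle|x\rangle|y\rangle|w\rangle\mapsto|b\rangle|x\rangle|y\oplus\varphi^{(-1)^b}(x)\rangle|w\rangle$, and finally measures in the computational basis and returns a function of the outcome. (No bound on computation time is assumed.) There is an absolute constant $C>0$ such that for all $r,c\ge1$, all $q\ge 0$,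 all $l\le q$, and every such quantum algorithm $\mathcal A$ making at most $q$ queries in total and returning a pair of messages, $$\Pr_{\substack{\varphi\sim S_{\{0,1\}^{n}}\\ (m,m')\leftarrow\mathcal A^{\varphi,\varphi^{-1}}}}\Bigl[m,m'\in(\{0,1\}^r)^{\le l},\ m\ne m',\ \mathsf{Sp}^\varphi(m)=\mathsf{Sp}^\varphi(m')\Bigr]\ \le\ C\,q^5\,n\,2^{-\min(r,c)},$$ where $\varphi$ is a uniformly random permutation of $\{0,1\}^{n}$ and $(\{0,1\}^r)^{\le l}$ is the set of messages of at most $l$ blocks. -/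

import Mathlib

/-- Bit strings of length `n`. Addition is bitwise XOR, and `0` is the all-zero string. -/
abbrev Bits (n : ℕ) : Type := Fin n → ZMod 2

namespace Sponge

/-- The rate of a state: its first `r` bits. -/
def rate {r c : ℕ} (s : Bits (r + c)) : Bits r := fun i => s (Fin.castAdd c i)

/-- One absorbing round: XOR the block into the rate, then apply the permutation to the state. -/
def absorbBlock {r c : ℕ} (φ : Equiv.Perm (Bits (r + c))) (s : Bits (r + c)) (x : Bits r) :
    Bits (r + c) :=
  φ (s + Fin.append x (0 : Bits c))

/-- The state after absorbing all the blocks of a message, first block first, starting from the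
all-zero state. -/
def absorb {r c : ℕ} (φ : Equiv.Perm (Bits (r + c))) (m : List (Bits r)) : Bits (r + c) :=
  m.foldl (absorbBlock φ) 0

/-- The sponge function with a single round of squeezing, on messages made of `r`-bit blocks. -/
def hash {r c : ℕ} (φ : Equiv.Perm (Bits (r + c))) (m : List (Bits r)) : Bits r :=
  rate (absorb φ m)

/-- `(m, m')` is a sponge collision between messages of at most `l` blocks. -/
def IsCollision {r c : ℕ} (l : ℕ) (φ : Equiv.Perm (Bits (r + c)))
    (p : List (Bits r) × List (Bits r)) : Prop :=
  p.1.length ≤ l ∧ p.2.length ≤ l ∧ p.1 ≠ p.2 ∧ hash φ p.1 = hash φ p.2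

end Sponge

/-- Basis labels of the registers of an algorithm that queries a permutation of `{0,1}ⁿ` and its
inverse: a direction bit, an `n`-bit query input, an `n`-bit query output, and a workspace `W`. -/
abbrev Reg (n : ℕ) (W : Type) : Type := Bool × Bits n × Bits n × W

/-- The Hilbert space of the registers. -/
abbrev RegSpace (n : ℕ) (W : Type) [Fintype W] : Type := EuclideanSpace ℂ (Reg n W)

/-- The action of one query on basis labels: `(b, x, y, w) ↦ (b, x, y ⊕ φ x, w)` if `b` is `false`
and `(b, x, y, w) ↦ (b, x, y ⊕ φ⁻¹ x, w)` if `b` is `true`. -/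
def queryLabel {n : ℕ} {W : Type} (φ : Equiv.Perm (Bits n)) : Equiv.Perm (Reg n W) where
  toFun v := (v.1, v.2.1, v.2.2.1 + (if v.1 then φ.symm v.2.1 else φ v.2.1), v.2.2.2)
  invFun v := (v.1, v.2.1, v.2.2.1 - (if v.1 then φ.symm v.2.1 else φ v.2.1), v.2.2.2)
  left_inv v := by simp
  right_inv v := by simp

/-- The unitary of one query: it sends the basis state `|v⟩` to `|queryLabel φ v⟩`. -/
noncomputable def queryOp {n : ℕ} {W : Type} [Fintype W] (φ : Equiv.Perm (Bits n)) :
    RegSpace n W ≃ₗᵢ[ℂ] RegSpace n W :=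
  LinearIsometryEquiv.piLpCongrLeft 2 ℂ ℂ (queryLabel φ)

/-- A quantum algorithm with oracle access to a permutation of `{0,1}ⁿ` and to its inverse, with
workspace `W` and outputs in `Out`. It starts in a state of norm one, alternates arbitrary unitaries
(which do not depend on the oracle) with `numQueries` oracle queries, measures all the registers in
the computational basis, and returns a function of the outcome. -/
structure QueryAlgorithm (n : ℕ) (W : Type) [Fintype W] (Out : Type) where
  numQueries : ℕ
  init : RegSpace n W
  norm_init : ‖init‖ = 1
  unitary : ℕ → (RegSpace n W ≃ₗᵢ[ℂ] RegSpace n W)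
  output : Reg n W → Out

namespace QueryAlgorithm

/-- The state right after the `t`-th query and the unitary that follows it. -/
noncomputable def state {n : ℕ} {W : Type} [Fintype W] {Out : Type} (A : QueryAlgorithm n W Out)
    (φ : Equiv.Perm (Bits n)) : ℕ → RegSpace n W
  | 0 => A.unitary 0 A.init
  | t + 1 => A.unitary (t + 1) (queryOp φ (A.state φ t))

open Classical in
/-- The probability, for the fixed oracle `φ`, that the output of the algorithm satisfies `P`. -/
noncomputable def outputProb {n : ℕ} {W : Type} [Fintype W] {Out : Type}
    (A : QueryAlgorithm n W Out) (φ : Equiv.Perm (Bits n)) (P : Out → Prop) : ℝ :=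
  ∑ v : Reg n W, if P (A.output v) then ‖A.state φ A.numQueries v‖ ^ 2 else 0

/-- The probability, over a uniformly random permutation `φ` and the measurement of the algorithm
run with oracle `φ`, that the output satisfies `P φ`. -/
noncomputable def successProb {n : ℕ} {W : Type} [Fintype W] {Out : Type}
    (A : QueryAlgorithm n W Out) (P : Equiv.Perm (Bits n) → Out → Prop) : ℝ :=
  (∑ φ : Equiv.Perm (Bits n), A.outputProb φ (P φ)) / (Fintype.card (Equiv.Perm (Bits n)) : ℝ)

end QueryAlgorithm

/-! The values of a random permutation are correlated, so they cannot be sampled lazily one by one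
as those of a random function. The proof randomises a block structure instead. Inputs and outputs
are divided by independent uniform bijections `lam false` and `lam true` into blocks of size s =
2^min(r,c), and the b-th input block is mapped to the b-th output block by an independent uniform
permutation of `S`. The resulting permutation is uniform, even given the division of one side
(`sum_blockPerm`). The division is unknown to the algorithm, so queries at two positions of one
block carry little weight, and a database with at most one input-output pair per block suffices.

An entry (i, j) of a block stands for the centred function √s (1[σ i = j] - 1/s) of the block
permutation σ, and an empty entry for the constant 1. This defines `jmap`, which is nearly a
contraction on small databases (`sum_normSq_jmap_le`). Before a query at position k, the true state
is replaced by its average over the changes of the block permutation that keep the answer at k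
(`resample`). By the hybrid argument such a change moves the state little, and by exchanging
positions the change is equally spread over the possible queries, so it is seen by the present query
only with tiny weight: the mean squared error is at most 16 t² s / 2^n
(`sum_l2_sub_resample_sq_le`). After averaging, an entry at another position of the block
contributes only a factor -1/(s-1) (`resample_jmap`); in what remains the queried pair can be
recorded, answered from the database, and compressed again (`expand`, `ask_kmap`, `fold`).
`l2_step_sub_le` bounds the error of one such step.

On databases the argument is classical. If the recorded pairs are `Good`, no two recorded messages
collide (`Path.eq_of_rate`). A query spoils goodness only for answers whose rate or capacity lies in
a set of size O(T). With high probability over the division, no block contains 3n positions with the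
same rate or capacity (`card_crowded_le`), so at most a fraction ε = O(T n / s) of the answers is
harmful (`card_le_of_not_good`), and the amplitude on bad databases grows by at most 3√ε per step
(`l2_onBad_simStep_le`).

To link the output with the database, the algorithm is followed by at most 2l queries that compute
both hashes and are left recorded. A collision then forces a bad database. With T the total number
of queries, the losses add up to O((T⁴ + T³ n) / s), which is within the claim since T ≤ 3q. -/

set_option linter.unusedSectionVars false

/-! ### Euclidean norms of functions on finite types. -/

/-- The Euclidean norm of a complex-valued function on a finite type. -/
noncomputable def l2 {ι : Type*} [Fintype ι] (f : ι → ℂ) : ℝ := Real.sqrt (∑ i, ‖f i‖ ^ 2)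

section L2

variable {ι κ : Type*} [Fintype ι] [Fintype κ]

lemma l2_eq_norm (f : ι → ℂ) : l2 f = ‖(WithLp.toLp 2 f : EuclideanSpace ℂ ι)‖ := by
  rw [EuclideanSpace.norm_eq, l2]

lemma l2_nonneg (f : ι → ℂ) : 0 ≤ l2 f := Real.sqrt_nonneg _

lemma l2_sq (f : ι → ℂ) : l2 f ^ 2 = ∑ i, ‖f i‖ ^ 2 :=
  Real.sq_sqrt (Finset.sum_nonneg fun _ _ => by positivity)

lemma l2_zero : l2 (0 : ι → ℂ) = 0 := by simp [l2]

lemma l2_add_le (f g : ι → ℂ) : l2 (f + g) ≤ l2 f + l2 g := by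
  simp only [l2_eq_norm, WithLp.toLp_add]
  exact norm_add_le _ _

lemma l2_neg (f : ι → ℂ) : l2 (-f) = l2 f := by simp [l2]

lemma l2_sub_le (f g : ι → ℂ) : l2 (f - g) ≤ l2 f + l2 g := by
  rw [sub_eq_add_neg, ← l2_neg g]
  exact l2_add_le _ _

lemma l2_le_l2 {f : ι → ℂ} {g : κ → ℂ} (h : ∑ i, ‖f i‖ ^ 2 ≤ ∑ i, ‖g i‖ ^ 2) : l2 f ≤ l2 g :=
  Real.sqrt_le_sqrt h

lemma l2_mono {f g : ι → ℂ} (h : ∀ i, ‖f i‖ ≤ ‖g i‖) : l2 f ≤ l2 g :=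
  l2_le_l2 (Finset.sum_le_sum fun i _ => by gcongr; exact h i)

lemma l2_le_mul {f : ι → ℂ} {g : κ → ℂ} {C : ℝ} (hC : 0 ≤ C)
    (h : ∑ i, ‖f i‖ ^ 2 ≤ C ^ 2 * ∑ i, ‖g i‖ ^ 2) : l2 f ≤ C * l2 g := by
  refine (Real.sqrt_le_sqrt h).trans ?_
  rw [Real.sqrt_mul (by positivity), Real.sqrt_sq hC, l2]

lemma l2_comp_equiv (f : ι → ℂ) (e : κ ≃ ι) : l2 (f ∘ e) = l2 f := by
  simp only [l2, Function.comp_apply]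
  rw [Equiv.sum_comp e fun i => ‖f i‖ ^ 2]

lemma norm_sum_sq_le {α : Type*} (s : Finset α) (f : α → ℂ) :
    ‖∑ a ∈ s, f a‖ ^ 2 ≤ s.card * ∑ a ∈ s, ‖f a‖ ^ 2 :=
  (pow_le_pow_left₀ (norm_nonneg _) (norm_sum_le _ _) 2).trans sq_sum_le_card_mul_sum_sq

end L2

/-! ### General query algorithms and the hybrid argument. -/

/-- One query of a general query algorithm with label set `V`, followed by a unitary: the label
determines the direction and the input of the query, if there is one, and the answer acts on the
labels. -/
structure QStep (X V : Type*) [Fintype V] where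
  qry : V → Option (Bool × X)
  act : Option X → Equiv.Perm V
  qry_act : ∀ y v, qry (act y v) = qry v
  U : (V → ℂ) →ₗ[ℂ] (V → ℂ)
  l2_U : ∀ f, l2 (U f) = l2 f

/-- The answer of a permutation to a query in a given direction. -/
def answer {X : Type*} (φ : Equiv.Perm X) (q : Bool × X) : X := if q.1 then φ.symm q.2 else φ q.2

namespace QStep

variable {X V I : Type*} [Fintype V] (Q : QStep X V)

@[simp] lemma qry_act_symm (o : Option X) (v : V) : Q.qry ((Q.act o).symm v) = Q.qry v := by
  conv_rhs => rw [← (Q.act o).apply_symm_apply v, qry_act]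

/-- The permutation of the labels `I × V` by which a query is answered from the data in `I`. -/
def ctrl (G : I → Bool × X → Option X) : Equiv.Perm (I × V) where
  toFun p := (p.1, Q.act ((Q.qry p.2).bind (G p.1)) p.2)
  invFun p := (p.1, (Q.act ((Q.qry p.2).bind (G p.1))).symm p.2)
  left_inv p := by simp [Q.qry_act]
  right_inv p := by simp

/-- The query operator that answers from the data in `I`. -/
def ask (G : I → Bool × X → Option X) (f : I × V → ℂ) : I × V → ℂ := f ∘ (Q.ctrl G).symm

lemma ask_apply (G : I → Bool × X → Option X) (f : I × V → ℂ) (i : I) (v : V) :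
    Q.ask G f (i, v) = f (i, (Q.act ((Q.qry v).bind (G i))).symm v) := rfl

lemma l2_ask [Fintype I] (G : I → Bool × X → Option X) (f : I × V → ℂ) :
    l2 (Q.ask G f) = l2 f :=
  l2_comp_equiv _ _

lemma ask_add (G : I → Bool × X → Option X) (f g : I × V → ℂ) :
    Q.ask G (f + g) = Q.ask G f + Q.ask G g := rfl

lemma ask_sub (G : I → Bool × X → Option X) (f g : I × V → ℂ) :
    Q.ask G (f - g) = Q.ask G f - Q.ask G g := rfl

/-- The unitary of a step, applied to the label register. -/
def liftU (f : I × V → ℂ) : I × V → ℂ := fun p => Q.U (fun v => f (p.1, v)) p.2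

lemma l2_liftU [Fintype I] (f : I × V → ℂ) : l2 (Q.liftU f) = l2 f := by
  have h : ∀ i, ∑ v, ‖Q.liftU f (i, v)‖ ^ 2 = ∑ v, ‖f (i, v)‖ ^ 2 := fun i => by
    have := congrArg (· ^ 2) (Q.l2_U fun v => f (i, v))
    simpa only [l2_sq, liftU] using this
  simp only [l2, Fintype.sum_prod_type, h]

lemma liftU_add (f g : I × V → ℂ) : Q.liftU (f + g) = Q.liftU f + Q.liftU g := by
  ext p
  exact congrFun (Q.U.map_add (fun v => f (p.1, v)) fun v => g (p.1, v)) p.2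

lemma liftU_sub (f g : I × V → ℂ) : Q.liftU (f - g) = Q.liftU f - Q.liftU g := by
  ext p
  exact congrFun (Q.U.map_sub (fun v => f (p.1, v)) fun v => g (p.1, v)) p.2

/-- The query operator of a step for a fixed permutation. -/
def askPerm (φ : Equiv.Perm X) (f : V → ℂ) : V → ℂ :=
  fun v => f ((Q.act ((Q.qry v).map (answer φ))).symm v)

lemma l2_askPerm (φ : Equiv.Perm X) (f : V → ℂ) : l2 (Q.askPerm φ f) = l2 f := by
  have := Q.l2_ask (I := Unit) (fun _ q => some (answer φ q)) (fun p => f p.2)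
  simp only [l2, ask_apply, Fintype.sum_prod_type, Fintype.sum_unique] at this
  simp only [l2, askPerm, Option.map_eq_bind]
  exact this

/-- The part of a vector on the labels whose query satisfies a predicate. -/
noncomputable def restrict (D : Bool × X → Prop) (f : V → ℂ) : V → ℂ :=
  open Classical in fun v => if ∃ q, Q.qry v = some q ∧ D q then f v else 0

lemma restrict_of {D : Bool × X → Prop} (f : V → ℂ) {v : V} (h : ∃ q, Q.qry v = some q ∧ D q) :
    Q.restrict D f v = f v := if_pos h

lemma restrict_of_not {D : Bool × X → Prop} (f : V → ℂ) {v : V}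
    (h : ¬ ∃ q, Q.qry v = some q ∧ D q) : Q.restrict D f v = 0 := if_neg h

/-- Both query operators act in the same way on labels whose query is outside `D`, so only the
restricted part is left; the factor 2 is the triangle inequality. -/
lemma l2_askPerm_sub_le (φ φ' : Equiv.Perm X) (D : Bool × X → Prop)
    (hD : ∀ q, ¬ D q → answer φ q = answer φ' q) (f : V → ℂ) :
    l2 (Q.askPerm φ f - Q.askPerm φ' f) ≤ 2 * l2 (Q.restrict D f) := by
  have : Q.askPerm φ f - Q.askPerm φ' f =
      Q.askPerm φ (Q.restrict D f) - Q.askPerm φ' (Q.restrict D f) := by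
    ext v
    by_cases h : ∃ q, Q.qry v = some q ∧ D q
    · simp only [Pi.sub_apply, askPerm]
      rw [restrict_of _ _ (by simpa using h), restrict_of _ _ (by simpa using h)]
    · have : (Q.qry v).map (answer φ) = (Q.qry v).map (answer φ') := by
        rcases hq : Q.qry v with _ | q
        · rfl
        · simp only [Option.map_some]
          rw [hD q fun hd => h ⟨q, hq, hd⟩]
      simp only [Pi.sub_apply, askPerm, this, sub_self]
  rw [this]
  refine (l2_sub_le _ _).trans ?_
  rw [l2_askPerm, l2_askPerm, two_mul]

end QStep

/-- The state of a general query algorithm after `t` steps. -/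
def run {X V : Type*} [Fintype V] (Q : ℕ → QStep X V) (init : V → ℂ) (φ : Equiv.Perm X) :
    ℕ → V → ℂ
  | 0 => init
  | t + 1 => (Q t).U ((Q t).askPerm φ (run Q init φ t))

section Run

variable {X V : Type*} [Fintype V]

lemma l2_run (Q : ℕ → QStep X V) (init : V → ℂ) (φ : Equiv.Perm X) (t : ℕ) :
    l2 (run Q init φ t) = l2 init := by
  induction t with
  | zero => rfl
  | succ t ih => rw [run, QStep.l2_U, QStep.l2_askPerm, ih]

/-- The hybrid bound: replacing the permutation changes the state by at most twice the total query
weight on the queries with a changed answer. -/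
lemma l2_run_sub_le (Q : ℕ → QStep X V) (init : V → ℂ) (φ φ' : Equiv.Perm X)
    (D : Bool × X → Prop) (hD : ∀ q, ¬ D q → answer φ q = answer φ' q) (t : ℕ) :
    l2 (run Q init φ t - run Q init φ' t) ≤
      ∑ i ∈ Finset.range t, 2 * l2 ((Q i).restrict D (run Q init φ i)) := by
  induction t with
  | zero => simp [run, l2]
  | succ t ih =>
    rw [Finset.sum_range_succ]
    have : run Q init φ (t + 1) - run Q init φ' (t + 1) =
        (Q t).U (((Q t).askPerm φ' (run Q init φ t - run Q init φ' t)) +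
          ((Q t).askPerm φ (run Q init φ t) - (Q t).askPerm φ' (run Q init φ t))) := by
      rw [run, run, ← map_sub]
      congr 1
      ext v
      simp [QStep.askPerm]
    rw [this, QStep.l2_U]
    refine (l2_add_le _ _).trans ?_
    rw [QStep.l2_askPerm]
    exact add_le_add ih ((Q t).l2_askPerm_sub_le _ _ _ hD _)

/-- Cauchy–Schwarz on the hybrid bound. Only the run on `φ` occurs on the right, and in squared
form, so that the bound can be averaged over a random `D`. -/
lemma l2_run_sub_sq_le (Q : ℕ → QStep X V) (init : V → ℂ) (φ φ' : Equiv.Perm X)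
    (D : Bool × X → Prop) (hD : ∀ q, ¬ D q → answer φ q = answer φ' q) (t : ℕ) :
    l2 (run Q init φ t - run Q init φ' t) ^ 2 ≤
      4 * t * ∑ i ∈ Finset.range t, l2 ((Q i).restrict D (run Q init φ i)) ^ 2 := by
  refine (pow_le_pow_left₀ (l2_nonneg _) (l2_run_sub_le Q init φ φ' D hD t) 2).trans ?_
  refine sq_sum_le_card_mul_sum_sq.trans ?_
  simp only [Finset.card_range, mul_pow, ← Finset.mul_sum]
  linarith

end Run

/-! ### Databases with one entry per block, and the local operators on them. -/

section Database

variable {β S : Type*} [Fintype β] [DecidableEq β] [Fintype S] [DecidableEq S]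

/-- Isolates the entry of a single block; all norm estimates below reduce to one block with the rest
of the database fixed. -/
lemma sum_update_split {C M : Type*} [Fintype C] [DecidableEq C] [AddCommMonoid M] (b : β) (c : C)
    (F : (β → C) → M) :
    ∑ α, F α = ∑ α : β → C with α b = c, ∑ o, F (Function.update α b o) := by
  rw [← Finset.sum_product']
  refine Finset.sum_bij' (fun α _ => (Function.update α b c, α b))
    (fun p _ => Function.update p.1 b p.2) ?_ ?_ ?_ ?_ ?_
  · simp
  · simp
  · simp
  · rintro ⟨α, o⟩ h
    have : α b = c := by simpa using h
    simp [← this]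
  · simp

/-- The edge with fixed endpoint `k` and other endpoint `z`, for a query in direction `d`. -/
def edge (d : Bool) (k z : S) : S × S := if d then (z, k) else (k, z)

/-- The answer of a permutation to the query `k` in direction `d`. -/
def permVal (d : Bool) (k : S) (σ : Equiv.Perm S) : S := if d then σ.symm k else σ k

/-- The other endpoint of a recorded edge, if its fixed endpoint is `k`. -/
def rowVal (d : Bool) (k : S) (o : Option (S × S)) : Option S :=
  o.bind fun e => if (if d then e.2 else e.1) = k then some (if d then e.1 else e.2) else none

@[simp] lemma rowVal_none (d : Bool) (k : S) : rowVal d k none = none := rfl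

@[simp] lemma rowVal_edge (d : Bool) (k k' z : S) :
    rowVal d k (some (edge d k' z)) = if k' = k then some z else none := by
  cases d <;> simp [rowVal, edge]

lemma eq_edge_of_rowVal {d : Bool} {k z : S} {o : Option (S × S)} (h : rowVal d k o = some z) :
    o = some (edge d k z) := by
  rcases o with _ | ⟨i, j⟩
  · simp at h
  · cases d <;> simp [rowVal, edge] at h ⊢ <;> tauto

lemma sum_edge {M : Type*} [AddCommMonoid M] (d : Bool) (F : S × S → M) :
    ∑ e, F e = ∑ k, ∑ z, F (edge d k z) := by
  cases d
  · simp [edge, Fintype.sum_prod_type]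
  · simp [edge, Fintype.sum_prod_type_right]

/-- Databases with at most one recorded input-output pair in each block. -/
abbrev DB (β S : Type*) : Type _ := β → Option (S × S)

/-- The square root of the size of a block. -/
noncomputable def rtCard (S : Type*) [Fintype S] : ℂ := ((Real.sqrt (Fintype.card S) : ℝ) : ℂ)

lemma rtCard_mul_self : rtCard S * rtCard S = (Fintype.card S : ℂ) := by
  rw [rtCard, ← Complex.ofReal_mul, Real.mul_self_sqrt (by positivity)]
  simp

lemma rtCard_ne_zero [Nonempty S] : rtCard S ≠ 0 := by
  intro h
  have := rtCard_mul_self (S := S)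
  rw [h, mul_zero] at this
  exact Fintype.card_ne_zero (α := S) (by exact_mod_cast this.symm)

lemma normSq_rtCard : ‖rtCard S‖ ^ 2 = (Fintype.card S : ℝ) := by
  rw [rtCard, Complex.norm_real, Real.norm_eq_abs, sq_abs, Real.sq_sqrt (by positivity)]

/-- Pythagoras: with u the unit vector of constant entry `(rtCard S)⁻¹`, the vector on the left is
`f` with its component along u replaced by `a`. -/
lemma sum_norm_add_sq [Nonempty S] (f : S → ℂ) (a : ℂ) :
    ∑ z, ‖f z + (rtCard S)⁻¹ * (a - (rtCard S)⁻¹ * ∑ z, f z)‖ ^ 2 =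
      ∑ z, ‖f z‖ ^ 2 + ‖a‖ ^ 2 - ‖(rtCard S)⁻¹ * ∑ z, f z‖ ^ 2 := by
  set m := (rtCard S)⁻¹ * ∑ z, f z with hm
  have hs : ∑ z, f z = rtCard S * m := by
    rw [hm, ← mul_assoc, mul_inv_cancel₀ rtCard_ne_zero, one_mul]
  set w := (rtCard S)⁻¹ * (a - m) with hw
  have hcard : (Fintype.card S : ℝ) ≠ 0 := by simp
  have h1 : ∑ z, ‖f z + w‖ ^ 2 =
      ∑ z, ‖f z‖ ^ 2 + Fintype.card S * ‖w‖ ^ 2 + 2 * ((∑ z, f z) * (starRingEnd ℂ) w).re := by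
    simp only [Complex.sq_norm, Complex.normSq_add, Finset.sum_add_distrib, Finset.sum_const,
      Finset.card_univ, nsmul_eq_mul, ← Finset.mul_sum, Finset.sum_mul, Complex.re_sum]
  have h2 : Fintype.card S * ‖w‖ ^ 2 = ‖a - m‖ ^ 2 := by
    rw [hw, norm_mul, mul_pow, norm_inv, inv_pow, normSq_rtCard, ← mul_assoc,
      mul_inv_cancel₀ hcard, one_mul]
  have h3 : (∑ z, f z) * (starRingEnd ℂ) w = m * (starRingEnd ℂ) (a - m) := by
    have : (starRingEnd ℂ) (rtCard S) = rtCard S := by simp [rtCard]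
    rw [hs, hw, map_mul, map_inv₀, this]
    field_simp [rtCard_ne_zero (S := S)]
  rw [h1, h2, h3]
  simp only [Complex.sq_norm, Complex.normSq_apply, Complex.mul_re, Complex.sub_re, Complex.sub_im,
    Complex.conj_re, Complex.conj_im, map_sub]
  ring

/-- The normalized sum of a function over the possible answers to a query. -/
noncomputable def rowMean (κ : Bool × β × S) (f : DB β S → ℂ) (α : DB β S) : ℂ :=
  (rtCard S)⁻¹ * ∑ z, f (Function.update α κ.2.1 (some (edge κ.1 κ.2.2 z)))

/-- Records the queried pair in the database, in uniform superposition if it was not there. -/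
noncomputable def expand (κ : Bool × β × S) (f : DB β S → ℂ) (α : DB β S) : ℂ :=
  if (rowVal κ.1 κ.2.2 (α κ.2.1)).isSome then
    f α + (rtCard S)⁻¹ * (f (Function.update α κ.2.1 none) - rowMean κ f α)
  else 0

/-- The adjoint of `expand`. -/
noncomputable def fold (κ : Bool × β × S) (g : DB β S → ℂ) (α : DB β S) : ℂ :=
  if α κ.2.1 = none then rowMean κ g α
  else if (rowVal κ.1 κ.2.2 (α κ.2.1)).isSome then g α - (rtCard S)⁻¹ * rowMean κ g α
  else 0

/-- Drops the databases that record another query in the block of the current one. -/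
noncomputable def keep (κ : Bool × β × S) (f : DB β S → ℂ) (α : DB β S) : ℂ :=
  if α κ.2.1 = none ∨ (rowVal κ.1 κ.2.2 (α κ.2.1)).isSome then f α else 0

/-- The contribution of the databases that record another query in the block of the current one,
after averaging over the rest of the block. -/
noncomputable def spill (κ : Bool × β × S) (f : DB β S → ℂ) (α : DB β S) : ℂ :=
  (rowVal κ.1 κ.2.2 (α κ.2.1)).elim 0 fun z =>
    -((Fintype.card S : ℂ) - 1)⁻¹ *
      ∑ k with k ≠ κ.2.2, f (Function.update α κ.2.1 (some (edge κ.1 k z)))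

lemma sum_db_split {M : Type*} [AddCommMonoid M] (κ : Bool × β × S) (F : DB β S → M) :
    ∑ α, F α = ∑ α : DB β S with α κ.2.1 = none, (F (Function.update α κ.2.1 none) +
      ∑ k, ∑ z, F (Function.update α κ.2.1 (some (edge κ.1 k z)))) := by
  rw [sum_update_split κ.2.1 none]
  refine Finset.sum_congr rfl fun α _ => ?_
  rw [Fintype.sum_option, sum_edge κ.1]

lemma rowMean_update (κ : Bool × β × S) (f : DB β S → ℂ) (α : DB β S) (o : Option (S × S)) :
    rowMean κ f (Function.update α κ.2.1 o) = rowMean κ f α := by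
  simp [rowMean]

@[simp] lemma expand_none (κ : Bool × β × S) (f : DB β S → ℂ) (α : DB β S) :
    expand κ f (Function.update α κ.2.1 none) = 0 := by
  simp [expand]

@[simp] lemma expand_edge (κ : Bool × β × S) (f : DB β S → ℂ) (α : DB β S) (k z : S) :
    expand κ f (Function.update α κ.2.1 (some (edge κ.1 k z))) =
      if k = κ.2.2 then f (Function.update α κ.2.1 (some (edge κ.1 k z))) +
        (rtCard S)⁻¹ * (f (Function.update α κ.2.1 none) - rowMean κ f α) else 0 := by
  by_cases h : k = κ.2.2 <;> simp [expand, h, rowMean_update]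

@[simp] lemma fold_none (κ : Bool × β × S) (f : DB β S → ℂ) (α : DB β S) :
    fold κ f (Function.update α κ.2.1 none) = rowMean κ f α := by
  simp [fold, rowMean_update]

@[simp] lemma fold_edge (κ : Bool × β × S) (f : DB β S → ℂ) (α : DB β S) (k z : S) :
    fold κ f (Function.update α κ.2.1 (some (edge κ.1 k z))) =
      if k = κ.2.2 then f (Function.update α κ.2.1 (some (edge κ.1 k z))) -
        (rtCard S)⁻¹ * rowMean κ f α else 0 := by
  by_cases h : k = κ.2.2 <;> simp [fold, h, rowMean_update]

@[simp] lemma keep_none (κ : Bool × β × S) (f : DB β S → ℂ) (α : DB β S) :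
    keep κ f (Function.update α κ.2.1 none) = f (Function.update α κ.2.1 none) := by
  simp [keep]

@[simp] lemma keep_edge (κ : Bool × β × S) (f : DB β S → ℂ) (α : DB β S) (k z : S) :
    keep κ f (Function.update α κ.2.1 (some (edge κ.1 k z))) =
      if k = κ.2.2 then f (Function.update α κ.2.1 (some (edge κ.1 k z))) else 0 := by
  by_cases h : k = κ.2.2 <;> simp [keep, h]

@[simp] lemma spill_none (κ : Bool × β × S) (f : DB β S → ℂ) (α : DB β S) :
    spill κ f (Function.update α κ.2.1 none) = 0 := by
  simp [spill]

@[simp] lemma spill_edge (κ : Bool × β × S) (f : DB β S → ℂ) (α : DB β S) (k z : S) :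
    spill κ f (Function.update α κ.2.1 (some (edge κ.1 k z))) =
      if k = κ.2.2 then -((Fintype.card S : ℂ) - 1)⁻¹ *
        ∑ k with k ≠ κ.2.2, f (Function.update α κ.2.1 (some (edge κ.1 k z))) else 0 := by
  by_cases h : k = κ.2.2 <;> simp [spill, h]

lemma sum_normSq_split (κ : Bool × β × S) (F : DB β S → ℂ) :
    ∑ α, ‖F α‖ ^ 2 = ∑ α : DB β S with α κ.2.1 = none,
      (‖F (Function.update α κ.2.1 none)‖ ^ 2 +
        ∑ k, ∑ z, ‖F (Function.update α κ.2.1 (some (edge κ.1 k z)))‖ ^ 2) :=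
  sum_db_split κ fun α => ‖F α‖ ^ 2

lemma row_le_sum_normSq (κ : Bool × β × S) (F : DB β S → ℂ) (α : DB β S) :
    ∑ z, ‖F (Function.update α κ.2.1 (some (edge κ.1 κ.2.2 z)))‖ ^ 2 ≤
      ∑ k, ∑ z, ‖F (Function.update α κ.2.1 (some (edge κ.1 k z)))‖ ^ 2 :=
  Finset.single_le_sum (f := fun k => ∑ z,
    ‖F (Function.update α κ.2.1 (some (edge κ.1 k z)))‖ ^ 2)
    (fun _ _ => by positivity) (Finset.mem_univ _)

/-- In the queried row, the uniform component is discarded and the amplitude of the empty entry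
takes its place. -/
lemma sum_normSq_expand_le [Nonempty S] (κ : Bool × β × S) (f : DB β S → ℂ) :
    ∑ α, ‖expand κ f α‖ ^ 2 ≤ ∑ α, ‖f α‖ ^ 2 := by
  rw [sum_normSq_split κ, sum_normSq_split κ]
  refine Finset.sum_le_sum fun α _ => ?_
  have h := sum_norm_add_sq (fun z => f (Function.update α κ.2.1 (some (edge κ.1 κ.2.2 z))))
    (f (Function.update α κ.2.1 none))
  have h2 := row_le_sum_normSq κ f α
  rw [Finset.sum_eq_single κ.2.2 (by intro k _ hk; simp [hk]) (by simp)]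
  simp only [expand_none, expand_edge, if_true, rowMean]
  rw [h]
  have := sq_nonneg ‖(rtCard S)⁻¹ * ∑ z, f (Function.update α κ.2.1 (some (edge κ.1 κ.2.2 z)))‖
  simp only [norm_zero]
  linarith

/-- The empty entry receives exactly the uniform component that the queried row loses. -/
lemma sum_normSq_fold_le [Nonempty S] (κ : Bool × β × S) (f : DB β S → ℂ) :
    ∑ α, ‖fold κ f α‖ ^ 2 ≤ ∑ α, ‖f α‖ ^ 2 := by
  rw [sum_normSq_split κ, sum_normSq_split κ]
  refine Finset.sum_le_sum fun α _ => ?_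
  have h := sum_norm_add_sq (fun z => f (Function.update α κ.2.1 (some (edge κ.1 κ.2.2 z)))) 0
  simp only [zero_sub, mul_neg, ← sub_eq_add_neg] at h
  have h2 := row_le_sum_normSq κ f α
  rw [Finset.sum_eq_single κ.2.2 (by intro k _ hk; simp [hk]) (by simp)]
  simp only [fold_none, fold_edge, if_true, rowMean]
  rw [h]
  have := sq_nonneg ‖f (Function.update α κ.2.1 none)‖
  simp only [norm_zero]
  linarith

/-- Cauchy–Schwarz over the s - 1 other positions costs a factor s - 1 against the prefactor (s -
1)⁻². -/
lemma sum_normSq_spill_le (hS : 1 < Fintype.card S) (κ : Bool × β × S) (f : DB β S → ℂ) :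
    ∑ α, ‖spill κ f α‖ ^ 2 ≤ ((Fintype.card S : ℝ) - 1)⁻¹ * ∑ α, ‖f α‖ ^ 2 := by
  have hc : (0 : ℝ) < (Fintype.card S : ℝ) - 1 := by
    have : (1 : ℝ) < Fintype.card S := by exact_mod_cast hS
    linarith
  have hn : ‖-((Fintype.card S : ℂ) - 1)⁻¹‖ = ((Fintype.card S : ℝ) - 1)⁻¹ := by
    have : ((Fintype.card S : ℂ) - 1) = (((Fintype.card S : ℝ) - 1 : ℝ) : ℂ) := by simp
    rw [norm_neg, norm_inv, this, Complex.norm_real, Real.norm_of_nonneg hc.le]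
  have hk : ((Finset.univ.filter fun k : S => k ≠ κ.2.2).card : ℝ) = (Fintype.card S : ℝ) - 1 := by
    rw [Finset.filter_ne', Finset.card_erase_of_mem (Finset.mem_univ _), Finset.card_univ,
      Nat.cast_sub hS.le, Nat.cast_one]
  rw [sum_normSq_split κ, sum_normSq_split κ, Finset.mul_sum]
  refine Finset.sum_le_sum fun α _ => ?_
  rw [Finset.sum_eq_single κ.2.2 (by intro k _ hk; simp [hk]) (by simp)]
  simp only [spill_none, spill_edge, if_true, norm_mul, mul_pow, hn]
  have h1 : ∀ z, ‖∑ k with k ≠ κ.2.2, f (Function.update α κ.2.1 (some (edge κ.1 k z)))‖ ^ 2 ≤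
      ((Fintype.card S : ℝ) - 1) * ∑ k, ‖f (Function.update α κ.2.1 (some (edge κ.1 k z)))‖ ^ 2 := by
    intro z
    refine (norm_sum_sq_le _ _).trans ?_
    rw [hk]
    gcongr
    exact Finset.subset_univ _
  calc _ ≤ ∑ z, (((Fintype.card S : ℝ) - 1)⁻¹ ^ 2 * (((Fintype.card S : ℝ) - 1) *
        ∑ k, ‖f (Function.update α κ.2.1 (some (edge κ.1 k z)))‖ ^ 2)) := by
        simp only [norm_zero, ne_eq, OfNat.ofNat_ne_zero, not_false_eq_true, zero_pow, zero_add]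
        gcongr with z
        exact h1 z
    _ = ((Fintype.card S : ℝ) - 1)⁻¹ *
        ∑ k, ∑ z, ‖f (Function.update α κ.2.1 (some (edge κ.1 k z)))‖ ^ 2 := by
        rw [Finset.sum_comm (s := Finset.univ) (t := Finset.univ) (f := fun k z =>
          ‖f (Function.update α κ.2.1 (some (edge κ.1 k z)))‖ ^ 2)]
        rw [Finset.mul_sum]
        refine Finset.sum_congr rfl fun z _ => ?_
        field_simp
    _ ≤ _ := by
        gcongr
        have := sq_nonneg ‖f (Function.update α κ.2.1 none)‖
        linarith

/-- Where the new database is bad, `f` vanishes and `expand` has the constant value (a - m)/√s, with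
a the amplitude of the empty entry and m the row mean. At most ε s answers are bad, and |a - m|² ≤
2(|a|² + |m|²) gives the factor 2. -/
lemma sum_bad_expand_le [Nonempty S] (κ : Bool × β × S) (f : DB β S → ℂ) (Bad : DB β S → Prop)
    [DecidablePred Bad] (ε : ℝ) (hε : 0 ≤ ε)
    (hmono : ∀ α : DB β S, Bad (Function.update α κ.2.1 none) → Bad α)
    (hf : ∀ α, Bad α → f α = 0)
    (hcount : ∀ α : DB β S, α κ.2.1 = none → ¬ Bad α →
      (f α ≠ 0 ∨ ∃ z, f (Function.update α κ.2.1 (some (edge κ.1 κ.2.2 z))) ≠ 0) →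
      ((Finset.univ.filter fun z : S =>
        Bad (Function.update α κ.2.1 (some (edge κ.1 κ.2.2 z)))).card : ℝ) ≤
          ε * Fintype.card S) :
    ∑ α, ‖if Bad α then expand κ f α else 0‖ ^ 2 ≤ 2 * ε * ∑ α, ‖f α‖ ^ 2 := by
  rw [sum_normSq_split κ, sum_normSq_split κ, Finset.mul_sum]
  refine Finset.sum_le_sum fun α hα => ?_
  have hα : α κ.2.1 = none := by simpa using hα
  have hu : Function.update α κ.2.1 none = α := by rw [← hα, Function.update_eq_self]
  rw [Finset.sum_eq_single κ.2.2 (by intro k _ hk; simp [hk]) (by simp)]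
  simp only [expand_none, expand_edge, if_true, ite_self, norm_zero, ne_eq, OfNat.ofNat_ne_zero,
    not_false_eq_true, zero_pow, zero_add]
  set c := fun z => f (Function.update α κ.2.1 (some (edge κ.1 κ.2.2 z))) with hc
  have hrow := row_le_sum_normSq κ f α
  by_cases hz : f α ≠ 0 ∨ ∃ z, c z ≠ 0
  · have hgood : ¬ Bad α := by
      intro hb
      rcases hz with h | ⟨z, h⟩
      · exact h (hf _ hb)
      · exact h (hf _ (hmono _ (by simpa [hu] using hb)))
    have hcnt := hcount α hα hgood hz
    have hm : ‖rowMean κ f α‖ ^ 2 ≤ ∑ z, ‖c z‖ ^ 2 := by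
      have := sum_norm_add_sq c 0
      have h0 : 0 ≤ ∑ z, ‖c z + (rtCard S)⁻¹ * (0 - (rtCard S)⁻¹ * ∑ z, c z)‖ ^ 2 := by positivity
      rw [this] at h0
      simp only [rowMean]
      simp only [norm_zero] at h0
      linarith
    set w := f α - rowMean κ f α with hw
    have hw2 : ‖w‖ ^ 2 ≤ 2 * (‖f α‖ ^ 2 + ‖rowMean κ f α‖ ^ 2) := by
      have := norm_sub_le (f α) (rowMean κ f α)
      have h2 := pow_le_pow_left₀ (norm_nonneg _) this 2
      nlinarith [sq_nonneg (‖f α‖ - ‖rowMean κ f α‖)]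
    rw [hu]
    have hterm : ∀ z, ‖if Bad (Function.update α κ.2.1 (some (edge κ.1 κ.2.2 z))) then
        c z + (rtCard S)⁻¹ * w else 0‖ ^ 2 =
        if Bad (Function.update α κ.2.1 (some (edge κ.1 κ.2.2 z))) then
          (Fintype.card S : ℝ)⁻¹ * ‖w‖ ^ 2 else 0 := by
      intro z
      split_ifs with hb
      · simp only [hc]
        rw [hf _ hb, zero_add, norm_mul, mul_pow, norm_inv, inv_pow, normSq_rtCard]
      · simp
    simp only [hc] at hterm
    rw [Finset.sum_congr rfl fun z _ => hterm z, ← Finset.sum_filter, Finset.sum_const,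
      nsmul_eq_mul]
    have hcard : (0 : ℝ) < Fintype.card S := by exact_mod_cast Fintype.card_pos
    calc _ ≤ ε * Fintype.card S * ((Fintype.card S : ℝ)⁻¹ * ‖w‖ ^ 2) := by gcongr
      _ = ε * ‖w‖ ^ 2 := by field_simp
      _ ≤ ε * (2 * (‖f α‖ ^ 2 + ∑ z, ‖c z‖ ^ 2)) := by gcongr; linarith
      _ ≤ 2 * ε * (‖f α‖ ^ 2 + _) := by
        rw [← mul_assoc, mul_comm ε 2]
        gcongr
  · push Not at hz
    have h0 : ∀ z, f (Function.update α κ.2.1 (some (edge κ.1 κ.2.2 z))) = 0 := hz.2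
    have hm : rowMean κ f α = 0 := by simp [rowMean, h0]
    simp only [hu, hz.1, h0, hm, sub_zero, mul_zero, add_zero, ite_self, norm_zero, ne_eq,
      OfNat.ofNat_ne_zero, not_false_eq_true, zero_pow, Finset.sum_const_zero]
    positivity

/-- The part of `fold` that spreads over the possible answers. -/
noncomputable def foldMean (κ : Bool × β × S) (g : DB β S → ℂ) (α : DB β S) : ℂ :=
  if α κ.2.1 = none then rowMean κ g α
  else if (rowVal κ.1 κ.2.2 (α κ.2.1)).isSome then -((rtCard S)⁻¹ * rowMean κ g α) else 0

/-- The remainder of `fold` is diagonal, so it moves no weight to bad databases; only `foldMean` has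
to be estimated. -/
lemma norm_fold_sub_foldMean_le (κ : Bool × β × S) (g : DB β S → ℂ) (α : DB β S) :
    ‖fold κ g α - foldMean κ g α‖ ≤ ‖g α‖ := by
  unfold fold foldMean
  split_ifs <;> simp

/-- If the database is bad without the queried block, the whole row of `g` vanishes. Otherwise the
empty entry is good, and at most ε s answers carry the value of modulus |mean|/√s. -/
lemma sum_bad_foldMean_le [Nonempty S] (κ : Bool × β × S) (g : DB β S → ℂ) (Bad : DB β S → Prop)
    [DecidablePred Bad] (ε : ℝ) (hε : 0 ≤ ε)
    (hg : ∀ α, Bad (Function.update α κ.2.1 none) → g α = 0)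
    (hcount : ∀ α : DB β S, α κ.2.1 = none → ¬ Bad α →
      (∃ z, g (Function.update α κ.2.1 (some (edge κ.1 κ.2.2 z))) ≠ 0) →
      ((Finset.univ.filter fun z : S =>
        Bad (Function.update α κ.2.1 (some (edge κ.1 κ.2.2 z)))).card : ℝ) ≤
          ε * Fintype.card S) :
    ∑ α, ‖if Bad α then foldMean κ g α else 0‖ ^ 2 ≤ ε * ∑ α, ‖g α‖ ^ 2 := by
  rw [sum_normSq_split κ, sum_normSq_split κ, Finset.mul_sum]
  refine Finset.sum_le_sum fun α hα => ?_
  have hα : α κ.2.1 = none := by simpa using hα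
  have hu : Function.update α κ.2.1 none = α := by rw [← hα, Function.update_eq_self]
  have hzero : ∀ k, k ≠ κ.2.2 → ∀ z,
      foldMean κ g (Function.update α κ.2.1 (some (edge κ.1 k z))) = 0 := by
    intro k hk z
    simp [foldMean, hk]
  have hval : ∀ z, foldMean κ g (Function.update α κ.2.1 (some (edge κ.1 κ.2.2 z))) =
      -((rtCard S)⁻¹ * rowMean κ g α) := by
    intro z
    simp [foldMean, rowMean_update]
  have hnone : foldMean κ g (Function.update α κ.2.1 none) = rowMean κ g α := by
    simp [foldMean, rowMean_update]
  rw [Finset.sum_eq_single κ.2.2 (by intro k _ hk; simp [hzero k hk]) (by simp), hnone]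
  simp only [hval]
  set c := fun z => g (Function.update α κ.2.1 (some (edge κ.1 κ.2.2 z))) with hc
  have hrow := row_le_sum_normSq κ g α
  have hm : ‖rowMean κ g α‖ ^ 2 ≤ ∑ z, ‖c z‖ ^ 2 := by
    have := sum_norm_add_sq c 0
    have h0 : 0 ≤ ∑ z, ‖c z + (rtCard S)⁻¹ * (0 - (rtCard S)⁻¹ * ∑ z, c z)‖ ^ 2 := by positivity
    rw [this] at h0
    simp only [rowMean]
    simp only [norm_zero] at h0
    linarith
  by_cases hz : ¬ Bad α ∧ ∃ z, c z ≠ 0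
  · have hcnt := hcount α hα hz.1 hz.2
    have hterm : ∀ z, ‖if Bad (Function.update α κ.2.1 (some (edge κ.1 κ.2.2 z))) then
        -((rtCard S)⁻¹ * rowMean κ g α) else 0‖ ^ 2 =
        if Bad (Function.update α κ.2.1 (some (edge κ.1 κ.2.2 z))) then
          (Fintype.card S : ℝ)⁻¹ * ‖rowMean κ g α‖ ^ 2 else 0 := by
      intro z
      split_ifs with hb
      · rw [norm_neg, norm_mul, mul_pow, norm_inv, inv_pow, normSq_rtCard]
      · simp
    rw [hu, if_neg hz.1, Finset.sum_congr rfl fun z _ => hterm z, ← Finset.sum_filter,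
      Finset.sum_const, nsmul_eq_mul]
    have hcard : (0 : ℝ) < Fintype.card S := by exact_mod_cast Fintype.card_pos
    rw [norm_zero, zero_pow two_ne_zero, zero_add]
    refine (mul_le_mul_of_nonneg_right hcnt (by positivity)).trans ?_
    have h2 : ε * (Fintype.card S : ℝ) * ((Fintype.card S : ℝ)⁻¹ * ‖rowMean κ g α‖ ^ 2) =
        ε * ‖rowMean κ g α‖ ^ 2 := by
      field_simp
    rw [h2]
    refine mul_le_mul_of_nonneg_left ?_ hε
    exact (hm.trans hrow).trans (le_add_of_nonneg_left (sq_nonneg _))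
  · have hm0 : rowMean κ g α = 0 := by
      by_cases hb : Bad α
      · have : ∀ z, g (Function.update α κ.2.1 (some (edge κ.1 κ.2.2 z))) = 0 := fun z =>
          hg _ (by simpa [hu] using hb)
        simp [rowMean, this]
      · have : ∀ z, c z = 0 := by
          intro z
          by_contra h
          exact hz ⟨hb, z, h⟩
        simp only [hc] at this
        simp [rowMean, this]
    simp only [hm0, mul_zero, neg_zero, ite_self, norm_zero, ne_eq,
      OfNat.ofNat_ne_zero, not_false_eq_true, zero_pow, Finset.sum_const_zero, add_zero]
    exact mul_nonneg hε (add_nonneg (sq_nonneg _)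
      (Finset.sum_nonneg fun _ _ => Finset.sum_nonneg fun _ _ => sq_nonneg _))

end Database

/-! ### Averages over the permutations of a block, and the functions that represent a database
entry. -/

/-- A real kernel whose Gram matrix is a projection is a contraction. -/
lemma sum_normSq_kernel_le {T ι : Type*} [Fintype T] [Fintype ι] [DecidableEq ι]
    (K : Matrix T ι ℝ) (hK : (K.transpose * K) * (K.transpose * K) = K.transpose * K) (f : ι → ℂ) :
    ∑ h, ‖∑ a, (K h a : ℂ) * f a‖ ^ 2 ≤ ∑ a, ‖f a‖ ^ 2 := by
  have key : ∀ g : ι → ℝ, ∑ h, (∑ a, K h a * g a) ^ 2 ≤ ∑ a, g a ^ 2 := by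
    intro g
    set P := K.transpose * K with hP
    have hPt : P.transpose = P := by rw [hP, Matrix.transpose_mul, Matrix.transpose_transpose]
    have e1 : ∑ h, (∑ a, K h a * g a) ^ 2 = g ⬝ᵥ P.mulVec g := by
      have : ∑ h, (∑ a, K h a * g a) ^ 2 = K.mulVec g ⬝ᵥ K.mulVec g := by
        simp [dotProduct, Matrix.mulVec, sq]
      rw [this, Matrix.dotProduct_mulVec, ← Matrix.mulVec_transpose, dotProduct_comm,
        Matrix.mulVec_mulVec]
    have e2 : P.mulVec g ⬝ᵥ P.mulVec g = g ⬝ᵥ P.mulVec g := by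
      rw [Matrix.dotProduct_mulVec, ← Matrix.mulVec_transpose, dotProduct_comm,
        Matrix.mulVec_mulVec, hPt, hK]
    -- For the projection P this reads ⟨g, P g⟩ ≤ ⟨g, g⟩, and ⟨g, P g⟩ is the squared norm of K g.
    have e3 : (0 : ℝ) ≤ (g - P.mulVec g) ⬝ᵥ (g - P.mulVec g) := by
      simp only [dotProduct]
      exact Finset.sum_nonneg fun i _ => mul_self_nonneg _
    have e4 : ∑ a, g a ^ 2 = g ⬝ᵥ g := by simp [dotProduct, sq]
    rw [sub_dotProduct, dotProduct_sub, dotProduct_sub, e2, dotProduct_comm (P.mulVec g) g] at e3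
    rw [e1, e4]
    linarith
  -- The kernel is real, so real and imaginary parts are treated separately.
  have hre := key fun a => (f a).re
  have him := key fun a => (f a).im
  have h1 : ∀ h, ‖∑ a, (K h a : ℂ) * f a‖ ^ 2 =
      (∑ a, K h a * (f a).re) ^ 2 + (∑ a, K h a * (f a).im) ^ 2 := by
    intro h
    rw [Complex.sq_norm, Complex.normSq_apply]
    simp [Complex.re_sum, Complex.im_sum, sq]
  have h2 : ∀ a, ‖f a‖ ^ 2 = (f a).re ^ 2 + (f a).im ^ 2 := by
    intro a
    rw [Complex.sq_norm, Complex.normSq_apply, sq, sq]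
  simp only [h1, h2, Finset.sum_add_distrib]
  linarith

section Perm

variable {S : Type*} [Fintype S] [DecidableEq S]

/-- The permutations that fix a point. -/
def stab (k : S) : Finset (Equiv.Perm S) := Finset.univ.filter fun π => π k = k

lemma stab_card_ne_zero (k : S) : (stab k).card ≠ 0 :=
  Finset.card_ne_zero.2 ⟨1, by simp [stab]⟩

/-- Under a uniform permutation that fixes `k`, the image of `i` is uniform on the points other than
`k`: the sum does not depend on `i`, by composing with transpositions. -/
lemma sum_stab_apply {k i : S} (hi : i ≠ k) (g : S → ℝ) :
    ((Fintype.card S : ℝ) - 1) * ∑ π ∈ stab k, g (π i) =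
      (stab k).card * ∑ j with j ≠ k, g j := by
  have h1 : ∀ j, j ≠ k → ∑ π ∈ stab k, g (π i) = ∑ π ∈ stab k, g (π j) := by
    intro j hj
    refine Finset.sum_bij' (fun π _ => π * Equiv.swap i j) (fun π _ => π * Equiv.swap i j)
      ?_ ?_ ?_ ?_ ?_
    all_goals simp only [stab, Finset.mem_filter, Finset.mem_univ, true_and]
    · intro π hπ
      simp [Equiv.swap_apply_of_ne_of_ne hi.symm hj.symm, hπ]
    · intro π hπ
      simp [Equiv.swap_apply_of_ne_of_ne hi.symm hj.symm, hπ]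
    · intro π _; simp [mul_assoc]
    · intro π _; simp [mul_assoc]
    · intro π _; simp
  have hcard : ((Finset.univ.filter fun j : S => j ≠ k).card : ℝ) = (Fintype.card S : ℝ) - 1 := by
    rw [Finset.filter_ne', Finset.card_erase_of_mem (Finset.mem_univ _), Finset.card_univ,
      Nat.cast_sub (Fintype.card_pos_iff.2 ⟨k⟩), Nat.cast_one]
  calc ((Fintype.card S : ℝ) - 1) * ∑ π ∈ stab k, g (π i)
      = ∑ j with j ≠ k, ∑ π ∈ stab k, g (π i) := by
        rw [Finset.sum_const, nsmul_eq_mul, hcard]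
    _ = ∑ j with j ≠ k, ∑ π ∈ stab k, g (π j) :=
        Finset.sum_congr rfl fun j hj => h1 j (by simpa using hj)
    _ = ∑ π ∈ stab k, ∑ j with j ≠ k, g (π j) := Finset.sum_comm
    _ = ∑ π ∈ stab k, ∑ j with j ≠ k, g j := by
        refine Finset.sum_congr rfl fun π hπ => ?_
        have hπ : π k = k := by simpa [stab] using hπ
        refine Finset.sum_bij (fun j _ => π j) ?_ ?_ ?_ ?_
        · intro j hj
          have hj : j ≠ k := by simpa using hj
          simp only [Finset.mem_filter, Finset.mem_univ, true_and]
          exact fun h => hj (π.injective (h.trans hπ.symm))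
        · intro a _ b _ h; exact π.injective h
        · intro j hj
          have hj : j ≠ k := by simpa using hj
          refine ⟨π.symm j, ?_, by simp⟩
          simp only [Finset.mem_filter, Finset.mem_univ, true_and]
          intro h
          exact hj (by rw [← π.apply_symm_apply j, h, hπ])
        · intro j _; rfl
    _ = _ := by rw [Finset.sum_const, nsmul_eq_mul]

/-- The count does not depend on `j`, by composing with transpositions, and the counts for all `j`
add up to the number of permutations. -/
lemma card_mul_sum_perm (i j : S) :
    (Fintype.card S : ℝ) * ∑ σ : Equiv.Perm S, (if σ i = j then (1 : ℝ) else 0) =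
      Fintype.card (Equiv.Perm S) := by
  have h1 : ∀ j', ∑ σ : Equiv.Perm S, (if σ i = j then (1 : ℝ) else 0) =
      ∑ σ : Equiv.Perm S, (if σ i = j' then (1 : ℝ) else 0) := by
    intro j'
    rw [← Equiv.sum_comp (Equiv.mulLeft (Equiv.swap j j'))]
    refine Finset.sum_congr rfl fun σ _ => ?_
    simp only [Equiv.coe_mulLeft, Equiv.Perm.mul_apply, Equiv.swap_apply_eq_iff,
      Equiv.swap_apply_left]
  calc _ = ∑ j' : S, ∑ σ : Equiv.Perm S, (if σ i = j' then (1 : ℝ) else 0) := by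
        rw [← Finset.sum_congr rfl fun j' _ => h1 j']
        simp
    _ = _ := by
        rw [Finset.sum_comm]
        simp

/-- The same symmetry with `σ i = j` fixed: the image of `i'` is uniform on the s - 1 points other
than `j`. -/
lemma card_mul_sum_perm_pair {i i' j j' : S} (hi : i ≠ i') (hj : j ≠ j') :
    (Fintype.card S : ℝ) * (((Fintype.card S : ℝ) - 1) *
      ∑ σ : Equiv.Perm S, (if σ i = j then (1 : ℝ) else 0) * (if σ i' = j' then 1 else 0)) =
      Fintype.card (Equiv.Perm S) := by
  rw [← card_mul_sum_perm i j]
  congr 1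
  have h1 : ∀ l, l ≠ j →
      ∑ σ : Equiv.Perm S, (if σ i = j then (1 : ℝ) else 0) * (if σ i' = j' then 1 else 0) =
      ∑ σ : Equiv.Perm S, (if σ i = j then (1 : ℝ) else 0) * (if σ i' = l then 1 else 0) := by
    intro l hl
    rw [← Equiv.sum_comp (Equiv.mulLeft (Equiv.swap j' l))]
    refine Finset.sum_congr rfl fun σ _ => ?_
    simp only [Equiv.coe_mulLeft, Equiv.Perm.mul_apply, Equiv.swap_apply_eq_iff,
      Equiv.swap_apply_left, Equiv.swap_apply_of_ne_of_ne hj hl.symm]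
  have hcard : ((Finset.univ.filter fun l : S => l ≠ j).card : ℝ) = (Fintype.card S : ℝ) - 1 := by
    rw [Finset.filter_ne', Finset.card_erase_of_mem (Finset.mem_univ _), Finset.card_univ,
      Nat.cast_sub (Fintype.card_pos_iff.2 ⟨j⟩), Nat.cast_one]
  calc _ = ∑ l with l ≠ j, ∑ σ : Equiv.Perm S,
        (if σ i = j then (1 : ℝ) else 0) * (if σ i' = l then 1 else 0) := by
        rw [← Finset.sum_congr rfl fun l hl => h1 l (by simpa using hl), Finset.sum_const,
          nsmul_eq_mul, hcard]
    _ = _ := by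
        rw [Finset.sum_comm]
        refine Finset.sum_congr rfl fun σ _ => ?_
        rw [← Finset.mul_sum]
        split_ifs with h
        · have : σ i' ≠ j := fun h' => hi (σ.injective (h.trans h'.symm))
          simp [this]
        · simp

/-- Multiplication of a permutation by `π` on the side of the inputs of direction `d`. -/
def tw (d : Bool) (σ π : Equiv.Perm S) : Equiv.Perm S := if d then π⁻¹ * σ else σ * π

lemma permVal_tw (d : Bool) (k : S) (σ π : Equiv.Perm S) :
    permVal d k (tw d σ π) = permVal d (π k) σ := by
  cases d <;> simp [permVal, tw, ← Equiv.Perm.inv_def]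

lemma sum_permVal_eq (d : Bool) (σ : Equiv.Perm S) (z : S) :
    ∑ k, (if permVal d k σ = z then (1 : ℝ) else 0) = 1 := by
  cases d
  · simp only [permVal, Bool.false_eq_true, if_false]
    rw [Equiv.sum_comp σ fun k => if k = z then (1 : ℝ) else 0]
    simp
  · simp only [permVal, if_true]
    rw [Equiv.sum_comp σ.symm fun k => if k = z then (1 : ℝ) else 0]
    simp

/-- The function of a permutation of a block that represents a database entry. -/
noncomputable def jl (σ : Equiv.Perm S) (o : Option (S × S)) : ℝ :=
  o.elim 1 fun e => Real.sqrt (Fintype.card S) *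
    ((if σ e.1 = e.2 then 1 else 0) - (Fintype.card S : ℝ)⁻¹)

@[simp] lemma jl_none (σ : Equiv.Perm S) : jl σ none = 1 := rfl

lemma jl_edge (d : Bool) (k z : S) (σ : Equiv.Perm S) :
    jl σ (some (edge d k z)) = Real.sqrt (Fintype.card S) *
      ((if permVal d k σ = z then 1 else 0) - (Fintype.card S : ℝ)⁻¹) := by
  cases d
  · simp [jl, edge, permVal]
  · have : (σ z = k) = (σ.symm k = z) := by
      rw [Equiv.symm_apply_eq]
      exact propext eq_comm
    simp [jl, edge, permVal, this]

/-- The entries of a row are linearly dependent: the uniform component of a row is invisible to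
`jmap`, which is what allows `expand` to discard it. -/
lemma sum_jl_edge [Nonempty S] (d : Bool) (k : S) (σ : Equiv.Perm S) :
    ∑ z, jl σ (some (edge d k z)) = 0 := by
  simp [jl_edge, ← Finset.mul_sum]

/-- Averaging over the permutations that fix the queried point. -/
lemma sum_stab_jl (hS : 1 < Fintype.card S) (d : Bool) {k i : S} (hi : i ≠ k) (z : S)
    (σ : Equiv.Perm S) :
    ∑ π ∈ stab k, jl (tw d σ π) (some (edge d i z)) =
      (stab k).card * (-((Fintype.card S : ℝ) - 1)⁻¹ * jl σ (some (edge d k z))) := by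
  have hc : (Fintype.card S : ℝ) - 1 ≠ 0 := by
    have : (1 : ℝ) < Fintype.card S := by exact_mod_cast hS
    linarith
  have hc' : (Fintype.card S : ℝ) ≠ 0 := by
    have : (1 : ℝ) < Fintype.card S := by exact_mod_cast hS
    linarith
  have h := sum_stab_apply hi fun j => (if permVal d j σ = z then (1 : ℝ) else 0)
  -- Exactly one position has the answer `z`; it is either `k` or one of the others.
  have h2 : ∑ j with j ≠ k, (if permVal d j σ = z then (1 : ℝ) else 0) =
      1 - if permVal d k σ = z then (1 : ℝ) else 0 := by
    have := sum_permVal_eq d σ z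
    rw [← Finset.add_sum_erase _ _ (Finset.mem_univ k)] at this
    rw [Finset.filter_ne']
    linarith
  rw [h2] at h
  simp only [jl_edge, permVal_tw, ← Finset.mul_sum, Finset.sum_sub_distrib, Finset.sum_const,
    nsmul_eq_mul]
  have h3 : ∑ π ∈ stab k, (if permVal d (π i) σ = z then (1 : ℝ) else 0) =
      ((Fintype.card S : ℝ) - 1)⁻¹ * ((stab k).card *
        (1 - if permVal d k σ = z then (1 : ℝ) else 0)) := by
    rw [← h, ← mul_assoc, inv_mul_cancel₀ hc, one_mul]
  rw [h3]
  field_simp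
  ring

/-- The rescaled version of `jl`, with an idempotent Gram matrix. -/
noncomputable def jlc (σ : Equiv.Perm S) (o : Option (S × S)) : ℝ :=
  o.elim 1 fun e => Real.sqrt ((Fintype.card S : ℝ) - 1) *
    ((if σ e.1 = e.2 then 1 else 0) - (Fintype.card S : ℝ)⁻¹)

/-- The projection onto the vectors of sum zero. -/
noncomputable def cent (i j : S) : ℝ := (if i = j then 1 else 0) - (Fintype.card S : ℝ)⁻¹

lemma sum_cent_mul [Nonempty S] (i j : S) : ∑ l, cent i l * cent l j = cent i j := by
  have h1 : ∀ l : S, cent i l * cent l j = (if i = l then (if l = j then 1 else 0) else 0) -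
      (Fintype.card S : ℝ)⁻¹ * (if i = l then 1 else 0) -
      (Fintype.card S : ℝ)⁻¹ * (if l = j then 1 else 0) +
      (Fintype.card S : ℝ)⁻¹ * (Fintype.card S : ℝ)⁻¹ := by
    intro l
    simp only [cent]
    split_ifs <;> ring
  have hc : (Fintype.card S : ℝ) ≠ 0 := by simp
  simp only [h1, Finset.sum_add_distrib, Finset.sum_sub_distrib, ← Finset.mul_sum]
  simp only [Finset.sum_ite_eq, Finset.sum_ite_eq', Finset.mem_univ, if_true, Finset.sum_const,
    Finset.card_univ, nsmul_eq_mul, cent]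
  field_simp
  ring

/-- The Gram matrix of `jlc`. -/
noncomputable def jGram (o o' : Option (S × S)) : ℝ :=
  o.elim (o'.elim 1 fun _ => 0) fun e => o'.elim 0 fun e' => cent e.1 e'.1 * cent e.2 e'.2

lemma sum_jGram_mul [Nonempty S] (o o' : Option (S × S)) :
    ∑ u, jGram o u * jGram u o' = jGram o o' := by
  rcases o with _ | ⟨i, j⟩ <;> rcases o' with _ | ⟨i', j'⟩ <;>
    simp only [Fintype.sum_option, jGram, Option.elim_none, Option.elim_some, mul_zero, zero_mul,
      Finset.sum_const_zero, add_zero, zero_add, mul_one]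
  rw [Fintype.sum_prod_type]
  simp only [← sum_cent_mul i i', ← sum_cent_mul j j', Finset.sum_mul_sum]
  exact Finset.sum_congr rfl fun _ _ => Finset.sum_congr rfl fun _ _ => by ring

/-- The probability that σ i = j and σ i' = j' is 1/s, 0 or 1/(s(s - 1)) according to whether both,
exactly one or none of i = i', j = j' hold. The normalization √(s - 1) turns the covariances into
the product of two centring projections. -/
lemma sum_jlc_mul (hS : 1 < Fintype.card S) (o o' : Option (S × S)) :
    ∑ σ : Equiv.Perm S, jlc σ o * jlc σ o' = Fintype.card (Equiv.Perm S) * jGram o o' := by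
  have h1 : (1 : ℝ) < Fintype.card S := by exact_mod_cast hS
  have hc : (Fintype.card S : ℝ) - 1 ≠ 0 := by linarith
  have hc' : (Fintype.card S : ℝ) ≠ 0 := by linarith
  have hA : ∀ i j : S, ∑ σ : Equiv.Perm S, (if σ i = j then (1 : ℝ) else 0) =
      (Fintype.card S : ℝ)⁻¹ * Fintype.card (Equiv.Perm S) := by
    intro i j
    rw [← card_mul_sum_perm i j, ← mul_assoc, inv_mul_cancel₀ hc', one_mul]
  have hz : ∀ i j : S, ∑ σ : Equiv.Perm S,
      ((if σ i = j then (1 : ℝ) else 0) - (Fintype.card S : ℝ)⁻¹) = 0 := by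
    intro i j
    rw [Finset.sum_sub_distrib, hA]
    simp only [Finset.sum_const, Finset.card_univ, nsmul_eq_mul]
    ring
  rcases o with _ | ⟨i, j⟩ <;> rcases o' with _ | ⟨i', j'⟩ <;>
    simp only [jlc, jGram, Option.elim_none, Option.elim_some, one_mul, mul_one]
  · simp
  · rw [← Finset.mul_sum, hz, mul_zero, mul_zero]
  · rw [← Finset.mul_sum, hz, mul_zero, mul_zero]
  · have hexp : ∀ σ : Equiv.Perm S,
        Real.sqrt ((Fintype.card S : ℝ) - 1) * ((if σ i = j then 1 else 0) - (Fintype.card S : ℝ)⁻¹) *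
        (Real.sqrt ((Fintype.card S : ℝ) - 1) *
          ((if σ i' = j' then 1 else 0) - (Fintype.card S : ℝ)⁻¹)) =
        ((Fintype.card S : ℝ) - 1) * ((if σ i = j then (1 : ℝ) else 0) * (if σ i' = j' then 1 else 0)
          - (Fintype.card S : ℝ)⁻¹ * (if σ i = j then 1 else 0)
          - (Fintype.card S : ℝ)⁻¹ * (if σ i' = j' then 1 else 0)
          + (Fintype.card S : ℝ)⁻¹ * (Fintype.card S : ℝ)⁻¹) := by
      intro σ
      have := Real.mul_self_sqrt (show (0 : ℝ) ≤ (Fintype.card S : ℝ) - 1 by linarith)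
      calc _ = (Real.sqrt ((Fintype.card S : ℝ) - 1) * Real.sqrt ((Fintype.card S : ℝ) - 1)) *
            (((if σ i = j then 1 else 0) - (Fintype.card S : ℝ)⁻¹) *
              ((if σ i' = j' then 1 else 0) - (Fintype.card S : ℝ)⁻¹)) := by ring
        _ = _ := by rw [this]; ring
    simp only [hexp, ← Finset.mul_sum, Finset.sum_add_distrib, Finset.sum_sub_distrib, hA,
      Finset.sum_const, Finset.card_univ, nsmul_eq_mul]
    have hB : ∑ σ : Equiv.Perm S, (if σ i = j then (1 : ℝ) else 0) * (if σ i' = j' then 1 else 0) =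
        Fintype.card (Equiv.Perm S) * (if i = i' then (if j = j' then (Fintype.card S : ℝ)⁻¹ else 0)
          else (if j = j' then 0 else (Fintype.card S : ℝ)⁻¹ * ((Fintype.card S : ℝ) - 1)⁻¹)) := by
      by_cases hi : i = i' <;> by_cases hj : j = j'
      · subst hi hj
        simp only [if_true, mul_ite, mul_one, mul_zero]
        rw [← mul_comm (Fintype.card S : ℝ)⁻¹, ← hA i j]
        refine Finset.sum_congr rfl fun σ _ => ?_
        split_ifs <;> rfl
      · subst hi
        simp only [if_true, hj, if_false, mul_zero]
        refine Finset.sum_eq_zero fun σ _ => ?_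
        split_ifs with h h' <;> simp_all
      · subst hj
        simp only [if_true, hi, if_false, mul_zero]
        refine Finset.sum_eq_zero fun σ _ => ?_
        split_ifs with h h'
        · exact absurd (σ.injective (h.trans h'.symm)) hi
        all_goals simp_all
      · simp only [hi, hj, if_false]
        rw [← card_mul_sum_perm_pair hi hj]
        field_simp
    rw [hB]
    simp only [cent]
    by_cases hi : i = i' <;> by_cases hj : j = j' <;> simp only [hi, hj, if_true, if_false] <;>
      field_simp <;> ring

end Perm

/-! ### States of the block permutations that are represented by databases. -/

section Blocks

variable {β S : Type*} [Fintype β] [DecidableEq β] [Fintype S] [DecidableEq S]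

/-- The normalization of the uniform superposition over the permutations of all the blocks. -/
noncomputable def permNorm (β S : Type*) [Fintype β] [DecidableEq β] [Fintype S]
    [DecidableEq S] : ℂ :=
  (((Real.sqrt (Fintype.card (β → Equiv.Perm S)))⁻¹ : ℝ) : ℂ)

/-- The product of the entries of a database outside of a block. -/
noncomputable def jrest (b : β) (h : β → Equiv.Perm S) (α : DB β S) : ℝ :=
  ∏ b' ∈ Finset.univ.erase b, jl (h b') (α b')

lemma jrest_update_right (b : β) (h : β → Equiv.Perm S) (α : DB β S) (o : Option (S × S)) :
    jrest b h (Function.update α b o) = jrest b h α :=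
  Finset.prod_congr rfl fun b' hb => by simp [Function.update_of_ne (Finset.ne_of_mem_erase hb)]

lemma jrest_update_left (b : β) (h : β → Equiv.Perm S) (α : DB β S) (σ : Equiv.Perm S) :
    jrest b (Function.update h b σ) α = jrest b h α :=
  Finset.prod_congr rfl fun b' hb => by simp [Function.update_of_ne (Finset.ne_of_mem_erase hb)]

lemma prod_jl_eq (b : β) (h : β → Equiv.Perm S) (α : DB β S) (o : Option (S × S)) :
    ∏ b', jl (h b') (Function.update α b o b') = jl (h b) o * jrest b h α := by
  rw [← Finset.mul_prod_erase _ _ (Finset.mem_univ b), Function.update_self,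
    ← jrest_update_right b h α o]
  rfl

/-- The state of the permutations that is represented by a superposition of databases. -/
noncomputable def jmap (f : DB β S → ℂ) (h : β → Equiv.Perm S) : ℂ :=
  permNorm β S * ∑ α, ((∏ b, jl (h b) (α b) : ℝ) : ℂ) * f α

/-- The state of the permutations that is represented by a superposition of databases in which the
queried pair is recorded. -/
noncomputable def kmap (κ : Bool × β × S) (g : DB β S → ℂ) (h : β → Equiv.Perm S) : ℂ :=
  permNorm β S * ∑ α : DB β S with α κ.2.1 = none, (jrest κ.2.1 h α : ℂ) * (rtCard S *
    g (Function.update α κ.2.1 (some (edge κ.1 κ.2.2 (permVal κ.1 κ.2.2 (h κ.2.1))))))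

/-- The average over the permutations of the queried block with the same answer. -/
noncomputable def resample (κ : Bool × β × S) (F : (β → Equiv.Perm S) → ℂ)
    (h : β → Equiv.Perm S) : ℂ :=
  ((stab κ.2.2).card : ℂ)⁻¹ * ∑ π ∈ stab κ.2.2, F (Function.update h κ.2.1 (tw κ.1 (h κ.2.1) π))

lemma jmap_eq (κ : Bool × β × S) (f : DB β S → ℂ) (h : β → Equiv.Perm S) :
    jmap f h = permNorm β S * ∑ α : DB β S with α κ.2.1 = none, (jrest κ.2.1 h α : ℂ) *
      (f (Function.update α κ.2.1 none) + ∑ k, ∑ z, (jl (h κ.2.1) (some (edge κ.1 k z)) : ℂ) *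
        f (Function.update α κ.2.1 (some (edge κ.1 k z)))) := by
  rw [jmap, sum_db_split κ]
  congr 1
  refine Finset.sum_congr rfl fun α _ => ?_
  simp only [prod_jl_eq, jl_none, one_mul, mul_add, Finset.mul_sum, Complex.ofReal_mul]
  congr 1
  refine Finset.sum_congr rfl fun k _ => Finset.sum_congr rfl fun z _ => by ring

lemma jmap_add (f g : DB β S → ℂ) (h : β → Equiv.Perm S) :
    jmap (f + g) h = jmap f h + jmap g h := by
  simp [jmap, mul_add, Finset.sum_add_distrib]

/-- Entries at the queried position depend only on the answer, which the averaging preserves. An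
entry at another position averages, by `sum_stab_jl`, to -1/(s - 1) times the entry at the queried
position with the same answer. -/
lemma resample_jmap (hS : 1 < Fintype.card S) (κ : Bool × β × S) (f : DB β S → ℂ)
    (h : β → Equiv.Perm S) :
    resample κ (jmap f) h = jmap (keep κ f) h + jmap (spill κ f) h := by
  have hst : ((stab κ.2.2).card : ℂ) ≠ 0 := by exact_mod_cast stab_card_ne_zero κ.2.2
  have hjk : ∀ z, ∑ π ∈ stab κ.2.2, (jl (tw κ.1 (h κ.2.1) π) (some (edge κ.1 κ.2.2 z)) : ℂ) =
      (stab κ.2.2).card * (jl (h κ.2.1) (some (edge κ.1 κ.2.2 z)) : ℂ) := by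
    intro z
    rw [← nsmul_eq_mul, ← Finset.sum_const]
    refine Finset.sum_congr rfl fun π hπ => ?_
    have : π κ.2.2 = κ.2.2 := by simpa [stab] using hπ
    rw [jl_edge, jl_edge, permVal_tw, this]
  have hjo : ∀ k z, k ≠ κ.2.2 →
      ∑ π ∈ stab κ.2.2, (jl (tw κ.1 (h κ.2.1) π) (some (edge κ.1 k z)) : ℂ) =
      (stab κ.2.2).card * (-((Fintype.card S : ℂ) - 1)⁻¹ *
        (jl (h κ.2.1) (some (edge κ.1 κ.2.2 z)) : ℂ)) := by
    intro k z hk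
    have := congrArg (fun x : ℝ => (x : ℂ)) (sum_stab_jl hS κ.1 hk z (h κ.2.1))
    push_cast at this ⊢
    exact this
  rw [← jmap_add, jmap_eq κ, resample]
  simp only [jmap_eq κ, jrest_update_left, Function.update_self]
  rw [← Finset.mul_sum, mul_left_comm, Finset.sum_comm]
  congr 1
  rw [Finset.mul_sum]
  refine Finset.sum_congr rfl fun α _ => ?_
  rw [← Finset.mul_sum, mul_left_comm]
  congr 1
  rw [Finset.sum_add_distrib, Finset.sum_const, nsmul_eq_mul, mul_add, ← mul_assoc,
    inv_mul_cancel₀ hst, one_mul]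
  simp only [Pi.add_apply, keep_none, spill_none, add_zero, keep_edge, spill_edge]
  congr 1
  rw [Finset.sum_comm]
  simp only [Finset.sum_comm (s := stab κ.2.2)]
  simp only [← Finset.sum_mul]
  have hR : (∑ k, ∑ z, (jl (h κ.2.1) (some (edge κ.1 k z)) : ℂ) *
      ((if k = κ.2.2 then f (Function.update α κ.2.1 (some (edge κ.1 k z))) else 0) +
        if k = κ.2.2 then -((Fintype.card S : ℂ) - 1)⁻¹ *
          ∑ k with k ≠ κ.2.2, f (Function.update α κ.2.1 (some (edge κ.1 k z))) else 0)) =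
      ∑ z, (jl (h κ.2.1) (some (edge κ.1 κ.2.2 z)) : ℂ) *
        (f (Function.update α κ.2.1 (some (edge κ.1 κ.2.2 z))) + -((Fintype.card S : ℂ) - 1)⁻¹ *
          ∑ k with k ≠ κ.2.2, f (Function.update α κ.2.1 (some (edge κ.1 k z)))) := by
    rw [Finset.sum_eq_single κ.2.2 (by intro k _ hk; simp [hk]) (by simp)]
    simp
  rw [hR, ← Finset.add_sum_erase _ _ (Finset.mem_univ κ.2.2)]
  simp only [hjk, Finset.filter_ne']
  rw [Finset.sum_congr rfl fun k hk => Finset.sum_congr rfl fun z _ => by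
    rw [hjo k z (Finset.ne_of_mem_erase hk)]]
  simp only [mul_add, Finset.mul_sum, Finset.sum_add_distrib]
  congr 1
  · refine Finset.sum_congr rfl fun z _ => ?_
    field_simp
  · rw [Finset.sum_comm]
    refine Finset.sum_congr rfl fun z _ => Finset.sum_congr rfl fun k _ => ?_
    field_simp

lemma rtCard_eq : rtCard S = ((Real.sqrt (Fintype.card S) : ℝ) : ℂ) := rfl

/-- Splits the centred indicators of a row into the value at the true answer and the uniform part.
-/
lemma sum_jl_mul [Nonempty S] (d : Bool) (k : S) (σ : Equiv.Perm S) (c : S → ℂ) :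
    ∑ z, (jl σ (some (edge d k z)) : ℂ) * c z =
      rtCard S * c (permVal d k σ) - (rtCard S)⁻¹ * ∑ z, c z := by
  have hr := rtCard_ne_zero (S := S)
  have : ∀ z, (jl σ (some (edge d k z)) : ℂ) * c z =
      rtCard S * (if permVal d k σ = z then c z else 0) - (rtCard S)⁻¹ * c z := by
    intro z
    have h : rtCard S * (Fintype.card S : ℂ)⁻¹ = (rtCard S)⁻¹ := by
      rw [← rtCard_mul_self]
      field_simp
    rw [jl_edge, Complex.ofReal_mul, ← rtCard_eq, ← h]
    split_ifs <;> push_cast <;> ring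
  simp only [this, Finset.sum_sub_distrib, ← Finset.mul_sum]
  simp

/-- By `sum_jl_mul`, centred and uncentred indicators of a row differ by the row mean m; the
correction (a - m)/√s in `expand` restores it and spreads the amplitude a of the empty entry
uniformly. -/
lemma jmap_keep [Nonempty S] (κ : Bool × β × S) (f : DB β S → ℂ) (h : β → Equiv.Perm S) :
    jmap (keep κ f) h = kmap κ (expand κ f) h := by
  have hr := rtCard_ne_zero (S := S)
  rw [jmap_eq κ, kmap]
  congr 1
  refine Finset.sum_congr rfl fun α _ => ?_
  congr 1
  rw [Finset.sum_eq_single (a := κ.2.2) (by intro k _ hk; simp [hk]) (by simp)]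
  simp only [keep_none, keep_edge, if_true, expand_edge]
  rw [sum_jl_mul, rowMean]
  field_simp
  ring

/-- The uncentred indicators consist of the centred ones and a constant; the constant part is the
empty entry, and subtracting a constant from a row does not change `jmap`. -/
lemma kmap_eq_jmap_fold [Nonempty S] (κ : Bool × β × S) (g : DB β S → ℂ)
    (h : β → Equiv.Perm S) : kmap κ g h = jmap (fold κ g) h := by
  have hr := rtCard_ne_zero (S := S)
  rw [jmap_eq κ, kmap]
  congr 1
  refine Finset.sum_congr rfl fun α _ => ?_
  congr 1
  rw [Finset.sum_eq_single (a := κ.2.2) (by intro k _ hk; simp [hk]) (by simp)]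
  simp only [fold_none, fold_edge, if_true, mul_sub, Finset.sum_sub_distrib]
  rw [sum_jl_mul, ← Finset.sum_mul, ← Complex.ofReal_sum, sum_jl_edge, rowMean]
  simp

/-- The value of `rowMean` on the databases that record nothing in the queried block. -/
noncomputable def drop (κ : Bool × β × S) (g : DB β S → ℂ) (α : DB β S) : ℂ :=
  if α κ.2.1 = none then rowMean κ g α else 0

/-- On a function supported on the databases that record the queried input, `kmap` and `jmap`
differ only by the part of sum zero. -/
lemma kmap_sub_jmap [Nonempty S] (κ : Bool × β × S) (g : DB β S → ℂ)
    (hg : ∀ α, ¬ (rowVal κ.1 κ.2.2 (α κ.2.1)).isSome → g α = 0) (h : β → Equiv.Perm S) :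
    kmap κ g h = jmap g h + jmap (drop κ g) h := by
  have hr := rtCard_ne_zero (S := S)
  rw [← jmap_add, jmap_eq κ, kmap]
  congr 1
  refine Finset.sum_congr rfl fun α _ => ?_
  congr 1
  rw [Finset.sum_eq_single (a := κ.2.2)
    (by intro k _ hk; simp [hk, drop, hg (Function.update α κ.2.1 (some (edge κ.1 k _)))])
    (by simp)]
  simp only [Pi.add_apply, drop, Function.update_self, if_true, rowMean_update,
    reduceCtorEq, if_false, add_zero]
  rw [sum_jl_mul, hg (Function.update α κ.2.1 none) (by simp), rowMean]
  ring

/-- The number of recorded pairs. -/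
def dbSize (α : DB β S) : ℕ := (Finset.univ.filter fun b => α b ≠ none).card

/-- With `jlc` in place of `jl` the kernel is a product over independent blocks with projection Gram
matrix, hence a contraction. Each recorded pair costs the factor √(s/(s - 1)) between the two
normalizations, so the squared norm grows by at most (s/(s - 1))^T. -/
lemma sum_normSq_jmap_le (hS : 1 < Fintype.card S) (T : ℕ)
    (hT : ((Fintype.card S : ℝ) / ((Fintype.card S : ℝ) - 1)) ^ T ≤ 4) (f : DB β S → ℂ)
    (hf : ∀ α, f α ≠ 0 → dbSize α ≤ T) :
    ∑ h, ‖jmap f h‖ ^ 2 ≤ 4 * ∑ α, ‖f α‖ ^ 2 := by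
  have : Nonempty S := Fintype.card_pos_iff.1 (by omega)
  have h1 : (1 : ℝ) < Fintype.card S := by exact_mod_cast hS
  set s : ℝ := (Fintype.card S : ℝ) with hs
  have hc : 0 < s - 1 := by linarith
  set c : ℝ := Real.sqrt (s - 1) / Real.sqrt s with hcdef
  have hc0 : 0 < c := by positivity
  have hc2 : c ^ 2 = (s - 1) / s := by
    rw [hcdef, div_pow, Real.sq_sqrt hc.le, Real.sq_sqrt (by linarith)]
  set γ : ℝ := (Real.sqrt (Fintype.card (β → Equiv.Perm S)))⁻¹ with hγ
  have hγ2 : γ * γ * (Fintype.card (β → Equiv.Perm S) : ℝ) = 1 := by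
    rw [hγ, ← mul_inv, Real.mul_self_sqrt (by positivity)]
    exact inv_mul_cancel₀ (by simp)
  obtain ⟨K, hKdef⟩ : ∃ K : Matrix (β → Equiv.Perm S) (DB β S) ℝ,
      ∀ h α, K h α = γ * ∏ b, jlc (h b) (α b) := ⟨Matrix.of fun _ _ => _, fun _ _ => rfl⟩
  have hjlc : ∀ σ (o : Option (S × S)), jlc σ o = (if o ≠ none then c else 1) * jl σ o := by
    intro σ o
    rcases o with _ | e
    · simp [jlc]
    · simp only [jlc, jl, Option.elim_some, ne_eq, reduceCtorEq, not_false_eq_true, if_true, hcdef,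
        ← hs]
      have : Real.sqrt s ≠ 0 := by positivity
      field_simp
  have hgram : ∀ α α', (K.transpose * K) α α' = ∏ b, jGram (α b) (α' b) := by
    intro α α'
    rw [Matrix.mul_apply]
    simp only [Matrix.transpose_apply, hKdef]
    have : ∀ h : β → Equiv.Perm S, γ * (∏ b, jlc (h b) (α b)) * (γ * ∏ b, jlc (h b) (α' b)) =
        γ * γ * ∏ b, (jlc (h b) (α b) * jlc (h b) (α' b)) := by
      intro h
      rw [Finset.prod_mul_distrib]
      ring
    simp only [this, ← Finset.mul_sum]
    have hp := Finset.prod_univ_sum (fun _ : β => (Finset.univ : Finset (Equiv.Perm S)))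
      (fun b σ => jlc σ (α b) * jlc σ (α' b))
    rw [Fintype.piFinset_univ] at hp
    rw [← hp]
    simp only [sum_jlc_mul hS, Finset.prod_mul_distrib, Finset.prod_const, Finset.card_univ]
    rw [Fintype.card_fun] at hγ2
    push_cast at hγ2
    rw [← mul_assoc, hγ2, one_mul]
  have hidem : (K.transpose * K) * (K.transpose * K) = K.transpose * K := by
    ext α α'
    rw [Matrix.mul_apply]
    simp only [hgram]
    have hp := Finset.prod_univ_sum (fun _ : β => (Finset.univ : Finset (Option (S × S))))
      (fun b u => jGram (α b) u * jGram u (α' b))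
    rw [Fintype.piFinset_univ] at hp
    simp only [← Finset.prod_mul_distrib]
    rw [← hp]
    simp only [sum_jGram_mul]
  have hmain := sum_normSq_kernel_le K hidem fun α => ((c ^ dbSize α)⁻¹ : ℝ) * f α
  have hK : ∀ h, jmap f h = ∑ α, (K h α : ℂ) * (((c ^ dbSize α)⁻¹ : ℝ) * f α) := by
    intro h
    rw [jmap, Finset.mul_sum]
    refine Finset.sum_congr rfl fun α _ => ?_
    have : K h α = γ * (c ^ dbSize α * ∏ b, jl (h b) (α b)) := by
      simp only [hKdef, hjlc, Finset.prod_mul_distrib, Finset.prod_ite, Finset.prod_const,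
        one_pow, mul_one, dbSize]
    rw [this, show permNorm β S = (γ : ℂ) from rfl]
    have hcc : ((c ^ dbSize α : ℝ) : ℂ) ≠ 0 := by exact_mod_cast (pow_pos hc0 _).ne'
    push_cast at hcc ⊢
    field_simp
  simp only [hK]
  refine hmain.trans ?_
  rw [Finset.mul_sum]
  refine Finset.sum_le_sum fun α _ => ?_
  by_cases h0 : f α = 0
  · simp [h0]
  · rw [norm_mul, mul_pow, Complex.norm_real, Real.norm_of_nonneg (by positivity)]
    refine mul_le_mul_of_nonneg_right ?_ (by positivity)
    rw [inv_pow, ← pow_mul, mul_comm, pow_mul, hc2, ← inv_pow, inv_div]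
    refine le_trans (pow_le_pow_right₀ ?_ (hf α h0)) hT
    rw [le_div_iff₀ hc]
    linarith

end Blocks

/-! ### One simulated query and its errors. -/

section Simulation

variable {β S X V : Type*} [Fintype β] [DecidableEq β] [Fintype S] [DecidableEq S] [Fintype V]

/-- The direction of a query, the block of its input and the position in the block, when inputs
and outputs are divided into blocks by `lam`. -/
def loc (lam : Bool → (β × S ≃ X)) (q : Bool × X) : Bool × β × S := (q.1, (lam q.1).symm q.2)

/-- The answer to a query that is recorded in a database. -/
def dbAns (lam : Bool → (β × S ≃ X)) (α : DB β S) (q : Bool × X) : Option X :=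
  (rowVal q.1 (loc lam q).2.2 (α (loc lam q).2.1)).map fun z => lam (!q.1) ((loc lam q).2.1, z)

/-- The permutation that maps each input block to an output block by a given permutation. -/
def blockPerm (lam : Bool → (β × S ≃ X)) (h : β → Equiv.Perm S) : Equiv.Perm X :=
  (lam false).symm.trans ((Equiv.prodShear (Equiv.refl β) h).trans (lam true))

lemma answer_blockPerm (lam : Bool → (β × S ≃ X)) (h : β → Equiv.Perm S) (q : Bool × X) :
    answer (blockPerm lam h) q =
      lam (!q.1) ((loc lam q).2.1, permVal q.1 (loc lam q).2.2 (h (loc lam q).2.1)) := by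
  rcases q with ⟨_ | _, x⟩ <;> simp [answer, blockPerm, loc, permVal, Equiv.prodShear]

/-- The answer of the permutation given by its blocks. -/
def blockAns (lam : Bool → (β × S ≃ X)) (h : β → Equiv.Perm S) (q : Bool × X) : Option X :=
  some (answer (blockPerm lam h) q)

namespace QStep

variable (Q : QStep X V) (lam : Bool → (β × S ≃ X))

/-- Applies an operator that depends on the location of the query. -/
def onLoc {A B : Type*} (T : Bool × β × S → (A → ℂ) → B → ℂ) (T₀ : (A → ℂ) → B → ℂ)
    (χ : A × V → ℂ) : B × V → ℂ := fun p =>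
  (Q.qry p.2).elim (T₀ (fun a => χ (a, p.2)) p.1) fun q => T (loc lam q) (fun a => χ (a, p.2)) p.1

lemma onLoc_of_none {A B : Type*} (T : Bool × β × S → (A → ℂ) → B → ℂ) (T₀ : (A → ℂ) → B → ℂ)
    (χ : A × V → ℂ) (a : B) {v : V} (hv : Q.qry v = none) :
    Q.onLoc lam T T₀ χ (a, v) = T₀ (fun a => χ (a, v)) a := by
  simp [onLoc, hv]

lemma onLoc_of_some {A B : Type*} (T : Bool × β × S → (A → ℂ) → B → ℂ) (T₀ : (A → ℂ) → B → ℂ)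
    (χ : A × V → ℂ) (a : B) {v : V} {q : Bool × X} (hv : Q.qry v = some q) :
    Q.onLoc lam T T₀ χ (a, v) = T (loc lam q) (fun a => χ (a, v)) a := by
  simp [onLoc, hv]

end QStep

lemma l2_le_of_fiber {A B : Type*} [Fintype A] [Fintype B] (f : A × V → ℂ) (g : B × V → ℂ) {C : ℝ}
    (hC : 0 ≤ C) (h : ∀ v, ∑ a, ‖f (a, v)‖ ^ 2 ≤ C ^ 2 * ∑ b, ‖g (b, v)‖ ^ 2) :
    l2 f ≤ C * l2 g := by
  refine l2_le_mul hC ?_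
  rw [Fintype.sum_prod_type_right, Fintype.sum_prod_type_right, Finset.mul_sum]
  exact Finset.sum_le_sum fun v _ => h v

/-- `jmap`, applied to the database register. -/
noncomputable def jlift (χ : DB β S × V → ℂ) : (β → Equiv.Perm S) × V → ℂ :=
  fun p => jmap (fun α => χ (α, p.2)) p.1

lemma l2_jlift_le (hS : 1 < Fintype.card S) (T : ℕ)
    (hT : ((Fintype.card S : ℝ) / ((Fintype.card S : ℝ) - 1)) ^ T ≤ 4) (χ : DB β S × V → ℂ)
    (hχ : ∀ α v, χ (α, v) ≠ 0 → dbSize α ≤ T) : l2 (jlift χ) ≤ 2 * l2 χ := by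
  refine l2_le_of_fiber _ _ (by norm_num) fun v => ?_
  have := sum_normSq_jmap_le hS T hT (fun α => χ (α, v)) fun α => hχ α v
  norm_num
  exact this

lemma liftU_jlift (Q : QStep X V) (χ : DB β S × V → ℂ) :
    Q.liftU (jlift χ) = jlift (Q.liftU χ) := by
  ext ⟨h, v⟩
  simp only [QStep.liftU, jlift, jmap]
  have : (fun v => permNorm β S * ∑ α : DB β S, ((∏ b, jl (h b) (α b) : ℝ) : ℂ) * χ (α, v)) =
      permNorm β S • ∑ α : DB β S, ((∏ b, jl (h b) (α b) : ℝ) : ℂ) • fun v => χ (α, v) := by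
    ext v
    simp [Finset.sum_apply]
  rw [this, map_smul, map_sum]
  simp [Finset.sum_apply]

/-- `kmap` only evaluates databases in which the true answer is recorded at the queried position, so
the database and the permutation give the same answer. -/
lemma ask_kmap (Q : QStep X V) (lam : Bool → (β × S ≃ X)) (g : DB β S × V → ℂ) :
    Q.ask (blockAns lam) (Q.onLoc lam kmap jmap g) = Q.onLoc lam kmap jmap (Q.ask (dbAns lam) g) := by
  ext ⟨h, v⟩
  rw [QStep.ask_apply]
  rcases hq : Q.qry v with _ | q
  · rw [QStep.onLoc_of_none _ _ _ _ _ _ hq, QStep.onLoc_of_none _ _ _ _ _ _ (by simp [hq])]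
    simp [QStep.ask_apply, hq]
  · rw [QStep.onLoc_of_some _ _ _ _ _ _ hq,
      QStep.onLoc_of_some (q := q) _ _ _ _ _ _ (by simp [hq])]
    rw [kmap, kmap]
    congr 1
    refine Finset.sum_congr rfl fun α _ => ?_
    have : dbAns lam (Function.update α (loc lam q).2.1 (some (edge (loc lam q).1 (loc lam q).2.2
        (permVal (loc lam q).1 (loc lam q).2.2 (h (loc lam q).2.1))))) q = blockAns lam h q := by
      rw [dbAns, blockAns, answer_blockPerm, Function.update_self]
      simp [show (loc lam q).1 = q.1 from rfl]
    simp only [QStep.ask_apply, hq, Option.bind_some, this]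

/-- `resample` is an average of operators that permute the arguments of `F`, each of which is an
isometry. -/
lemma sum_normSq_resample_le (κ : Bool × β × S) (F : (β → Equiv.Perm S) → ℂ) :
    ∑ h, ‖resample κ F h‖ ^ 2 ≤ ∑ h, ‖F h‖ ^ 2 := by
  have hc : (0 : ℝ) < (stab κ.2.2).card := by exact_mod_cast (stab_card_ne_zero κ.2.2).bot_lt
  have hbij : ∀ π : Equiv.Perm S,
      ∑ h : β → Equiv.Perm S, ‖F (Function.update h κ.2.1 (tw κ.1 (h κ.2.1) π))‖ ^ 2 =
        ∑ h, ‖F h‖ ^ 2 := by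
    intro π
    let e : Equiv.Perm (β → Equiv.Perm S) :=
      { toFun := fun h => Function.update h κ.2.1 (tw κ.1 (h κ.2.1) π)
        invFun := fun h => Function.update h κ.2.1 (tw κ.1 (h κ.2.1) π⁻¹)
        left_inv := fun h => by cases κ.1 <;> simp [tw]
        right_inv := fun h => by cases κ.1 <;> simp [tw] }
    exact Equiv.sum_comp e fun h => ‖F h‖ ^ 2
  have h1 : ∀ h, ‖resample κ F h‖ ^ 2 ≤ ((stab κ.2.2).card : ℝ)⁻¹ *
      ∑ π ∈ stab κ.2.2, ‖F (Function.update h κ.2.1 (tw κ.1 (h κ.2.1) π))‖ ^ 2 := by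
    intro h
    rw [resample, norm_mul, mul_pow, norm_inv, Complex.norm_natCast]
    calc _ ≤ ((stab κ.2.2).card : ℝ)⁻¹ ^ 2 * ((stab κ.2.2).card *
          ∑ π ∈ stab κ.2.2, ‖F (Function.update h κ.2.1 (tw κ.1 (h κ.2.1) π))‖ ^ 2) := by
          gcongr
          exact norm_sum_sq_le _ _
      _ = _ := by field_simp
  refine (Finset.sum_le_sum fun h _ => h1 h).trans ?_
  rw [← Finset.mul_sum, Finset.sum_comm, Finset.sum_congr rfl fun π _ => hbij π, Finset.sum_const,
    nsmul_eq_mul, ← mul_assoc, inv_mul_cancel₀ hc.ne', one_mul]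

variable (Q : QStep X V) (lam : Bool → (β × S ≃ X))

/-- The query of the simulation, which leaves the queried pair recorded. -/
noncomputable def simAsk (χ : DB β S × V → ℂ) : DB β S × V → ℂ :=
  Q.ask (dbAns lam) (Q.onLoc lam expand id χ)

lemma l2_onLoc_expand_le [Nonempty S] (χ : DB β S × V → ℂ) :
    l2 (Q.onLoc lam expand id χ) ≤ l2 χ := by
  refine (l2_le_of_fiber _ χ (C := 1) zero_le_one fun v => ?_).trans_eq (one_mul _)
  rw [one_pow, one_mul]
  rcases hq : Q.qry v with _ | q
  · simp [QStep.onLoc_of_none _ _ _ _ _ _ hq]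
  · simp only [QStep.onLoc_of_some _ _ _ _ _ _ hq]
    exact sum_normSq_expand_le _ _

lemma l2_onLoc_fold_le [Nonempty S] (χ : DB β S × V → ℂ) :
    l2 (Q.onLoc lam fold id χ) ≤ l2 χ := by
  refine (l2_le_of_fiber _ χ (C := 1) zero_le_one fun v => ?_).trans_eq (one_mul _)
  rw [one_pow, one_mul]
  rcases hq : Q.qry v with _ | q
  · simp [QStep.onLoc_of_none _ _ _ _ _ _ hq]
  · simp only [QStep.onLoc_of_some _ _ _ _ _ _ hq]
    exact sum_normSq_fold_le _ _

lemma l2_simAsk_le [Nonempty S] (χ : DB β S × V → ℂ) : l2 (simAsk Q lam χ) ≤ l2 χ :=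
  (Q.l2_ask _ _).trans_le (l2_onLoc_expand_le Q lam χ)

lemma l2_onLoc_resample_le (F : (β → Equiv.Perm S) × V → ℂ) :
    l2 (Q.onLoc lam resample id F) ≤ l2 F := by
  refine (l2_le_of_fiber _ F (C := 1) zero_le_one fun v => ?_).trans_eq (one_mul _)
  rw [one_pow, one_mul]
  rcases hq : Q.qry v with _ | q
  · simp [QStep.onLoc_of_none _ _ _ _ _ _ hq]
  · simp only [QStep.onLoc_of_some _ _ _ _ _ _ hq]
    exact sum_normSq_resample_le _ _

lemma onLoc_resample_sub (F G : (β → Equiv.Perm S) × V → ℂ) :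
    Q.onLoc lam resample id (F - G) = Q.onLoc lam resample id F - Q.onLoc lam resample id G := by
  ext ⟨h, v⟩
  rcases hq : Q.qry v with _ | q
  · simp [QStep.onLoc_of_none _ _ _ _ _ _ hq]
  · simp [QStep.onLoc_of_some _ _ _ _ _ _ hq, resample, mul_sub, Finset.sum_sub_distrib]

/-- The part of a superposition of databases that is lost in a query. -/
noncomputable def simSpill (χ : DB β S × V → ℂ) : DB β S × V → ℂ :=
  Q.onLoc lam spill (fun _ _ => 0) χ

lemma l2_simSpill_le (hS : 1 < Fintype.card S) (χ : DB β S × V → ℂ) :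
    l2 (simSpill Q lam χ) ≤ (Real.sqrt ((Fintype.card S : ℝ) - 1))⁻¹ * l2 χ := by
  have h1 : (1 : ℝ) < Fintype.card S := by exact_mod_cast hS
  refine l2_le_of_fiber _ χ (by positivity) fun v => ?_
  rw [inv_pow, Real.sq_sqrt (by linarith), simSpill]
  rcases hq : Q.qry v with _ | q
  · simp only [QStep.onLoc_of_none _ _ _ _ _ _ hq, norm_zero, ne_eq, OfNat.ofNat_ne_zero,
      not_false_eq_true, zero_pow, Finset.sum_const_zero]
    have : (0 : ℝ) < (Fintype.card S : ℝ) - 1 := by linarith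
    positivity
  · simp only [QStep.onLoc_of_some _ _ _ _ _ _ hq]
    exact sum_normSq_spill_le hS _ _

/-- The simulated query represents the real one, up to the lost part. -/
lemma ask_resample_jlift (hS : 1 < Fintype.card S) (χ : DB β S × V → ℂ) :
    Q.ask (blockAns lam) (Q.onLoc lam resample id (jlift χ)) =
      Q.onLoc lam kmap jmap (simAsk Q lam χ) + Q.ask (blockAns lam) (jlift (simSpill Q lam χ)) := by
  have : Nonempty S := Fintype.card_pos_iff.1 (by omega)
  rw [simAsk, ← ask_kmap, ← QStep.ask_add]
  congr 1
  ext ⟨h, v⟩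
  rcases hq : Q.qry v with _ | q
  · simp only [Pi.add_apply, QStep.onLoc_of_none _ _ _ _ _ _ hq, jlift, simSpill, id]
    simp [jmap]
  · simp only [Pi.add_apply, QStep.onLoc_of_some _ _ _ _ _ _ hq, jlift, simSpill]
    rw [← jmap_keep]
    exact resample_jmap hS _ _ _

lemma onLoc_kmap_eq [Nonempty S] (g : DB β S × V → ℂ) :
    Q.onLoc lam kmap jmap g = jlift (Q.onLoc lam fold id g) := by
  ext ⟨h, v⟩
  rcases hq : Q.qry v with _ | q
  · simp only [QStep.onLoc_of_none _ _ _ _ _ _ hq, jlift, id]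
  · simp only [QStep.onLoc_of_some _ _ _ _ _ _ hq, jlift]
    exact kmap_eq_jmap_fold _ _ _

/-- The part of sum zero of a superposition of databases. -/
noncomputable def simDrop (g : DB β S × V → ℂ) : DB β S × V → ℂ :=
  Q.onLoc lam drop (fun _ _ => 0) g

lemma simAsk_eq_zero (χ : DB β S × V → ℂ) (α : DB β S) {v : V} {q : Bool × X}
    (hq : Q.qry v = some q) (hα : ¬ (rowVal q.1 (loc lam q).2.2 (α (loc lam q).2.1)).isSome) :
    simAsk Q lam χ (α, v) = 0 := by
  rw [simAsk, QStep.ask_apply, QStep.onLoc_of_some (q := q) _ _ _ _ _ _ (by simp [hq]), expand]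
  exact if_neg hα

lemma onLoc_kmap_simAsk [Nonempty S] (χ : DB β S × V → ℂ) :
    Q.onLoc lam kmap jmap (simAsk Q lam χ) =
      jlift (simAsk Q lam χ) + jlift (simDrop Q lam (simAsk Q lam χ)) := by
  ext ⟨h, v⟩
  rcases hq : Q.qry v with _ | q
  · simp only [Pi.add_apply, QStep.onLoc_of_none _ _ _ _ _ _ hq, jlift, simDrop]
    simp [jmap]
  · simp only [Pi.add_apply, QStep.onLoc_of_some _ _ _ _ _ _ hq, jlift, simDrop]
    exact kmap_sub_jmap _ _ (fun α hα => simAsk_eq_zero Q lam χ α hq hα) _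

/-- Each row has at most one nonzero amplitude, so its normalized sum is that amplitude divided by
√s. The labels of the verification phase, which contain the answer, are of this kind. -/
lemma l2_simDrop_le [Nonempty S] (g : DB β S × V → ℂ)
    (hg : ∀ α v q, Q.qry v = some q → ∀ z z',
      g (Function.update α (loc lam q).2.1 (some (edge q.1 (loc lam q).2.2 z)), v) ≠ 0 →
      g (Function.update α (loc lam q).2.1 (some (edge q.1 (loc lam q).2.2 z')), v) ≠ 0 → z = z') :
    l2 (simDrop Q lam g) ≤ (Real.sqrt (Fintype.card S))⁻¹ * l2 g := by
  refine l2_le_of_fiber _ g (by positivity) fun v => ?_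
  rw [inv_pow, Real.sq_sqrt (by positivity), simDrop]
  rcases hq : Q.qry v with _ | q
  · simp only [QStep.onLoc_of_none _ _ _ _ _ _ hq, norm_zero, ne_eq, OfNat.ofNat_ne_zero,
      not_false_eq_true, zero_pow, Finset.sum_const_zero]
    positivity
  · simp only [QStep.onLoc_of_some _ _ _ _ _ _ hq]
    rw [sum_normSq_split (loc lam q), sum_normSq_split (loc lam q), Finset.mul_sum]
    refine Finset.sum_le_sum fun α _ => ?_
    have hrow := row_le_sum_normSq (loc lam q) (fun α => g (α, v)) α
    have h1 : ∀ k z, drop (loc lam q) (fun α => g (α, v))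
        (Function.update α (loc lam q).2.1 (some (edge (loc lam q).1 k z))) = 0 := by
      intro k z
      simp [drop]
    simp only [h1, norm_zero, ne_eq, OfNat.ofNat_ne_zero, not_false_eq_true, zero_pow,
      Finset.sum_const_zero, add_zero]
    simp only [drop, Function.update_self, if_true, rowMean_update]
    rw [rowMean, norm_mul, mul_pow, norm_inv, inv_pow, normSq_rtCard]
    refine mul_le_mul_of_nonneg_left ?_ (by positivity)
    refine le_trans ?_ (hrow.trans (le_add_of_nonneg_left (sq_nonneg _)))
    by_cases hz : ∃ z, g (Function.update α (loc lam q).2.1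
        (some (edge (loc lam q).1 (loc lam q).2.2 z)), v) ≠ 0
    · obtain ⟨z, hz⟩ := hz
      rw [Finset.sum_eq_single z]
      · exact Finset.single_le_sum (f := fun z => ‖g (Function.update α (loc lam q).2.1
          (some (edge (loc lam q).1 (loc lam q).2.2 z)), v)‖ ^ 2) (fun _ _ => sq_nonneg _)
          (Finset.mem_univ z)
      · intro z' _ hne
        by_contra h
        exact hne (hg α v q hq z' z h hz)
      · simp
    · push Not at hz
      simp [hz]

end Simulation

/-! ### Supports and additivity of the local operators. -/

section Supports

variable {β S : Type*} [Fintype β] [DecidableEq β] [Fintype S] [DecidableEq S]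

lemma dbSize_le_of_imp {α α' : DB β S} (h : ∀ b, α b ≠ none → α' b ≠ none) :
    dbSize α ≤ dbSize α' :=
  Finset.card_le_card fun b hb => by simpa using h b (by simpa using hb)

lemma dbSize_le_update_add_one (α : DB β S) (b : β) (o : Option (S × S)) :
    dbSize α ≤ dbSize (Function.update α b o) + 1 := by
  unfold dbSize
  calc _ ≤ (insert b (Finset.univ.filter fun b' => Function.update α b o b' ≠ none)).card := by
        refine Finset.card_le_card fun b' hb => ?_
        by_cases hbb : b' = b
        · simp [hbb]
        · simp only [Finset.mem_insert, hbb, Finset.mem_filter, Finset.mem_univ, true_and,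
            false_or, Function.update_of_ne hbb]
          simpa using hb
    _ ≤ _ := Finset.card_insert_le _ _

lemma dbSize_lt_update {α : DB β S} {b : β} (hb : α b = none) (e : S × S) :
    dbSize α < dbSize (Function.update α b (some e)) := by
  refine Finset.card_lt_card (Finset.ssubset_iff_subset_ne.2 ⟨fun b' hb' => ?_, fun h => ?_⟩)
  · have : b' ≠ b := by rintro rfl; simp [hb] at hb'
    simpa [Function.update_of_ne this] using hb'
  · have : b ∈ Finset.univ.filter fun b' => Function.update α b (some e) b' ≠ none := by simp
    rw [← h] at this
    simp [hb] at this

lemma exists_of_rowMean_ne_zero {κ : Bool × β × S} {f : DB β S → ℂ} {α : DB β S}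
    (h : rowMean κ f α ≠ 0) : ∃ z, f (Function.update α κ.2.1 (some (edge κ.1 κ.2.2 z))) ≠ 0 := by
  by_contra hz
  push Not at hz
  exact h (by simp [rowMean, hz])

lemma exists_of_expand_ne_zero {κ : Bool × β × S} {f : DB β S → ℂ} {α : DB β S}
    (h : expand κ f α ≠ 0) : ∃ z, α κ.2.1 = some (edge κ.1 κ.2.2 z) ∧
      (f (Function.update α κ.2.1 none) ≠ 0 ∨
        ∃ z, f (Function.update α κ.2.1 (some (edge κ.1 κ.2.2 z))) ≠ 0) := by
  unfold expand at h
  split_ifs at h with hr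
  · obtain ⟨z, hz⟩ := Option.isSome_iff_exists.1 hr
    have hα := eq_edge_of_rowVal hz
    refine ⟨z, hα, ?_⟩
    by_contra hcon
    push Not at hcon
    have h1 : rowMean κ f α = 0 := by simp [rowMean, hcon.2]
    have h2 : f α = 0 := by
      have := hcon.2 z
      rwa [← hα, Function.update_eq_self] at this
    exact h (by simp [h1, h2, hcon.1])
  · exact absurd rfl h

lemma dbSize_of_fold_ne_zero {κ : Bool × β × S} {g : DB β S → ℂ} {α : DB β S}
    (h : fold κ g α ≠ 0) : ∃ α', g α' ≠ 0 ∧ dbSize α ≤ dbSize α' := by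
  have key : ∀ z, dbSize α ≤ dbSize (Function.update α κ.2.1 (some (edge κ.1 κ.2.2 z))) := by
    intro z
    refine dbSize_le_of_imp fun b hb => ?_
    by_cases hbb : b = κ.2.1
    · subst hbb; simp
    · simpa [Function.update_of_ne hbb] using hb
  unfold fold at h
  split_ifs at h
  · obtain ⟨z, hz⟩ := exists_of_rowMean_ne_zero h
    exact ⟨_, hz, key z⟩
  · by_cases hg : g α = 0
    · have : rowMean κ g α ≠ 0 := by
        intro h0
        exact h (by simp [hg, h0])
      obtain ⟨z, hz⟩ := exists_of_rowMean_ne_zero this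
      exact ⟨_, hz, key z⟩
    · exact ⟨α, hg, le_rfl⟩
  · exact absurd rfl h

lemma dbSize_of_spill_ne_zero {κ : Bool × β × S} {f : DB β S → ℂ} {α : DB β S}
    (h : spill κ f α ≠ 0) : ∃ α', f α' ≠ 0 ∧ dbSize α ≤ dbSize α' := by
  unfold spill at h
  rcases hr : rowVal κ.1 κ.2.2 (α κ.2.1) with _ | z
  · simp [hr] at h
  · simp only [hr, Option.elim_some] at h
    obtain ⟨k, _, hk⟩ := Finset.exists_ne_zero_of_sum_ne_zero (right_ne_zero_of_mul h)
    refine ⟨_, hk, dbSize_le_of_imp fun b hb => ?_⟩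
    by_cases hbb : b = κ.2.1
    · subst hbb; simp
    · simpa [Function.update_of_ne hbb] using hb

lemma expand_add (κ : Bool × β × S) (f g : DB β S → ℂ) :
    expand κ (f + g) = expand κ f + expand κ g := by
  ext α
  simp only [expand, rowMean, Pi.add_apply, Finset.sum_add_distrib]
  split_ifs <;> ring

lemma fold_add (κ : Bool × β × S) (f g : DB β S → ℂ) :
    fold κ (f + g) = fold κ f + fold κ g := by
  ext α
  simp only [fold, rowMean, Pi.add_apply, Finset.sum_add_distrib]
  split_ifs <;> ring

end Supports

/-! ### Growth of the simulation error and of the bad weight in one step. -/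

section Propagation

variable {β S X V : Type*} [Fintype β] [DecidableEq β] [Fintype S] [DecidableEq S] [Fintype V]

/-- The part of a superposition of databases that satisfies a predicate. -/
noncomputable def onBad (Bad : DB β S → Prop) (χ : DB β S × V → ℂ) : DB β S × V → ℂ :=
  open Classical in fun p => if Bad p.1 then χ p else 0

lemma onBad_add (Bad : DB β S → Prop) (f g : DB β S × V → ℂ) :
    onBad Bad (f + g) = onBad Bad f + onBad Bad g := by
  ext p
  by_cases h : Bad p.1 <;> simp [onBad, h]

lemma l2_onBad_le (Bad : DB β S → Prop) (f : DB β S × V → ℂ) : l2 (onBad Bad f) ≤ l2 f :=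
  l2_mono fun p => by by_cases h : Bad p.1 <;> simp [onBad, h]

variable (Q : QStep X V) (lam : Bool → (β × S ≃ X))

lemma onBad_ask (Bad : DB β S → Prop) (G : DB β S → Bool × X → Option X) (f : DB β S × V → ℂ) :
    onBad Bad (Q.ask G f) = Q.ask G (onBad Bad f) := rfl

lemma onBad_liftU (Bad : DB β S → Prop) (f : DB β S × V → ℂ) :
    onBad Bad (Q.liftU f) = Q.liftU (onBad Bad f) := by
  ext ⟨α, v⟩
  by_cases h : Bad α
  · simp [onBad, QStep.liftU, h]
  · have : Q.U (fun _ => 0) v = 0 := by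
      rw [show (fun _ : V => (0 : ℂ)) = 0 from rfl, map_zero]
      rfl
    simp [onBad, QStep.liftU, h, this]

/-- One step of the simulation. -/
noncomputable def simStep (ver : Bool) (χ : DB β S × V → ℂ) : DB β S × V → ℂ :=
  if ver then simAsk Q lam χ else Q.liftU (Q.onLoc lam fold id (simAsk Q lam χ))

lemma simAsk_add (f g : DB β S × V → ℂ) :
    simAsk Q lam (f + g) = simAsk Q lam f + simAsk Q lam g := by
  rw [simAsk, simAsk, simAsk, ← QStep.ask_add]
  congr 1
  ext ⟨α, v⟩
  rcases hq : Q.qry v with _ | q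
  · simp [QStep.onLoc_of_none _ _ _ _ _ _ hq]
  · simp only [Pi.add_apply, QStep.onLoc_of_some _ _ _ _ _ _ hq]
    exact congrFun (expand_add (loc lam q) (fun α => f (α, v)) fun α => g (α, v)) α

lemma simStep_add (ver : Bool) (f g : DB β S × V → ℂ) :
    simStep Q lam ver (f + g) = simStep Q lam ver f + simStep Q lam ver g := by
  unfold simStep
  split_ifs
  · exact simAsk_add Q lam f g
  · rw [← QStep.liftU_add, simAsk_add]
    congr 1
    ext ⟨α, v⟩
    rcases hq : Q.qry v with _ | q
    · simp [QStep.onLoc_of_none _ _ _ _ _ _ hq]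
    · simp only [Pi.add_apply, QStep.onLoc_of_some _ _ _ _ _ _ hq]
      exact congrFun (fold_add (loc lam q) (fun α => simAsk Q lam f (α, v))
        fun α => simAsk Q lam g (α, v)) α

lemma l2_simStep_le [Nonempty S] (ver : Bool) (χ : DB β S × V → ℂ) :
    l2 (simStep Q lam ver χ) ≤ l2 χ := by
  unfold simStep
  split_ifs
  · exact l2_simAsk_le Q lam χ
  · rw [QStep.l2_liftU]
    exact (l2_onLoc_fold_le Q lam _).trans (l2_simAsk_le Q lam χ)

/-- A database in the support of the state after a simulated query comes from a database in the
support of the state before it by recording the queried pair. -/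
lemma exists_of_simAsk_ne_zero {χ : DB β S × V → ℂ} {α : DB β S} {v : V} {q : Bool × X}
    (hq : Q.qry v = some q) (h : simAsk Q lam χ (α, v) ≠ 0) :
    ∃ z, α (loc lam q).2.1 = some (edge q.1 (loc lam q).2.2 z) ∧
      ((χ (Function.update α (loc lam q).2.1 none,
          (Q.act (some (lam (!q.1) ((loc lam q).2.1, z)))).symm v) ≠ 0) ∨
        ∃ z', χ (Function.update α (loc lam q).2.1 (some (edge q.1 (loc lam q).2.2 z')),
          (Q.act (some (lam (!q.1) ((loc lam q).2.1, z)))).symm v) ≠ 0) := by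
  rw [simAsk, QStep.ask_apply, QStep.onLoc_of_some (q := q) _ _ _ _ _ _ (by simp [hq])] at h
  obtain ⟨z, hz, h'⟩ := exists_of_expand_ne_zero h
  refine ⟨z, hz, ?_⟩
  have : (Q.qry v).bind (dbAns lam α) = some (lam (!q.1) ((loc lam q).2.1, z)) := by
    rw [hq, Option.bind_some, dbAns, hz, show (loc lam q).1 = q.1 from rfl]
    simp
  rw [this] at h'
  exact h'

lemma simAsk_of_none {χ : DB β S × V → ℂ} {α : DB β S} {v : V} (hq : Q.qry v = none) :
    simAsk Q lam χ (α, v) = χ (α, (Q.act none).symm v) := by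
  rw [simAsk, QStep.ask_apply, QStep.onLoc_of_none _ _ _ _ _ _ (by simp [hq])]
  simp [hq]

lemma dbSize_of_simAsk_ne_zero {χ : DB β S × V → ℂ} {t : ℕ}
    (hχ : ∀ α v, χ (α, v) ≠ 0 → dbSize α ≤ t) (α : DB β S) (v : V)
    (h : simAsk Q lam χ (α, v) ≠ 0) : dbSize α ≤ t + 1 := by
  rcases hq : Q.qry v with _ | q
  · rw [simAsk_of_none Q lam hq] at h
    exact (hχ _ _ h).trans (Nat.le_succ t)
  · obtain ⟨z, -, h | ⟨z', h⟩⟩ := exists_of_simAsk_ne_zero Q lam hq h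
    · exact (dbSize_le_update_add_one _ _ _).trans (Nat.succ_le_succ (hχ _ _ h))
    · exact (dbSize_le_update_add_one _ _ _).trans (Nat.succ_le_succ (hχ _ _ h))

lemma dbSize_of_liftU_ne_zero {χ : DB β S × V → ℂ} {t : ℕ}
    (hχ : ∀ α v, χ (α, v) ≠ 0 → dbSize α ≤ t) (α : DB β S) (v : V)
    (h : Q.liftU χ (α, v) ≠ 0) : dbSize α ≤ t := by
  by_contra hcon
  have : (fun v => χ (α, v)) = 0 := by
    ext v
    by_contra h'
    exact hcon (hχ α v h')
  exact h (by simp [QStep.liftU, this])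

lemma dbSize_of_onLoc_fold_ne_zero {χ : DB β S × V → ℂ} {t : ℕ}
    (hχ : ∀ α v, χ (α, v) ≠ 0 → dbSize α ≤ t) (α : DB β S) (v : V)
    (h : Q.onLoc lam fold id χ (α, v) ≠ 0) : dbSize α ≤ t := by
  rcases hq : Q.qry v with _ | q
  · rw [QStep.onLoc_of_none _ _ _ _ _ _ hq] at h
    exact hχ _ _ h
  · rw [QStep.onLoc_of_some _ _ _ _ _ _ hq] at h
    obtain ⟨α', h1, h2⟩ := dbSize_of_fold_ne_zero h
    exact h2.trans (hχ _ _ h1)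

lemma dbSize_of_simStep_ne_zero {χ : DB β S × V → ℂ} {t : ℕ} (ver : Bool)
    (hχ : ∀ α v, χ (α, v) ≠ 0 → dbSize α ≤ t) (α : DB β S) (v : V)
    (h : simStep Q lam ver χ (α, v) ≠ 0) : dbSize α ≤ t + 1 := by
  unfold simStep at h
  split_ifs at h
  · exact dbSize_of_simAsk_ne_zero Q lam hχ α v h
  · exact dbSize_of_liftU_ne_zero Q (dbSize_of_onLoc_fold_ne_zero Q lam
      (dbSize_of_simAsk_ne_zero Q lam hχ)) α v h

lemma dbSize_of_simSpill_ne_zero {χ : DB β S × V → ℂ} {t : ℕ}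
    (hχ : ∀ α v, χ (α, v) ≠ 0 → dbSize α ≤ t) (α : DB β S) (v : V)
    (h : simSpill Q lam χ (α, v) ≠ 0) : dbSize α ≤ t := by
  rw [simSpill] at h
  rcases hq : Q.qry v with _ | q
  · rw [QStep.onLoc_of_none _ _ _ _ _ _ hq] at h
    exact absurd rfl h
  · rw [QStep.onLoc_of_some _ _ _ _ _ _ hq] at h
    obtain ⟨α', h1, h2⟩ := dbSize_of_spill_ne_zero h
    exact h2.trans (hχ _ _ h1)

lemma dbSize_of_simDrop_ne_zero {χ : DB β S × V → ℂ} {t : ℕ}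
    (hχ : ∀ α v, χ (α, v) ≠ 0 → dbSize α ≤ t) (α : DB β S) (v : V)
    (h : simDrop Q lam χ (α, v) ≠ 0) : dbSize α ≤ t := by
  rw [simDrop] at h
  rcases hq : Q.qry v with _ | q
  · rw [QStep.onLoc_of_none _ _ _ _ _ _ hq] at h
    exact absurd rfl h
  · rw [QStep.onLoc_of_some _ _ _ _ _ _ hq, drop] at h
    split_ifs at h with hα
    · obtain ⟨z, hz⟩ := exists_of_rowMean_ne_zero h
      exact (dbSize_lt_update hα _).le.trans (hχ _ _ hz)
    · exact absurd rfl h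

/-- The simulation error grows by at most a small amount in each step. -/
lemma l2_step_sub_le (hS : 1 < Fintype.card S) (t : ℕ)
    (hT : ((Fintype.card S : ℝ) / ((Fintype.card S : ℝ) - 1)) ^ (t + 1) ≤ 4) (ver : Bool)
    (hU : ver = true → Q.U = LinearMap.id) (χ : DB β S × V → ℂ)
    (hχ : ∀ α v, χ (α, v) ≠ 0 → dbSize α ≤ t)
    (hdrop : ver = true → ∀ α v q, Q.qry v = some q → ∀ z z',
      simAsk Q lam χ (Function.update α (loc lam q).2.1 (some (edge q.1 (loc lam q).2.2 z)), v) ≠ 0 →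
      simAsk Q lam χ (Function.update α (loc lam q).2.1 (some (edge q.1 (loc lam q).2.2 z')), v) ≠ 0 →
      z = z')
    (Ψ : (β → Equiv.Perm S) × V → ℂ) :
    l2 (Q.liftU (Q.ask (blockAns lam) Ψ) - jlift (simStep Q lam ver χ)) ≤
      l2 (Ψ - Q.onLoc lam resample id Ψ) + l2 (Ψ - jlift χ) +
        (2 * (Real.sqrt ((Fintype.card S : ℝ) - 1))⁻¹ + 2 * (Real.sqrt (Fintype.card S))⁻¹) *
          l2 χ := by
  have hne : Nonempty S := Fintype.card_pos_iff.1 (by omega)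
  set K := Q.onLoc lam kmap jmap (simAsk Q lam χ) with hK
  have hsp : l2 (jlift (simSpill Q lam χ)) ≤
      2 * (Real.sqrt ((Fintype.card S : ℝ) - 1))⁻¹ * l2 χ := by
    refine (l2_jlift_le hS _ hT _ fun α v h =>
      (dbSize_of_simSpill_ne_zero Q lam hχ α v h).trans (Nat.le_succ t)).trans ?_
    rw [mul_assoc]
    exact mul_le_mul_of_nonneg_left (l2_simSpill_le Q lam hS χ) (by norm_num)
  have hmain : l2 (Q.ask (blockAns lam) Ψ - K) ≤
      l2 (Ψ - Q.onLoc lam resample id Ψ) + l2 (Ψ - jlift χ) +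
        2 * (Real.sqrt ((Fintype.card S : ℝ) - 1))⁻¹ * l2 χ := by
    -- The three sources of error: replacing the state by its average, the error accumulated so far
    -- (carried through a contraction), and the lost part.
    have e : Q.ask (blockAns lam) Ψ - K =
        Q.ask (blockAns lam) (Ψ - Q.onLoc lam resample id Ψ) +
        Q.ask (blockAns lam) (Q.onLoc lam resample id (Ψ - jlift χ)) +
        Q.ask (blockAns lam) (jlift (simSpill Q lam χ)) := by
      rw [onLoc_resample_sub, QStep.ask_sub, QStep.ask_sub, ask_resample_jlift Q lam hS χ, ← hK]
      abel
    rw [e]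
    refine (l2_add_le _ _).trans (add_le_add ((l2_add_le _ _).trans ?_) ?_)
    · rw [QStep.l2_ask, QStep.l2_ask]
      exact add_le_add le_rfl (l2_onLoc_resample_le Q lam _)
    · rw [QStep.l2_ask]
      exact hsp
  have hpos : 0 ≤ 2 * (Real.sqrt (Fintype.card S))⁻¹ * l2 χ :=
    mul_nonneg (by positivity) (l2_nonneg _)
  have hg := dbSize_of_simAsk_ne_zero Q lam hχ
  rw [add_mul]
  cases ver with
  | false =>
    have e : Q.liftU (Q.ask (blockAns lam) Ψ) - jlift (simStep Q lam false χ) =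
        Q.liftU (Q.ask (blockAns lam) Ψ - K) := by
      rw [QStep.liftU_sub, hK, onLoc_kmap_eq, liftU_jlift]
      simp [simStep]
    rw [e, QStep.l2_liftU]
    linarith
  | true =>
    have hid : Q.liftU (Q.ask (blockAns lam) Ψ) = Q.ask (blockAns lam) Ψ := by
      ext p
      simp [QStep.liftU, hU rfl]
    -- A verification step keeps the pair recorded, without `fold`; the price is the term `simDrop`.
    have e : Q.liftU (Q.ask (blockAns lam) Ψ) - jlift (simStep Q lam true χ) =
        (Q.ask (blockAns lam) Ψ - K) + jlift (simDrop Q lam (simAsk Q lam χ)) := by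
      rw [hid, hK, onLoc_kmap_simAsk]
      simp only [simStep, if_true]
      abel
    rw [e]
    have hd : l2 (jlift (simDrop Q lam (simAsk Q lam χ))) ≤
        2 * (Real.sqrt (Fintype.card S))⁻¹ * l2 χ := by
      refine (l2_jlift_le hS _ hT _ (dbSize_of_simDrop_ne_zero Q lam hg)).trans ?_
      rw [mul_assoc]
      refine mul_le_mul_of_nonneg_left ((l2_simDrop_le Q lam _ (hdrop rfl)).trans ?_) (by norm_num)
      exact mul_le_mul_of_nonneg_left (l2_simAsk_le Q lam χ) (by positivity)
    refine (l2_add_le _ _).trans ?_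
    linarith

/-- The weight of the bad databases grows by at most a small amount in each step. -/
lemma l2_onBad_simStep_le [Nonempty S] (ver : Bool) (χ : DB β S × V → ℂ) (Bad : DB β S → Prop)
    (t : ℕ) (hχ : ∀ α v, χ (α, v) ≠ 0 → dbSize α ≤ t) (ε : ℝ) (hε : 0 ≤ ε)
    (hmono : ∀ (α : DB β S) b, Bad (Function.update α b none) → Bad α)
    (hcount : ∀ (α : DB β S) (q : Bool × X) (P : Finset S), dbSize α ≤ t →
      α (loc lam q).2.1 = none → ¬ Bad α →
      (∀ z ∈ P, Bad (Function.update α (loc lam q).2.1 (some (edge q.1 (loc lam q).2.2 z)))) →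
      (P.card : ℝ) ≤ ε * Fintype.card S) :
    l2 (onBad Bad (simStep Q lam ver χ)) ≤ l2 (onBad Bad χ) + 3 * Real.sqrt ε * l2 χ := by
  classical
  -- The bad part `B` is carried along by a contraction; new bad weight can only come from the good
  -- part `G`.
  set B := onBad Bad χ with hB
  set G := χ - B with hG
  have hGbad : ∀ α v, Bad α → G (α, v) = 0 := by
    intro α v h
    simp [hG, hB, onBad, h]
  have hGχ : ∀ p, ‖G p‖ ≤ ‖χ p‖ := by
    intro p
    by_cases h : Bad p.1 <;> simp [hG, hB, onBad, h]
  have hGsupp : ∀ α v, G (α, v) ≠ 0 → dbSize α ≤ t := by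
    intro α v h
    refine hχ α v fun h0 => h ?_
    have := hGχ (α, v)
    rw [h0, norm_zero] at this
    exact norm_le_zero_iff.1 this
  have hGl2 : l2 G ≤ l2 χ := l2_mono hGχ
  have hsplit : χ = G + B := by rw [hG, sub_add_cancel]
  -- The factor 2 rounds up √2. Folding costs one more √ε, whence the factor 3 in total.
  have hexp : l2 (onBad Bad (simAsk Q lam G)) ≤ 2 * Real.sqrt ε * l2 χ := by
    rw [simAsk, onBad_ask, QStep.l2_ask]
    refine (l2_le_of_fiber _ G (by positivity) fun v => ?_).trans
      (mul_le_mul_of_nonneg_left hGl2 (by positivity))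
    rw [mul_pow, Real.sq_sqrt hε]
    simp only [onBad]
    rcases hq : Q.qry v with _ | q
    · simp only [QStep.onLoc_of_none _ _ _ _ _ _ hq, id]
      have : ∀ α, (if Bad α then G (α, v) else 0) = 0 := by
        intro α
        split_ifs with h
        · exact hGbad α v h
        · rfl
      simp only [this, norm_zero, ne_eq, OfNat.ofNat_ne_zero, not_false_eq_true, zero_pow,
        Finset.sum_const_zero]
      positivity
    · simp only [QStep.onLoc_of_some _ _ _ _ _ _ hq]
      refine (sum_bad_expand_le (loc lam q) (fun α => G (α, v)) Bad ε hε
        (fun α => hmono α _) (fun α => hGbad α v) ?_).trans ?_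
      · intro α hα hb hne
        refine hcount α q _ ?_ hα hb fun z hz => (Finset.mem_filter.1 hz).2
        rcases hne with h | ⟨z, h⟩
        · exact hGsupp _ _ h
        · exact (dbSize_lt_update hα _).le.trans (hGsupp _ _ h)
      · refine mul_le_mul_of_nonneg_right ?_ (by positivity)
        linarith
  have hgood : l2 (onBad Bad (simStep Q lam ver G)) ≤ 3 * Real.sqrt ε * l2 χ := by
    have hnn : 0 ≤ Real.sqrt ε * l2 χ := mul_nonneg (Real.sqrt_nonneg _) (l2_nonneg _)
    unfold simStep
    split_ifs
    · linarith
    · rw [onBad_liftU, QStep.l2_liftU]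
      set g := simAsk Q lam G with hg
      set M := Q.onLoc lam foldMean (fun _ _ => 0) g with hM
      have h1 : onBad Bad (Q.onLoc lam fold id g) =
          onBad Bad M + onBad Bad (Q.onLoc lam fold id g - M) := by
        rw [← onBad_add, add_sub_cancel]
      have h2 : l2 (onBad Bad (Q.onLoc lam fold id g - M)) ≤ l2 (onBad Bad g) := by
        refine l2_mono ?_
        rintro ⟨α, v⟩
        by_cases hb : Bad α
        · simp only [onBad, hb, if_true, Pi.sub_apply, hM]
          rcases hq : Q.qry v with _ | q
          · simp [QStep.onLoc_of_none _ _ _ _ _ _ hq]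
          · simp only [QStep.onLoc_of_some _ _ _ _ _ _ hq]
            exact norm_fold_sub_foldMean_le _ _ _
        · simp [onBad, hb]
      have h3 : l2 (onBad Bad M) ≤ Real.sqrt ε * l2 χ := by
        refine (l2_le_of_fiber _ g (Real.sqrt_nonneg _) fun v => ?_).trans
          (mul_le_mul_of_nonneg_left ((l2_simAsk_le Q lam G).trans hGl2) (Real.sqrt_nonneg _))
        rw [Real.sq_sqrt hε]
        simp only [onBad, hM]
        rcases hq : Q.qry v with _ | q
        · simp only [QStep.onLoc_of_none _ _ _ _ _ _ hq, ite_self, norm_zero, ne_eq,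
            OfNat.ofNat_ne_zero, not_false_eq_true, zero_pow, Finset.sum_const_zero]
          positivity
        · simp only [QStep.onLoc_of_some _ _ _ _ _ _ hq]
          refine sum_bad_foldMean_le (loc lam q) (fun α => g (α, v)) Bad ε hε ?_ ?_
          · intro α hb
            by_contra h
            obtain ⟨z, -, h | ⟨z', h⟩⟩ := exists_of_simAsk_ne_zero Q lam hq h
            · exact h (hGbad _ _ hb)
            · exact h (hGbad _ _ (hmono _ (loc lam q).2.1 (by simpa using hb)))
          · rintro α hα hb ⟨z, hz⟩
            refine hcount α q _ ?_ hα hb fun z hz => (Finset.mem_filter.1 hz).2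
            -- The database after the query may have size `t + 1`, but `α` lacks the queried pair,
            -- so `α` has size at most `t`.
            have := dbSize_of_simAsk_ne_zero Q lam hGsupp _ _ hz
            have h' := dbSize_lt_update hα (edge (loc lam q).1 (loc lam q).2.2 z)
            omega
      rw [h1]
      refine (l2_add_le _ _).trans ?_
      linarith
  conv_lhs => rw [hsplit, simStep_add, onBad_add]
  refine (l2_add_le _ _).trans ?_
  rw [add_comm]
  exact add_le_add ((l2_onBad_le _ _).trans (l2_simStep_le Q lam ver B)) hgood

end Propagation

/-! ### The simulation of a whole run. -/

section Simulated

variable {β S X V : Type*} [Fintype β] [DecidableEq β] [Fintype S] [DecidableEq S] [Fintype V]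

/-- The state of the simulation after `t` steps. -/
noncomputable def simRun (Q : ℕ → QStep X V) (lam : Bool → (β × S ≃ X)) (ver : ℕ → Bool)
    (init : V → ℂ) : ℕ → DB β S × V → ℂ
  | 0 => fun p => if p.1 = fun _ => none then init p.2 else 0
  | t + 1 => simStep (Q t) lam (ver t) (simRun Q lam ver init t)

/-- The joint state of the permutations of the blocks and of the algorithm after `t` steps. -/
noncomputable def blockRun (Q : ℕ → QStep X V) (lam : Bool → (β × S ≃ X)) (init : V → ℂ) (t : ℕ) :
    (β → Equiv.Perm S) × V → ℂ :=
  fun p => permNorm β S * run Q init (blockPerm lam p.1) t p.2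

lemma blockRun_succ (Q : ℕ → QStep X V) (lam : Bool → (β × S ≃ X)) (init : V → ℂ) (t : ℕ) :
    blockRun Q lam init (t + 1) =
      (Q t).liftU ((Q t).ask (blockAns lam) (blockRun Q lam init t)) := by
  ext ⟨h, v⟩
  simp only [blockRun, run, QStep.liftU, QStep.ask_apply]
  have : (fun v => permNorm β S * run Q init (blockPerm lam h) t
      (((Q t).act (((Q t).qry v).bind (blockAns lam h))).symm v)) =
      permNorm β S • (Q t).askPerm (blockPerm lam h) (run Q init (blockPerm lam h) t) := by
    ext v
    simp only [QStep.askPerm, Option.map_eq_bind, Pi.smul_apply, smul_eq_mul]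
    rfl
  rw [this, map_smul]
  rfl

lemma blockRun_zero (Q : ℕ → QStep X V) (lam : Bool → (β × S ≃ X)) (ver : ℕ → Bool)
    (init : V → ℂ) : blockRun Q lam init 0 = jlift (simRun Q lam ver init 0) := by
  ext ⟨h, v⟩
  simp only [blockRun, run, jlift, jmap, simRun]
  congr 1
  rw [Finset.sum_eq_single fun _ => none]
  · simp
  · intro α _ hα
    simp [hα]
  · simp

lemma l2_simRun_zero (Q : ℕ → QStep X V) (lam : Bool → (β × S ≃ X)) (ver : ℕ → Bool)
    (init : V → ℂ) : l2 (simRun Q lam ver init 0) = l2 init := by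
  simp only [l2, simRun, Fintype.sum_prod_type_right]
  congr 1
  refine Finset.sum_congr rfl fun v _ => ?_
  rw [Finset.sum_eq_single fun _ => none]
  · simp
  · intro α _ hα
    simp [hα]
  · simp

lemma l2_simRun_le [Nonempty S] (Q : ℕ → QStep X V) (lam : Bool → (β × S ≃ X)) (ver : ℕ → Bool)
    (init : V → ℂ) (t : ℕ) : l2 (simRun Q lam ver init t) ≤ l2 init := by
  induction t with
  | zero => exact (l2_simRun_zero Q lam ver init).le
  | succ t ih => exact (l2_simStep_le _ _ _ _).trans ih

lemma dbSize_of_simRun_ne_zero (Q : ℕ → QStep X V) (lam : Bool → (β × S ≃ X)) (ver : ℕ → Bool)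
    (init : V → ℂ) (t : ℕ) (α : DB β S) (v : V) (h : simRun Q lam ver init t (α, v) ≠ 0) :
    dbSize α ≤ t := by
  induction t generalizing α v with
  | zero =>
    simp only [simRun] at h
    split_ifs at h with hα
    · simp [hα, dbSize]
    · exact absurd rfl h
  | succ t ih => exact dbSize_of_simStep_ne_zero _ _ _ ih α v h

/-- The probability of an outcome that only occurs with bad databases. -/
theorem l2_blockRun_le (Q : ℕ → QStep X V) (lam : Bool → (β × S ≃ X)) (ver : ℕ → Bool)
    (init : V → ℂ) (hinit : l2 init = 1) (hU : ∀ t, ver t = true → (Q t).U = LinearMap.id)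
    (hS : 1 < Fintype.card S) (T : ℕ)
    (hT : ((Fintype.card S : ℝ) / ((Fintype.card S : ℝ) - 1)) ^ T ≤ 4)
    (hdrop : ∀ t, ver t = true → ∀ α v q, (Q t).qry v = some q → ∀ z z',
      simAsk (Q t) lam (simRun Q lam ver init t)
        (Function.update α (loc lam q).2.1 (some (edge q.1 (loc lam q).2.2 z)), v) ≠ 0 →
      simAsk (Q t) lam (simRun Q lam ver init t)
        (Function.update α (loc lam q).2.1 (some (edge q.1 (loc lam q).2.2 z')), v) ≠ 0 → z = z')
    (Bad : DB β S → Prop) (hBad : ¬ Bad fun _ => none) (ε : ℝ) (hε : 0 ≤ ε)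
    (hmono : ∀ (α : DB β S) b, Bad (Function.update α b none) → Bad α)
    (hcount : ∀ (α : DB β S) (q : Bool × X) (P : Finset S), dbSize α ≤ T →
      α (loc lam q).2.1 = none → ¬ Bad α →
      (∀ z ∈ P, Bad (Function.update α (loc lam q).2.1 (some (edge q.1 (loc lam q).2.2 z)))) →
      (P.card : ℝ) ≤ ε * Fintype.card S)
    (R : V → Prop) [DecidablePred R]
    (hR : ∀ α v, simRun Q lam ver init T (α, v) ≠ 0 → R v → Bad α) :
    l2 (fun p => if R p.2 then blockRun Q lam init T p else 0) ≤
      ∑ t ∈ Finset.range T,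
        l2 (blockRun Q lam init t - (Q t).onLoc lam resample id (blockRun Q lam init t)) +
      T * (2 * (Real.sqrt ((Fintype.card S : ℝ) - 1))⁻¹ + 2 * (Real.sqrt (Fintype.card S))⁻¹) +
      2 * (T * (3 * Real.sqrt ε)) := by
  have hne : Nonempty S := Fintype.card_pos_iff.1 (by omega)
  have h1 : (1 : ℝ) < Fintype.card S := by exact_mod_cast hS
  have hpow : ∀ t ≤ T, ((Fintype.card S : ℝ) / ((Fintype.card S : ℝ) - 1)) ^ t ≤ 4 := by
    intro t ht
    refine (pow_le_pow_right₀ ?_ ht).trans hT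
    rw [le_div_iff₀ (by linarith)]
    linarith
  set η := 2 * (Real.sqrt ((Fintype.card S : ℝ) - 1))⁻¹ + 2 * (Real.sqrt (Fintype.card S))⁻¹ with hη
  have hη0 : 0 ≤ η := by positivity
  have herr : ∀ t ≤ T, l2 (blockRun Q lam init t - jlift (simRun Q lam ver init t)) ≤
      ∑ t ∈ Finset.range t,
        l2 (blockRun Q lam init t - (Q t).onLoc lam resample id (blockRun Q lam init t)) +
      t * η := by
    intro t
    induction t with
    | zero =>
      intro _
      rw [blockRun_zero Q lam ver, sub_self, l2_zero]
      simp
    | succ t ih =>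
      intro ht
      rw [blockRun_succ, simRun, Finset.sum_range_succ]
      refine (l2_step_sub_le (Q t) lam hS t (hpow _ ht) (ver t) (hU t) _
        (dbSize_of_simRun_ne_zero Q lam ver init t) (hdrop t) _).trans ?_
      have h2 : η * l2 (simRun Q lam ver init t) ≤ η * 1 :=
        mul_le_mul_of_nonneg_left ((l2_simRun_le Q lam ver init t).trans hinit.le) hη0
      have := ih (by omega)
      push_cast
      linarith
  have hbad : ∀ t ≤ T, l2 (onBad Bad (simRun Q lam ver init t)) ≤ t * (3 * Real.sqrt ε) := by
    intro t
    induction t with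
    | zero =>
      intro _
      have : onBad Bad (simRun Q lam ver init 0) = 0 := by
        ext ⟨α, v⟩
        by_cases hα : α = fun _ => none
        · subst hα; simp [onBad, hBad]
        · simp [onBad, simRun, hα]
      simp [this, l2_zero]
    | succ t ih =>
      intro ht
      rw [simRun]
      refine (l2_onBad_simStep_le (Q t) lam (ver t) _ Bad t
        (dbSize_of_simRun_ne_zero Q lam ver init t) ε hε hmono
        fun α q P hα => hcount α q P (by omega)).trans ?_
      have h2 : 3 * Real.sqrt ε * l2 (simRun Q lam ver init t) ≤ 3 * Real.sqrt ε * 1 :=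
        mul_le_mul_of_nonneg_left ((l2_simRun_le Q lam ver init t).trans hinit.le) (by positivity)
      have := ih (by omega)
      push_cast
      linarith
  set χ := simRun Q lam ver init T with hχ
  set χR : DB β S × V → ℂ := fun p => if R p.2 then χ p else 0 with hχR
  -- On the outcomes `R`, the true state is the simulation error plus the image of a simulated part
  -- that lives on bad databases; `jlift` at most doubles the norm of the latter.
  have hjR : (fun p : (β → Equiv.Perm S) × V => if R p.2 then blockRun Q lam init T p else 0) =
      (fun p => if R p.2 then (blockRun Q lam init T - jlift χ) p else 0) + jlift χR := by
    ext ⟨h, v⟩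
    by_cases hv : R v
    · simp [hv, jlift, hχR]
    · simp [hv, jlift, hχR, jmap]
  rw [hjR]
  refine (l2_add_le _ _).trans (add_le_add ?_ ?_)
  · refine (l2_mono fun p => ?_).trans (herr T le_rfl)
    split_ifs
    · exact le_rfl
    · simp
  · refine (l2_jlift_le hS T hT _ fun α v h => ?_).trans
      (mul_le_mul_of_nonneg_left (le_trans (l2_mono fun p => ?_) (hbad T le_rfl)) (by norm_num))
    · refine dbSize_of_simRun_ne_zero Q lam ver init T α v ?_
      simp only [hχR] at h
      split_ifs at h with hv
      · exact h
      · exact absurd rfl h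
    · simp only [hχR]
      split_ifs with hv
      · by_cases h0 : χ p = 0
        · simp [h0]
        · simp [onBad, hR p.1 p.2 h0 hv, hχ]
      · simp

end Simulated

/-! ### Averaging over the random division into blocks. -/

section Averaging

variable {β S X V : Type*} [Fintype β] [DecidableEq β] [Fintype S] [DecidableEq S]
  [Fintype X] [DecidableEq X] [Fintype V]

/-- A uniformly random division of inputs and outputs into blocks and uniformly random permutations
of the blocks give a uniformly random permutation, independent of the division of one side. -/
lemma sum_blockPerm {M : Type*} [AddCommMonoid M] (d : Bool)
    (G : (β × S ≃ X) → Equiv.Perm X → M) :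
    ∑ lam : Bool → (β × S ≃ X), ∑ h : β → Equiv.Perm S, G (lam d) (blockPerm lam h) =
      Fintype.card (β → Equiv.Perm S) • ∑ l : β × S ≃ X, ∑ φ : Equiv.Perm X, G l φ := by
  rw [Finset.sum_comm, ← Finset.card_univ, ← Finset.sum_const]
  refine Finset.sum_congr rfl fun h _ => ?_
  set H : Equiv.Perm (β × S) := Equiv.prodShear (Equiv.refl β) h with hH
  rw [← Equiv.sum_comp (Equiv.boolArrowEquivProd (β × S ≃ X)).symm, Fintype.sum_prod_type]
  -- With `h` and the division of one side fixed, the division of the other side and the permutation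
  -- determine each other.
  cases d with
  | false =>
    refine Finset.sum_congr rfl fun l _ => ?_
    let e : (β × S ≃ X) ≃ Equiv.Perm X :=
      { toFun := fun m => l.symm.trans (H.trans m)
        invFun := fun φ => H.symm.trans (l.trans φ)
        left_inv := fun m => by ext; simp
        right_inv := fun φ => by ext; simp }
    rw [← Equiv.sum_comp e]
    rfl
  | true =>
    rw [Finset.sum_comm]
    refine Finset.sum_congr rfl fun m _ => ?_
    let e : (β × S ≃ X) ≃ Equiv.Perm X :=
      { toFun := fun l => l.symm.trans (H.trans m)
        invFun := fun φ => (H.trans m).trans φ.symm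
        left_inv := fun l => by ext; simp
        right_inv := fun φ => by ext; simp }
    rw [← Equiv.sum_comp e]
    rfl

/-- The permutation that acts on a single block. -/
def conjBlock (l : β × S ≃ X) (b : β) (π : Equiv.Perm S) : Equiv.Perm X :=
  l.symm.trans ((Equiv.prodShear (Equiv.refl β) (Function.update 1 b π)).trans l)

/-- Turns resampling of a block into a modification of the whole permutation that depends on the
division of side `d` only, so that the runs before and after it can be compared by the hybrid bound.
-/
lemma blockPerm_update (lam : Bool → (β × S ≃ X)) (h : β → Equiv.Perm S) (d : Bool) (b : β)
    (π : Equiv.Perm S) :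
    blockPerm lam (Function.update h b (tw d (h b) π)) =
      tw d (blockPerm lam h) (conjBlock (lam d) b π) := by
  cases d with
  | false =>
    ext x
    simp only [blockPerm, tw, conjBlock, Bool.false_eq_true, if_false, Equiv.trans_apply,
      Equiv.Perm.mul_apply, Equiv.symm_apply_apply]
    congr 1
    simp only [Equiv.prodShear, Equiv.coe_fn_mk, Equiv.refl_apply]
    by_cases hb : ((lam false).symm x).1 = b
    · simp [hb]
    · simp [Function.update_of_ne hb]
  | true =>
    have : ∀ c φ : Equiv.Perm X, ∀ ψ, c * ψ = φ → ψ = c⁻¹ * φ := by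
      intro c φ ψ h
      rw [← h, inv_mul_cancel_left]
    refine this _ _ _ ?_
    ext x
    simp only [blockPerm, tw, conjBlock, if_true, Equiv.trans_apply,
      Equiv.Perm.mul_apply, Equiv.symm_apply_apply]
    congr 1
    simp only [Equiv.prodShear, Equiv.coe_fn_mk, Equiv.refl_apply]
    by_cases hb : ((lam false).symm x).1 = b
    · simp [hb]
    · simp [Function.update_of_ne hb]

/-- The positions of a block other than a given one. -/
def others (p : β × S) : Finset (β × S) := Finset.univ.filter fun p' => p'.1 = p.1 ∧ p'.2 ≠ p.2

lemma card_others (p : β × S) : (others p).card = Fintype.card S - 1 := by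
  have : others p = (Finset.univ.erase p.2).map (Function.Embedding.sectR p.1 S) := by
    ext ⟨b, k⟩
    simp only [others, Finset.mem_filter, Finset.mem_univ, true_and, Finset.mem_map,
      Finset.mem_erase, and_true, Function.Embedding.sectR_apply, Prod.mk.injEq]
    constructor
    · rintro ⟨h1, h2⟩
      exact ⟨k, h2, h1.symm, rfl⟩
    · rintro ⟨a, h1, h2, h3⟩
      exact ⟨h2.symm, h3 ▸ h1⟩
  rw [this, Finset.card_map, Finset.card_erase_of_mem (Finset.mem_univ _), Finset.card_univ]

lemma shear_apply_of_not_mem {p p' : β × S} {π : Equiv.Perm S} (hπ : π p.2 = p.2)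
    (hp : p' ∉ others p) :
    Equiv.prodShear (Equiv.refl β) (Function.update (1 : β → Equiv.Perm S) p.1 π) p' = p' := by
  rcases p' with ⟨b', k'⟩
  simp only [others, Finset.mem_filter, Finset.mem_univ, true_and, not_and, not_not] at hp
  by_cases hb : b' = p.1
  · have := hp hb
    subst hb this
    simp [Equiv.prodShear, hπ]
  · simp [Equiv.prodShear, Function.update_of_ne hb]

lemma conjBlock_apply_of_not_mem {l : β × S ≃ X} {p : β × S} {π : Equiv.Perm S}
    (hπ : π p.2 = p.2) {x : X} (hx : l.symm x ∉ others p) : conjBlock l p.1 π x = x := by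
  simp only [conjBlock, Equiv.trans_apply]
  rw [shear_apply_of_not_mem hπ hx, Equiv.apply_symm_apply]

lemma conjBlock_symm_apply_of_not_mem {l : β × S ≃ X} {p : β × S} {π : Equiv.Perm S}
    (hπ : π p.2 = p.2) {x : X} (hx : l.symm x ∉ others p) : (conjBlock l p.1 π).symm x = x := by
  rw [Equiv.symm_apply_eq, conjBlock_apply_of_not_mem hπ hx]

/-- The queries whose answers change if a permutation is modified in some positions. -/
def touched (d : Bool) (φ : Equiv.Perm X) (l : β × S ≃ X) (p : β × S) (q : Bool × X) : Prop :=
  l.symm (if q.1 = d then q.2 else answer φ q) ∈ others p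

/-- The modification acts on the inputs of direction `d`, which are the answers of the opposite
direction. -/
lemma answer_tw_of_not_touched {d : Bool} {φ : Equiv.Perm X} {l : β × S ≃ X} {p : β × S}
    {π : Equiv.Perm S} (hπ : π p.2 = p.2) (q : Bool × X) (hq : ¬ touched d φ l p q) :
    answer φ q = answer (tw d φ (conjBlock l p.1 π)) q := by
  rcases q with ⟨_ | _, x⟩ <;> cases d <;>
    simp only [touched, answer, tw, if_true, if_false, Bool.false_eq_true, reduceCtorEq] at hq ⊢
  · rw [Equiv.Perm.mul_apply, conjBlock_apply_of_not_mem hπ hq]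
  · rw [Equiv.Perm.mul_apply, Equiv.Perm.inv_def, conjBlock_symm_apply_of_not_mem hπ hq]
  · rw [eq_comm, Equiv.symm_apply_eq, Equiv.Perm.mul_apply, conjBlock_apply_of_not_mem hπ hq,
      Equiv.apply_symm_apply]
  · rw [eq_comm, Equiv.symm_apply_eq, Equiv.Perm.mul_apply, Equiv.apply_symm_apply,
      Equiv.Perm.inv_def, conjBlock_symm_apply_of_not_mem hπ hq]

/-- Only the points at the positions `others p` are moved, so `p` and `p'` are fixed and exchanging
their labels has no effect. This is the symmetry by which the change is equally spread over the
queries. -/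
lemma conjBlock_swap (l : β × S ≃ X) {p p' : β × S} {π : Equiv.Perm S} (hπ : π p.2 = p.2)
    (hp : p' ∉ others p) :
    conjBlock ((Equiv.swap p p').trans l) p.1 π = conjBlock l p.1 π := by
  have hpp : p ∉ others p := by simp [others]
  set H := Equiv.prodShear (Equiv.refl β) (Function.update (1 : β → Equiv.Perm S) p.1 π) with hH
  have h1 : H p = p := shear_apply_of_not_mem hπ hpp
  have h2 : H p' = p' := shear_apply_of_not_mem hπ hp
  have hcomm : ∀ r, Equiv.swap p p' (H (Equiv.swap p p' r)) = H r := by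
    intro r
    by_cases hr : r = p
    · subst hr; simp [h1, h2]
    by_cases hr' : r = p'
    · subst hr'; simp [h1, h2]
    · rw [Equiv.swap_apply_of_ne_of_ne hr hr', Equiv.swap_apply_of_ne_of_ne]
      · exact fun h => hr (H.injective (h.trans h1.symm))
      · exact fun h => hr' (H.injective (h.trans h2.symm))
  ext x
  simp only [conjBlock, Equiv.trans_apply, Equiv.symm_trans_apply, Equiv.symm_swap]
  rw [hcomm]

/-- A fixed point has a uniform position under a random bijection, by transpositions of the points.
-/
lemma card_mul_sum_mem (y : X) (P : Finset (β × S)) :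
    (Fintype.card X : ℝ) * ∑ l : β × S ≃ X, (if l.symm y ∈ P then (1 : ℝ) else 0) =
      P.card * Fintype.card (β × S ≃ X) := by
  have h1 : ∀ y', ∑ l : β × S ≃ X, (if l.symm y ∈ P then (1 : ℝ) else 0) =
      ∑ l : β × S ≃ X, (if l.symm y' ∈ P then (1 : ℝ) else 0) := by
    intro y'
    let e : (β × S ≃ X) ≃ (β × S ≃ X) :=
      { toFun := fun l => l.trans (Equiv.swap y y')
        invFun := fun l => l.trans (Equiv.swap y y')
        left_inv := fun l => by ext; simp
        right_inv := fun l => by ext; simp }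
    rw [← Equiv.sum_comp e]
    refine Finset.sum_congr rfl fun l _ => ?_
    simp [e]
  calc _ = ∑ y' : X, ∑ l : β × S ≃ X, (if l.symm y' ∈ P then (1 : ℝ) else 0) := by
        rw [← Finset.sum_congr rfl fun y' _ => h1 y']
        simp
    _ = ∑ l : β × S ≃ X, ∑ p : β × S, (if p ∈ P then (1 : ℝ) else 0) := by
        rw [Finset.sum_comm]
        refine Finset.sum_congr rfl fun l _ => ?_
        exact Equiv.sum_comp l.symm fun p => if p ∈ P then (1 : ℝ) else 0
    _ = _ := by
        simp [mul_comm]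

variable (Q : ℕ → QStep X V) (init : V → ℂ)

/-- The average change of the state when a random block is modified. -/
lemma sum_l2_run_sub_sq_le [Nonempty X] (hinit : l2 init = 1) (d : Bool) (φ : Equiv.Perm X)
    (p : β × S) {π : Equiv.Perm S} (hπ : π p.2 = p.2) (t : ℕ) :
    ∑ l : β × S ≃ X, l2 (run Q init φ t - run Q init (tw d φ (conjBlock l p.1 π)) t) ^ 2 ≤
      4 * t ^ 2 * (((Fintype.card S - 1 : ℕ) : ℝ) / Fintype.card X) *
        Fintype.card (β × S ≃ X) := by
  have hX : (Fintype.card X : ℝ) ≠ 0 := by simp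
  have hw : ∀ i, ∑ l : β × S ≃ X, l2 ((Q i).restrict (touched d φ l p) (run Q init φ i)) ^ 2 ≤
      ((Fintype.card S - 1 : ℕ) : ℝ) / Fintype.card X * Fintype.card (β × S ≃ X) := by
    intro i
    simp only [l2_sq]
    rw [Finset.sum_comm]
    have hv : ∀ v, ∑ l : β × S ≃ X,
        ‖(Q i).restrict (touched d φ l p) (run Q init φ i) v‖ ^ 2 ≤
        ((Fintype.card S - 1 : ℕ) : ℝ) / Fintype.card X * Fintype.card (β × S ≃ X) *
          ‖run Q init φ i v‖ ^ 2 := by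
      intro v
      rcases hq : (Q i).qry v with _ | q
      · have : ∀ l : β × S ≃ X, (Q i).restrict (touched d φ l p) (run Q init φ i) v = 0 :=
          fun l => (Q i).restrict_of_not _ (by simp [hq])
        simp only [this, norm_zero, ne_eq, OfNat.ofNat_ne_zero, not_false_eq_true, zero_pow,
          Finset.sum_const_zero]
        positivity
      · have : ∀ l : β × S ≃ X, ‖(Q i).restrict (touched d φ l p) (run Q init φ i) v‖ ^ 2 =
            (if l.symm (if q.1 = d then q.2 else answer φ q) ∈ others p then (1 : ℝ) else 0) *
              ‖run Q init φ i v‖ ^ 2 := by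
          intro l
          by_cases h : touched d φ l p q
          · rw [(Q i).restrict_of _ ⟨q, hq, h⟩, if_pos (show _ ∈ others p from h), one_mul]
          · rw [(Q i).restrict_of_not _ (by simpa [hq] using h), if_neg (show ¬ _ ∈ others p from h),
              zero_mul]
            simp
        simp only [this, ← Finset.sum_mul]
        refine mul_le_mul_of_nonneg_right (le_of_eq ?_) (sq_nonneg _)
        -- Neither `φ` nor the query depends on `l`, so the query is touched with probability
        -- exactly (s - 1)/|X|.
        have h2 := card_mul_sum_mem (if q.1 = d then q.2 else answer φ q) (others p)
        rw [card_others] at h2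
        rw [div_mul_eq_mul_div, ← h2, mul_div_cancel_left₀ _ hX]
    refine (Finset.sum_le_sum fun v _ => hv v).trans ?_
    rw [← Finset.mul_sum, ← l2_sq, l2_run, hinit, one_pow, mul_one]
  calc _ ≤ ∑ l : β × S ≃ X, 4 * t * ∑ i ∈ Finset.range t,
        l2 ((Q i).restrict (touched d φ l p) (run Q init φ i)) ^ 2 :=
        Finset.sum_le_sum fun l _ =>
          l2_run_sub_sq_le Q init φ _ _ (fun q hq => answer_tw_of_not_touched hπ q hq) t
    _ = 4 * t * ∑ i ∈ Finset.range t, ∑ l : β × S ≃ X,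
        l2 ((Q i).restrict (touched d φ l p) (run Q init φ i)) ^ 2 := by
        rw [← Finset.mul_sum, Finset.sum_comm]
    _ ≤ 4 * t * ∑ i ∈ Finset.range t,
        ((Fintype.card S - 1 : ℕ) : ℝ) / Fintype.card X * Fintype.card (β × S ≃ X) := by
        gcongr with i _
        exact hw i
    _ = _ := by
        rw [Finset.sum_const, Finset.card_range, nsmul_eq_mul]
        ring

/-- The squared amplitude of a vector on the labels with a given query. -/
noncomputable def qryWeight (A : QStep X V) (f : V → ℂ) (q : Bool × X) : ℝ :=
  open Classical in ∑ v with A.qry v = some q, ‖f v‖ ^ 2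

lemma qryWeight_nonneg (A : QStep X V) (f : V → ℂ) (q : Bool × X) : 0 ≤ qryWeight A f q :=
  Finset.sum_nonneg fun _ _ => sq_nonneg _

lemma sum_qryWeight_le (A : QStep X V) (f : V → ℂ) (d : Bool) (l : β × S ≃ X)
    (P : Finset (β × S)) : ∑ p ∈ P, qryWeight A f (d, l p) ≤ l2 f ^ 2 := by
  classical
  simp only [qryWeight, Finset.sum_filter]
  rw [Finset.sum_comm, l2_sq]
  refine Finset.sum_le_sum fun v _ => ?_
  rcases hq : A.qry v with _ | ⟨e, x⟩
  · simp
  · refine (Finset.sum_le_sum (g := fun p => if p = l.symm x then ‖f v‖ ^ 2 else 0)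
      fun p _ => ?_).trans ?_
    · split_ifs with h1 h2 h2
      · exact le_rfl
      · refine absurd ?_ h2
        simp only [Option.some.injEq, Prod.mk.injEq] at h1
        rw [h1.2, Equiv.symm_apply_apply]
      · exact sq_nonneg _
      · exact le_rfl
    · rw [Finset.sum_ite_eq']
      split_ifs
      · exact le_rfl
      · exact sq_nonneg _

/-- The change of the state is equally spread over the queries outside of the modified positions. -/
lemma sum_qryWeight_run_sub_le [Nonempty X] (hinit : l2 init = 1) (d : Bool) (φ : Equiv.Perm X)
    (p : β × S) {π : Equiv.Perm S} (hπ : π p.2 = p.2) (t : ℕ) :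
    ((Fintype.card (β × S) - (Fintype.card S - 1) : ℕ) : ℝ) *
      ∑ l : β × S ≃ X, qryWeight (Q t)
        (run Q init φ t - run Q init (tw d φ (conjBlock l p.1 π)) t) (d, l p) ≤
      4 * t ^ 2 * (((Fintype.card S - 1 : ℕ) : ℝ) / Fintype.card X) *
        Fintype.card (β × S ≃ X) := by
  -- Exchanging `p` and `p'` keeps the modified permutation and moves the tested query from `l p` to
  -- `l p'`. Hence all positions outside `others p` have the same mean weight, and together they
  -- have at most the squared norm of the change.
  have h1 : ∀ p' ∈ (others p)ᶜ,
      ∑ l : β × S ≃ X, qryWeight (Q t)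
        (run Q init φ t - run Q init (tw d φ (conjBlock l p.1 π)) t) (d, l p) =
      ∑ l : β × S ≃ X, qryWeight (Q t)
        (run Q init φ t - run Q init (tw d φ (conjBlock l p.1 π)) t) (d, l p') := by
    intro p' hp'
    let e : (β × S ≃ X) ≃ (β × S ≃ X) :=
      { toFun := fun l => (Equiv.swap p p').trans l
        invFun := fun l => (Equiv.swap p p').trans l
        left_inv := fun l => by ext; simp
        right_inv := fun l => by ext; simp }
    rw [← Equiv.sum_comp e]
    refine Finset.sum_congr rfl fun l _ => ?_
    simp only [e, Equiv.coe_fn_mk]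
    rw [conjBlock_swap l hπ (by simpa using hp')]
    simp
  rw [← card_others p, ← Finset.card_compl, ← nsmul_eq_mul, ← Finset.sum_const,
    Finset.sum_congr rfl h1, Finset.sum_comm, card_others]
  exact (Finset.sum_le_sum fun l _ => sum_qryWeight_le _ _ _ _ _).trans
    (sum_l2_run_sub_sq_le Q init hinit d φ p hπ t)

lemma norm_sub_resample_sq_le (κ : Bool × β × S) (F : (β → Equiv.Perm S) → ℂ)
    (h : β → Equiv.Perm S) :
    ‖F h - resample κ F h‖ ^ 2 ≤ ((stab κ.2.2).card : ℝ)⁻¹ * ∑ π ∈ stab κ.2.2,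
      ‖F h - F (Function.update h κ.2.1 (tw κ.1 (h κ.2.1) π))‖ ^ 2 := by
  have hc : (0 : ℝ) < (stab κ.2.2).card := by exact_mod_cast (stab_card_ne_zero κ.2.2).bot_lt
  have hcc : ((stab κ.2.2).card : ℂ) ≠ 0 := by exact_mod_cast stab_card_ne_zero κ.2.2
  have e : F h - resample κ F h = ((stab κ.2.2).card : ℂ)⁻¹ * ∑ π ∈ stab κ.2.2,
      (F h - F (Function.update h κ.2.1 (tw κ.1 (h κ.2.1) π))) := by
    rw [Finset.sum_sub_distrib, Finset.sum_const, nsmul_eq_mul, mul_sub, ← mul_assoc,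
      inv_mul_cancel₀ hcc, one_mul, resample]
  rw [e, norm_mul, mul_pow, norm_inv, Complex.norm_natCast]
  calc _ ≤ ((stab κ.2.2).card : ℝ)⁻¹ ^ 2 * ((stab κ.2.2).card * ∑ π ∈ stab κ.2.2,
        ‖F h - F (Function.update h κ.2.1 (tw κ.1 (h κ.2.1) π))‖ ^ 2) := by
        gcongr
        exact norm_sum_sq_le _ _
    _ = _ := by field_simp

/-- The contribution of a direction to the resampling error. -/
noncomputable def resampleErr (t : ℕ) (d : Bool) (l : β × S ≃ X) (φ : Equiv.Perm X) : ℝ :=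
  ∑ p : β × S, ((stab p.2).card : ℝ)⁻¹ * ∑ π ∈ stab p.2, qryWeight (Q t)
    (run Q init φ t - run Q init (tw d φ (conjBlock l p.1 π)) t) (d, l p)

/-- Convexity moves the average over `stab` out of the square. The two directions are separated
since each involves the division of one side only, as required by `sum_blockPerm`. -/
lemma l2_sub_resample_sq_le (lam : Bool → (β × S ≃ X)) (t : ℕ) :
    l2 (blockRun Q lam init t - (Q t).onLoc lam resample id (blockRun Q lam init t)) ^ 2 ≤
      ∑ d : Bool, (Fintype.card (β → Equiv.Perm S) : ℝ)⁻¹ *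
        ∑ h, resampleErr Q init t d (lam d) (blockPerm lam h) := by
  classical
  have hγ : ‖permNorm β S‖ ^ 2 = (Fintype.card (β → Equiv.Perm S) : ℝ)⁻¹ := by
    rw [permNorm, Complex.norm_real, Real.norm_of_nonneg (by positivity), inv_pow,
      Real.sq_sqrt (by positivity)]
  rw [l2_sq, Fintype.sum_prod_type, ← Finset.mul_sum,
    Finset.sum_comm (s := (Finset.univ : Finset Bool)), Finset.mul_sum]
  refine Finset.sum_le_sum fun h _ => ?_
  set c := fun (d : Bool) (p : β × S) (v : V) => ((stab p.2).card : ℝ)⁻¹ * ∑ π ∈ stab p.2,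
    ‖(run Q init (blockPerm lam h) t -
      run Q init (tw d (blockPerm lam h) (conjBlock (lam d) p.1 π)) t) v‖ ^ 2 with hc
  have hcnn : ∀ d p v, 0 ≤ c d p v := fun d p v => by
    simp only [hc]
    positivity
  have hR : ∀ d, resampleErr Q init t d (lam d) (blockPerm lam h) =
      ∑ v, ∑ p : β × S, if (Q t).qry v = some (d, lam d p) then c d p v else 0 := by
    intro d
    rw [Finset.sum_comm]
    simp only [resampleErr, qryWeight, hc]
    refine Finset.sum_congr rfl fun p _ => ?_
    rw [← Finset.sum_filter, ← Finset.mul_sum, Finset.sum_comm]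
  simp only [hR]
  rw [Finset.sum_comm, Finset.mul_sum]
  refine Finset.sum_le_sum fun v _ => ?_
  rw [Pi.sub_apply]
  rcases hq : (Q t).qry v with _ | q
  · rw [QStep.onLoc_of_none _ _ _ _ _ _ hq]
    simp
  · rw [QStep.onLoc_of_some _ _ _ _ _ _ hq]
    refine (norm_sub_resample_sq_le (loc lam q) (fun h => blockRun Q lam init t (h, v)) h).trans ?_
    have h1 : (((stab (loc lam q).2.2).card : ℝ)⁻¹ * ∑ π ∈ stab (loc lam q).2.2,
        ‖blockRun Q lam init t (h, v) - blockRun Q lam init t (Function.update h (loc lam q).2.1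
          (tw (loc lam q).1 (h (loc lam q).2.1) π), v)‖ ^ 2) =
        (Fintype.card (β → Equiv.Perm S) : ℝ)⁻¹ * c q.1 ((lam q.1).symm q.2) v := by
      simp only [blockRun, blockPerm_update, ← mul_sub, norm_mul, mul_pow, hγ, ← Finset.mul_sum, hc]
      rw [mul_left_comm]
      rfl
    rw [h1]
    refine mul_le_mul_of_nonneg_left ?_ (by positivity)
    calc c q.1 ((lam q.1).symm q.2) v
        = ∑ p : β × S, if p = (lam q.1).symm q.2 then c q.1 p v else 0 := by simp
      _ ≤ ∑ p : β × S, if some q = some (q.1, lam q.1 p) then c q.1 p v else 0 := by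
          refine Finset.sum_le_sum fun p _ => ?_
          split_ifs with h1 h2 h2
          · exact le_rfl
          · refine absurd ?_ h2
            rw [h1, Equiv.apply_symm_apply]
          · exact hcnn _ _ _
          · exact le_rfl
      _ ≤ _ := Finset.single_le_sum
          (f := fun d => ∑ p : β × S, if some q = some (d, lam d p) then c d p v else 0)
          (fun d _ => Finset.sum_nonneg fun p _ => by
            split_ifs
            · exact hcnn _ _ _
            · exact le_rfl) (Finset.mem_univ q.1)

/-- The average of the resampling error over the division into blocks. -/
theorem sum_l2_sub_resample_sq_le [Nonempty X] (hinit : l2 init = 1)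
    (hcard : Fintype.card (β × S) = Fintype.card X) (h2 : 2 * Fintype.card S ≤ Fintype.card X)
    (t : ℕ) :
    ∑ lam : Bool → (β × S ≃ X),
      l2 (blockRun Q lam init t - (Q t).onLoc lam resample id (blockRun Q lam init t)) ^ 2 ≤
      Fintype.card (Bool → (β × S ≃ X)) * (16 * t ^ 2 * (Fintype.card S / Fintype.card X)) := by
  have hX : (0 : ℝ) < Fintype.card X := by exact_mod_cast Fintype.card_pos
  have hH : (Fintype.card (β → Equiv.Perm S) : ℝ) ≠ 0 := by simp
  have hd : ∀ d : Bool, ∑ lam : Bool → (β × S ≃ X), (Fintype.card (β → Equiv.Perm S) : ℝ)⁻¹ *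
        ∑ h, resampleErr Q init t d (lam d) (blockPerm lam h) ≤
      Fintype.card (Bool → (β × S ≃ X)) * (8 * t ^ 2 * (Fintype.card S / Fintype.card X)) := by
    intro d
    rw [← Finset.mul_sum, sum_blockPerm d fun l φ => resampleErr Q init t d l φ, nsmul_eq_mul,
      ← mul_assoc, inv_mul_cancel₀ hH, one_mul, Finset.sum_comm]
    have hφ : ∀ φ : Equiv.Perm X, ∑ l : β × S ≃ X, resampleErr Q init t d l φ ≤
        Fintype.card (β × S ≃ X) * (8 * t ^ 2 * (Fintype.card S / Fintype.card X)) := by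
      intro φ
      simp only [resampleErr]
      rw [Finset.sum_comm]
      have hp : ∀ p : β × S, ∑ l : β × S ≃ X, ((stab p.2).card : ℝ)⁻¹ * ∑ π ∈ stab p.2,
          qryWeight (Q t) (run Q init φ t - run Q init (tw d φ (conjBlock l p.1 π)) t) (d, l p) ≤
          (Fintype.card X : ℝ)⁻¹ *
            (Fintype.card (β × S ≃ X) * (8 * t ^ 2 * (Fintype.card S / Fintype.card X))) := by
        intro p
        have hc : (0 : ℝ) < (stab p.2).card := by exact_mod_cast (stab_card_ne_zero p.2).bot_lt
        rw [← Finset.mul_sum, Finset.sum_comm]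
        have hπ : ∀ π ∈ stab p.2, ∑ l : β × S ≃ X, qryWeight (Q t)
            (run Q init φ t - run Q init (tw d φ (conjBlock l p.1 π)) t) (d, l p) ≤
            (Fintype.card X : ℝ)⁻¹ *
              (Fintype.card (β × S ≃ X) * (8 * t ^ 2 * (Fintype.card S / Fintype.card X))) := by
          intro π hπ
          have hπ : π p.2 = p.2 := by simpa [stab] using hπ
          have hm := sum_qryWeight_run_sub_le Q init hinit d φ p hπ t
          set w := ∑ l : β × S ≃ X, qryWeight (Q t)
            (run Q init φ t - run Q init (tw d φ (conjBlock l p.1 π)) t) (d, l p) with hw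
          have hw0 : 0 ≤ w := Finset.sum_nonneg fun _ _ => qryWeight_nonneg _ _ _
          -- A block has at most half of the points, so at least half of the positions lie outside
          -- `others p`. This loses a factor 2: 4 t² becomes 8 t² for each direction, and 16 t² for
          -- both.
          have h3 : (Fintype.card X : ℝ) ≤
              2 * ((Fintype.card (β × S) - (Fintype.card S - 1) : ℕ) : ℝ) := by
            have : Fintype.card X ≤ 2 * (Fintype.card (β × S) - (Fintype.card S - 1)) := by omega
            exact_mod_cast this
          have h4 : ((Fintype.card S - 1 : ℕ) : ℝ) ≤ Fintype.card S := by
            exact_mod_cast Nat.sub_le _ _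
          rw [inv_mul_eq_div, le_div_iff₀ hX, mul_comm]
          calc _ ≤ 2 * ((Fintype.card (β × S) - (Fintype.card S - 1) : ℕ) : ℝ) * w := by gcongr
            _ ≤ 2 * (4 * t ^ 2 * (((Fintype.card S - 1 : ℕ) : ℝ) / Fintype.card X) *
                  Fintype.card (β × S ≃ X)) := by
                rw [mul_assoc]
                gcongr
            _ ≤ 2 * (4 * t ^ 2 * ((Fintype.card S : ℝ) / Fintype.card X) *
                  Fintype.card (β × S ≃ X)) := by
                gcongr
            _ = _ := by ring
        refine (mul_le_mul_of_nonneg_left (Finset.sum_le_sum hπ) (by positivity)).trans ?_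
        rw [Finset.sum_const, nsmul_eq_mul, ← mul_assoc, inv_mul_cancel₀ hc.ne', one_mul]
      refine (Finset.sum_le_sum fun p _ => hp p).trans ?_
      rw [Finset.sum_const, Finset.card_univ, hcard, nsmul_eq_mul, ← mul_assoc,
        mul_inv_cancel₀ hX.ne', one_mul]
    refine (Finset.sum_le_sum fun φ _ => hφ φ).trans ?_
    rw [Finset.sum_const, Finset.card_univ, nsmul_eq_mul, ← mul_assoc]
    refine mul_le_mul_of_nonneg_right (le_of_eq ?_) (by positivity)
    let e : β × S ≃ X := Fintype.equivOfCardEq hcard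
    rw [Fintype.card_fun, Fintype.card_bool, sq, Fintype.card_equiv e, Fintype.card_perm, hcard]
    push_cast
    ring
  refine (Finset.sum_le_sum fun lam _ => l2_sub_resample_sq_le Q init lam t).trans ?_
  rw [Finset.sum_comm]
  refine (Finset.sum_le_sum fun d _ => hd d).trans (le_of_eq ?_)
  simp
  ring

end Averaging

/-! ### Occupancy of the blocks of a random division. -/

section Load

variable {A β S X G : Type*} [Fintype A] [DecidableEq A] [Fintype β] [DecidableEq β] [Fintype S]
  [DecidableEq S] [Fintype X] [DecidableEq X] [Fintype G] [DecidableEq G]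

/-- The probability that a random bijection maps a set of positions into a given set. -/
lemma card_mapsTo_mul_pow_le (P : Finset A) (Φ : Finset X) :
    (Finset.univ.filter fun l : A ≃ X => ∀ p ∈ P, l p ∈ Φ).card * Fintype.card X ^ P.card ≤
      Φ.card ^ P.card * Fintype.card (A ≃ X) := by
  induction P using Finset.induction_on with
  | empty => simp
  | insert p P hp ih =>
    have key : (Finset.univ.filter fun l : A ≃ X => ∀ p' ∈ insert p P, l p' ∈ Φ).card *
        Fintype.card X ≤
        Φ.card * (Finset.univ.filter fun l : A ≃ X => ∀ p' ∈ P, l p' ∈ Φ).card := by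
      -- Every position is at least as likely as the new position `p` to be mapped into `Φ`, given
      -- that `P` is: equally likely outside `P` by a swap, and certain inside `P`. Summed over all
      -- positions, each bijection hits `Φ` exactly `Φ.card` times.
      have hswap : ∀ p', (Finset.univ.filter fun l : A ≃ X => ∀ p' ∈ insert p P, l p' ∈ Φ).card ≤
          ((Finset.univ.filter fun l : A ≃ X => ∀ p' ∈ P, l p' ∈ Φ).filter
            fun l => l p' ∈ Φ).card := by
        intro p'
        by_cases hp' : p' ∈ P
        · refine Finset.card_le_card fun l hl => ?_
          simp only [Finset.mem_filter, Finset.mem_univ, true_and] at hl ⊢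
          exact ⟨fun a ha => hl a (Finset.mem_insert_of_mem ha),
            hl p' (Finset.mem_insert_of_mem hp')⟩
        · refine Finset.card_le_card_of_injOn (fun l => (Equiv.swap p p').trans l) ?_ ?_
          · intro l hl
            simp only [Finset.coe_filter, Finset.mem_univ, true_and, Set.mem_ofPred_eq,
              Equiv.trans_apply, Finset.mem_filter] at hl ⊢
            refine ⟨fun a ha => ?_, ?_⟩
            · rw [Equiv.swap_apply_of_ne_of_ne]
              · exact hl a (Finset.mem_insert_of_mem ha)
              · rintro rfl; exact hp ha
              · rintro rfl; exact hp' ha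
            · rw [Equiv.swap_apply_right]
              exact hl p (Finset.mem_insert_self _ _)
          · intro l _ l' _ h
            ext a
            have := congrArg (fun e : A ≃ X => e (Equiv.swap p p' a)) h
            simpa using this
      rcases isEmpty_or_nonempty (A ≃ X) with he | ⟨⟨l₀⟩⟩
      · simp
      · rw [← Fintype.card_congr l₀, mul_comm, ← smul_eq_mul, ← Finset.card_univ,
          ← Finset.sum_const]
        refine (Finset.sum_le_sum fun p' _ => hswap p').trans (le_of_eq ?_)
        simp only [Finset.card_filter _ (Finset.filter _ _)]
        rw [Finset.sum_comm, mul_comm, ← smul_eq_mul, ← Finset.sum_const]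
        refine Finset.sum_congr rfl fun l _ => ?_
        rw [← Finset.card_filter]
        refine Finset.card_bij (fun a _ => l a) (by simp) (by simp) fun x hx => ?_
        exact ⟨l.symm x, by simpa using hx, by simp⟩
    rw [Finset.card_insert_of_notMem hp, pow_succ, pow_succ]
    calc _ = (Finset.univ.filter fun l : A ≃ X => ∀ p' ∈ insert p P, l p' ∈ Φ).card *
          Fintype.card X * Fintype.card X ^ P.card := by ring
      _ ≤ Φ.card * (Finset.univ.filter fun l : A ≃ X => ∀ p' ∈ P, l p' ∈ Φ).card *
          Fintype.card X ^ P.card := Nat.mul_le_mul_right _ key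
      _ = Φ.card * ((Finset.univ.filter fun l : A ≃ X => ∀ p' ∈ P, l p' ∈ Φ).card *
          Fintype.card X ^ P.card) := by ring
      _ ≤ Φ.card * (Φ.card ^ P.card * Fintype.card (A ≃ X)) := Nat.mul_le_mul_left _ ih
      _ = _ := by ring

/-- The number of positions of a block with a given value of a function. -/
def load (g : X → G) (l : β × S ≃ X) (b : β) (a : G) : ℕ :=
  (Finset.univ.filter fun i => g (l (b, i)) = a).card

/-- A random division into blocks is unlikely to have a block in which a value is frequent. -/
lemma card_le_load_mul_factorial_le [Nonempty X] (g : X → G) (k : ℕ)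
    (hg : ∀ a, Fintype.card S * (Finset.univ.filter fun x => g x = a).card ≤ Fintype.card X) :
    (Finset.univ.filter fun l : β × S ≃ X => ∃ b a, k ≤ load g l b a).card * k.factorial ≤
      Fintype.card β * Fintype.card G * Fintype.card (β × S ≃ X) := by
  -- The probability that `k` given positions all have the value `a` is at most |S|⁻ᵏ, since a fibre
  -- of `g` has at most |X|/|S| points.
  have hI : ∀ (b : β) (a : G), ∀ I ∈ Finset.powersetCard k (Finset.univ : Finset S),
      (Finset.univ.filter fun l : β × S ≃ X => ∀ i ∈ I, g (l (b, i)) = a).card *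
        Fintype.card S ^ k ≤ Fintype.card (β × S ≃ X) := by
    intro b a I hI
    have hk : I.card = k := (Finset.mem_powersetCard.1 hI).2
    have h := card_mapsTo_mul_pow_le (I.map (Function.Embedding.sectR b S))
      (Finset.univ.filter fun x => g x = a)
    rw [Finset.card_map, hk] at h
    simp only [Finset.mem_map, Finset.mem_filter, Finset.mem_univ, true_and,
      forall_exists_index, and_imp, forall_apply_eq_imp_iff₂,
      Function.Embedding.sectR_apply] at h
    have hpos : 0 < Fintype.card X ^ k := pow_pos Fintype.card_pos _
    refine Nat.le_of_mul_le_mul_right ?_ hpos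
    calc _ = (Finset.univ.filter fun l : β × S ≃ X => ∀ i ∈ I, g (l (b, i)) = a).card *
          Fintype.card X ^ k * Fintype.card S ^ k := by ring
      _ ≤ (Finset.univ.filter fun x => g x = a).card ^ k * Fintype.card (β × S ≃ X) *
          Fintype.card S ^ k := Nat.mul_le_mul_right _ h
      _ = (Fintype.card S * (Finset.univ.filter fun x => g x = a).card) ^ k *
          Fintype.card (β × S ≃ X) := by ring
      _ ≤ Fintype.card X ^ k * Fintype.card (β × S ≃ X) :=
          Nat.mul_le_mul_right _ (Nat.pow_le_pow_left (hg a) _)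
      _ = _ := by ring
  have hsub : (Finset.univ.filter fun l : β × S ≃ X => ∃ b a, k ≤ load g l b a) ⊆
      (Finset.univ : Finset (β × G)).biUnion fun p =>
        (Finset.powersetCard k (Finset.univ : Finset S)).biUnion fun I =>
          Finset.univ.filter fun l : β × S ≃ X => ∀ i ∈ I, g (l (p.1, i)) = p.2 := by
    intro l hl
    obtain ⟨b, a, h⟩ := (Finset.mem_filter.1 hl).2
    obtain ⟨I, hI1, hI2⟩ := Finset.exists_subset_card_eq h
    simp only [Finset.mem_biUnion, Finset.mem_univ, true_and]
    refine ⟨(b, a), I, Finset.mem_powersetCard.2 ⟨Finset.subset_univ _, hI2⟩, ?_⟩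
    simp only [Finset.mem_filter, Finset.mem_univ, true_and]
    exact fun i hi => (Finset.mem_filter.1 (hI1 hi)).2
  rcases k.eq_zero_or_pos with rfl | hk0
  · rcases isEmpty_or_nonempty (β × S ≃ X) with he | ⟨⟨l₀⟩⟩
    · simp
    · rw [Nat.factorial_zero, mul_one]
      have hne : Nonempty (β × S) := l₀.nonempty
      have h1 : 0 < Fintype.card β := Fintype.card_pos_iff.2 ⟨hne.some.1⟩
      have h2 : 0 < Fintype.card G := Fintype.card_pos_iff.2 ⟨g (Classical.arbitrary X)⟩
      calc _ ≤ 1 * Fintype.card (β × S ≃ X) := by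
            rw [one_mul, ← Finset.card_univ]
            exact Finset.card_le_card (Finset.filter_subset _ _)
        _ ≤ _ := Nat.mul_le_mul_right _ (Nat.mul_pos h1 h2)
  rcases (Fintype.card S).eq_zero_or_pos with hs | hs
  · have : IsEmpty S := Fintype.card_eq_zero_iff.1 hs
    have : (Finset.univ.filter fun l : β × S ≃ X => ∃ b a, k ≤ load g l b a) = ∅ := by
      refine Finset.filter_eq_empty_iff.2 ?_
      rintro l - ⟨b, a, h⟩
      simp [load] at h
      omega
    simp [this]
  have hspos : 0 < Fintype.card S ^ k := pow_pos hs _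
  refine Nat.le_of_mul_le_mul_right ?_ hspos
  calc _ = (Finset.univ.filter fun l : β × S ≃ X => ∃ b a, k ≤ load g l b a).card *
        Fintype.card S ^ k * k.factorial := by ring
    _ ≤ (∑ _p : β × G, ∑ _I ∈ Finset.powersetCard k (Finset.univ : Finset S),
          Fintype.card (β × S ≃ X)) * k.factorial := by
        refine Nat.mul_le_mul_right _ ?_
        refine (Nat.mul_le_mul_right _ ((Finset.card_le_card hsub).trans
          (Finset.card_biUnion_le.trans
            (Finset.sum_le_sum fun p _ => Finset.card_biUnion_le)))).trans ?_
        rw [Finset.sum_mul]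
        refine Finset.sum_le_sum fun p _ => ?_
        rw [Finset.sum_mul]
        exact Finset.sum_le_sum fun I hI' => hI p.1 p.2 I hI'
    _ = Fintype.card β * Fintype.card G * Fintype.card (β × S ≃ X) *
        (k.factorial * (Fintype.card S).choose k) := by
        simp only [Finset.sum_const, Finset.card_powersetCard, Finset.card_univ, smul_eq_mul,
          Fintype.card_prod]
        ring
    -- The union bound over all k-subsets of a block costs a binomial coefficient, which is at most
    -- |S|ᵏ/k!.
    _ ≤ _ := by
        refine Nat.mul_le_mul_left _ ?_
        rw [← Nat.descFactorial_eq_factorial_mul_choose]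
        exact Nat.descFactorial_le_pow _ _

end Load

/-! ### Recorded pairs that exclude sponge collisions. -/

namespace Sponge

variable {r c : ℕ}

/-- The capacity of a state: its last `c` bits. -/
def cap (s : Bits (r + c)) : Bits c := fun i => s (Fin.natAdd r i)

/-- A block, padded to a state. -/
def pad (x : Bits r) : Bits (r + c) := Fin.append x 0

lemma rate_add (s t : Bits (r + c)) : rate (s + t) = rate s + rate t := rfl

lemma cap_add (s t : Bits (r + c)) : cap (s + t) = cap s + cap t := rfl

@[simp] lemma rate_zero : rate (0 : Bits (r + c)) = 0 := rfl

@[simp] lemma cap_zero : cap (0 : Bits (r + c)) = 0 := rfl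

@[simp] lemma rate_pad (x : Bits r) : rate (pad x : Bits (r + c)) = x := by
  ext i
  simp [rate, pad]

@[simp] lemma cap_pad (x : Bits r) : cap (pad x : Bits (r + c)) = 0 := by
  ext i
  simp [cap, pad]

lemma eq_of_rate_of_cap {s t : Bits (r + c)} (h1 : rate s = rate t) (h2 : cap s = cap t) :
    s = t := by
  ext i
  refine Fin.addCases (fun i => congrFun h1 i) (fun i => congrFun h2 i) i

lemma card_rate_fiber_le (a : Bits r) :
    (Finset.univ.filter fun x : Bits (r + c) => rate x = a).card ≤ 2 ^ c := by
  refine (Finset.card_le_card_of_injOn (t := (Finset.univ : Finset (Bits c))) cap (by simp)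
    ?_).trans (by simp [ZMod.card])
  intro x hx y hy h
  simp only [Finset.coe_filter, Finset.mem_univ, true_and, Set.mem_ofPred_eq] at hx hy
  exact eq_of_rate_of_cap (hx.trans hy.symm) h

lemma card_cap_fiber_le (a : Bits c) :
    (Finset.univ.filter fun x : Bits (r + c) => cap x = a).card ≤ 2 ^ r := by
  refine (Finset.card_le_card_of_injOn (t := (Finset.univ : Finset (Bits r))) rate (by simp)
    ?_).trans (by simp [ZMod.card])
  intro x hx y hy h
  simp only [Finset.coe_filter, Finset.mem_univ, true_and, Set.mem_ofPred_eq] at hx hy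
  exact eq_of_rate_of_cap h (hx.trans hy.symm)

/-- The input-output pairs that are reachable by absorbing blocks, up to changes of the rate. -/
inductive Live (E : Finset (Bits (r + c) × Bits (r + c))) : Bits (r + c) → Bits (r + c) → Prop
  | root {x y} : (x, y) ∈ E → cap x = 0 → Live E x y
  | step {x y x' y'} : Live E x y → (x', y') ∈ E → cap x' = cap y → Live E x' y'

lemma Live.mem {E : Finset (Bits (r + c) × Bits (r + c))} {x y} (h : Live E x y) : (x, y) ∈ E := by
  cases h <;> assumption

lemma Live.mono {E E' : Finset (Bits (r + c) × Bits (r + c))} (hE : E ⊆ E') {x y}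
    (h : Live E x y) : Live E' x y := by
  induction h with
  | root h1 h2 => exact .root (hE h1) h2
  | step _ h1 h2 ih => exact .step ih (hE h1) h2

/-- The reachable outputs of a set of input-output pairs are not zero and pairwise different, both
in the rate and in the capacity. -/
structure Good (E : Finset (Bits (r + c) × Bits (r + c))) : Prop where
  cap_ne_zero : ∀ x y, Live E x y → cap y ≠ 0
  rate_ne_zero : ∀ x y, Live E x y → rate y ≠ 0
  eq_of_cap : ∀ x y x' y', Live E x y → Live E x' y' → cap y = cap y' → x = x' ∧ y = y'
  eq_of_rate : ∀ x y x' y', Live E x y → Live E x' y' → rate y = rate y' → x = x' ∧ y = y'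

lemma Good.mono {E E' : Finset (Bits (r + c) × Bits (r + c))} (hE : E ⊆ E') (h : Good E') :
    Good E where
  cap_ne_zero x y hxy := h.cap_ne_zero x y (hxy.mono hE)
  rate_ne_zero x y hxy := h.rate_ne_zero x y (hxy.mono hE)
  eq_of_cap x y x' y' hxy hxy' := h.eq_of_cap x y x' y' (hxy.mono hE) (hxy'.mono hE)
  eq_of_rate x y x' y' hxy hxy' := h.eq_of_rate x y x' y' (hxy.mono hE) (hxy'.mono hE)

lemma good_empty : Good (∅ : Finset (Bits (r + c) × Bits (r + c))) := by
  have : ∀ x y, ¬ Live (∅ : Finset (Bits (r + c) × Bits (r + c))) x y := fun x y h => by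
    simpa using h.mem
  constructor <;> intros <;> exfalso <;> apply this <;> assumption

/-- Recording a new input with a fresh output. -/
lemma Good.insert_output {E : Finset (Bits (r + c) × Bits (r + c))} (hE : Good E)
    {x y : Bits (r + c)} (h0 : cap y ≠ 0) (hx : cap y ≠ cap x) (h1 : ∀ e ∈ E, cap y ≠ cap e.1)
    (h2 : ∀ e ∈ E, cap y ≠ cap e.2) (h0' : rate y ≠ 0) (h2' : ∀ e ∈ E, rate y ≠ rate e.2) :
    Good (insert (x, y) E) := by
  -- No previously recorded pair continues from the new one, because the capacity of `y` is not that
  -- of a recorded input. So at most the new pair itself becomes live.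
  have key : ∀ {x' y'}, Live (insert (x, y) E) x' y' → (x' = x ∧ y' = y) ∨ Live E x' y' := by
    intro x' y' h
    induction h with
    | root h3 h4 =>
      rcases Finset.mem_insert.1 h3 with h | h
      · exact .inl (Prod.mk.inj h)
      · exact .inr (.root h h4)
    | step _ h3 h4 ih =>
      rcases Finset.mem_insert.1 h3 with h | h
      · exact .inl (Prod.mk.inj h)
      · rcases ih with ⟨-, rfl⟩ | ih
        · exact absurd h4.symm (h1 _ h)
        · exact .inr (.step ih h h4)
  constructor
  · intro x' y' h
    rcases key h with ⟨rfl, rfl⟩ | h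
    · exact h0
    · exact hE.cap_ne_zero _ _ h
  · intro x' y' h
    rcases key h with ⟨rfl, rfl⟩ | h
    · exact h0'
    · exact hE.rate_ne_zero _ _ h
  · intro x1 y1 x2 y2 k1 k2 h
    rcases key k1 with ⟨rfl, rfl⟩ | j1 <;> rcases key k2 with ⟨rfl, rfl⟩ | j2
    · exact ⟨rfl, rfl⟩
    · exact absurd h (h2 _ j2.mem)
    · exact absurd h.symm (h2 _ j1.mem)
    · exact hE.eq_of_cap _ _ _ _ j1 j2 h
  · intro x1 y1 x2 y2 k1 k2 h
    rcases key k1 with ⟨rfl, rfl⟩ | j1 <;> rcases key k2 with ⟨rfl, rfl⟩ | j2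
    · exact ⟨rfl, rfl⟩
    · exact absurd h (h2' _ j2.mem)
    · exact absurd h.symm (h2' _ j1.mem)
    · exact hE.eq_of_rate _ _ _ _ j1 j2 h

/-- Recording a new output with a fresh input. -/
lemma Good.insert_input {E : Finset (Bits (r + c) × Bits (r + c))} (hE : Good E)
    {x y : Bits (r + c)} (h0 : cap x ≠ 0) (h2 : ∀ e ∈ E, cap x ≠ cap e.2) :
    Good (insert (x, y) E) := by
  -- The capacity of the new input is neither zero nor that of a recorded output, so the new pair is
  -- not reachable.
  have key : ∀ {x' y'}, Live (insert (x, y) E) x' y' → Live E x' y' := by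
    intro x' y' h
    induction h with
    | root h3 h4 =>
      rcases Finset.mem_insert.1 h3 with h | h
      · exact absurd h4 ((Prod.mk.inj h).1 ▸ h0)
      · exact .root h h4
    | step _ h3 h4 ih =>
      rcases Finset.mem_insert.1 h3 with h | h
      · exact absurd h4 ((Prod.mk.inj h).1 ▸ h2 _ ih.mem)
      · exact .step ih h h4
  exact ⟨fun x' y' h => hE.cap_ne_zero _ _ (key h), fun x' y' h => hE.rate_ne_zero _ _ (key h),
    fun _ _ _ _ k1 k2 => hE.eq_of_cap _ _ _ _ (key k1) (key k2),
    fun _ _ _ _ k1 k2 => hE.eq_of_rate _ _ _ _ (key k1) (key k2)⟩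

/-- A message is absorbed along recorded pairs, and ends in a state. -/
inductive Path (E : Finset (Bits (r + c) × Bits (r + c))) : List (Bits r) → Bits (r + c) → Prop
  | nil : Path E [] 0
  | snoc {m s x y} : Path E m s → (s + pad x, y) ∈ E → Path E (m ++ [x]) y

lemma Path.live {E : Finset (Bits (r + c) × Bits (r + c))} {m s} (h : Path E m s) :
    (m = [] ∧ s = 0) ∨ ∃ x, Live E x s := by
  induction h with
  | nil => exact .inl ⟨rfl, rfl⟩
  | snoc _ h2 ih =>
    rcases ih with ⟨-, rfl⟩ | ⟨x, hx⟩
    · exact .inr ⟨_, .root h2 (by simp)⟩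
    · exact .inr ⟨_, .step hx h2 (by simp [cap_add])⟩

lemma Path.live_snoc {E : Finset (Bits (r + c) × Bits (r + c))} {m s x y} (h : Path E m s)
    (h2 : (s + pad x, y) ∈ E) : Live E (s + pad x) y := by
  rcases h.live with ⟨-, rfl⟩ | ⟨x, hx⟩
  · exact .root h2 (by simp)
  · exact .step hx h2 (by simp [cap_add])

/-- The paths are traced back from their ends. Equal capacities force the same last pair; padding
does not affect the capacity, so the capacities before the last block agree as well; once the states
before it agree, the rates determine the block. An empty path is recognised by its zero capacity. -/
lemma Path.inj {E : Finset (Bits (r + c) × Bits (r + c))} (hE : Good E) {m m' s s'}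
    (h : Path E m s) (h' : Path E m' s') (hs : cap s = cap s') : m = m' ∧ s = s' := by
  induction h generalizing m' s' with
  | nil =>
    rcases h' with _ | ⟨k, hk⟩
    · exact ⟨rfl, rfl⟩
    · exact absurd hs.symm (hE.cap_ne_zero _ _ (k.live_snoc hk))
  | snoc k hk ih =>
    rcases h' with _ | ⟨k', hk'⟩
    · exact absurd hs (hE.cap_ne_zero _ _ (k.live_snoc hk))
    · obtain ⟨h1, h2⟩ := hE.eq_of_cap _ _ _ _ (k.live_snoc hk) (k'.live_snoc hk') hs
      have h3 := congrArg cap h1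
      simp only [cap_add, cap_pad, add_zero] at h3
      obtain ⟨h4, h5⟩ := ih k' h3
      have h6 := congrArg rate h1
      rw [rate_add, rate_add, h5, rate_pad, rate_pad] at h6
      rw [h4, add_left_cancel h6]
      exact ⟨rfl, h2⟩

/-- Recorded messages do not collide if the recorded pairs are good. -/
lemma Path.eq_of_rate {E : Finset (Bits (r + c) × Bits (r + c))} (hE : Good E) {m m' s s'}
    (h : Path E m s) (h' : Path E m' s') (hs : rate s = rate s') : m = m' := by
  refine (h.inj hE h' ?_).1
  -- Equal rates give equal capacities: live outputs are determined by their rates, and none has the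
  -- zero rate of the empty message.
  rcases h.live with ⟨-, rfl⟩ | ⟨x, hx⟩ <;> rcases h'.live with ⟨-, rfl⟩ | ⟨x', hx'⟩
  · rfl
  · exact absurd hs.symm (hE.rate_ne_zero _ _ hx')
  · exact absurd hs (hE.rate_ne_zero _ _ hx)
  · rw [(hE.eq_of_rate _ _ _ _ hx hx' hs).2]

end Sponge

/-! ### The pairs of a database, and the number of harmful answers. -/

section Pairs

variable {β S X : Type*} [Fintype β] [DecidableEq β] [Fintype S] [DecidableEq S]
  [Fintype X] [DecidableEq X]

/-- The input-output pairs that are recorded in a database. -/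
def pairs (lam : Bool → (β × S ≃ X)) (α : DB β S) : Finset (X × X) :=
  Finset.univ.biUnion fun b =>
    (α b).toFinset.image fun e => (lam false (b, e.1), lam true (b, e.2))

lemma mem_pairs {lam : Bool → (β × S ≃ X)} {α : DB β S} {x y : X} :
    (x, y) ∈ pairs lam α ↔
      ∃ b i j, α b = some (i, j) ∧ x = lam false (b, i) ∧ y = lam true (b, j) := by
  simp only [pairs, Finset.mem_biUnion, Finset.mem_univ, true_and, Finset.mem_image,
    Option.mem_toFinset, Option.mem_def, Prod.exists, Prod.mk.injEq]
  constructor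
  · rintro ⟨b, i, j, h, rfl, rfl⟩
    exact ⟨b, i, j, h, rfl, rfl⟩
  · rintro ⟨b, i, j, h, rfl, rfl⟩
    exact ⟨b, i, j, h, rfl, rfl⟩

lemma card_pairs_le (lam : Bool → (β × S ≃ X)) (α : DB β S) :
    (pairs lam α).card ≤ dbSize α := by
  rw [dbSize, Finset.card_filter]
  refine Finset.card_biUnion_le.trans (Finset.sum_le_sum fun b _ => ?_)
  refine Finset.card_image_le.trans ?_
  cases α b <;> simp

lemma pairs_none (lam : Bool → (β × S ≃ X)) : pairs lam (fun _ => none) = ∅ := by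
  ext ⟨x, y⟩
  simp [mem_pairs]

lemma pairs_update_none_subset (lam : Bool → (β × S ≃ X)) (α : DB β S) (b : β) :
    pairs lam (Function.update α b none) ⊆ pairs lam α := by
  rintro ⟨x, y⟩ h
  obtain ⟨b', i, j, h, hx, hy⟩ := mem_pairs.1 h
  by_cases hb : b' = b
  · subst hb; simp at h
  · rw [Function.update_of_ne hb] at h
    exact mem_pairs.2 ⟨b', i, j, h, hx, hy⟩

lemma pairs_update_some_subset (lam : Bool → (β × S ≃ X)) (α : DB β S) (b : β) (e : S × S) :
    pairs lam (Function.update α b (some e)) ⊆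
      insert (lam false (b, e.1), lam true (b, e.2)) (pairs lam α) := by
  rintro ⟨x, y⟩ h
  obtain ⟨b', i, j, h, hx, hy⟩ := mem_pairs.1 h
  by_cases hb : b' = b
  · subst hb
    simp only [Function.update_self, Option.some.injEq] at h
    subst h
    simp [hx, hy]
  · rw [Function.update_of_ne hb] at h
    exact Finset.mem_insert_of_mem (mem_pairs.2 ⟨b', i, j, h, hx, hy⟩)

end Pairs

namespace Sponge

variable {β S : Type*} [Fintype β] [DecidableEq β] [Fintype S] [DecidableEq S] {r c : ℕ}

lemma card_le_of_load {G : Type*} [DecidableEq G] {X : Type*} [Fintype X] [DecidableEq X]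
    (g : X → G) (l : β × S ≃ X) (b : β) {k : ℕ}
    (hl : ∀ a, load g l b a ≤ k) (K : Finset G) :
    (Finset.univ.filter fun z => g (l (b, z)) ∈ K).card ≤ K.card * k := by
  have : (Finset.univ.filter fun z => g (l (b, z)) ∈ K) ⊆
      K.biUnion fun a => Finset.univ.filter fun z => g (l (b, z)) = a := by
    intro z hz
    simpa using hz
  refine (Finset.card_le_card this).trans (Finset.card_biUnion_le_card_mul _ _ _ fun a _ => hl a)

/-- Few answers to a query destroy the goodness of a database. -/
lemma card_le_of_not_good (lam : Bool → (β × S ≃ Bits (r + c))) {k : ℕ}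
    (hrate : ∀ d b a, load rate (lam d) b a ≤ k) (hcap : ∀ d b a, load cap (lam d) b a ≤ k)
    {T : ℕ} (α : DB β S) (q : Bool × Bits (r + c)) (P : Finset S) (hT : dbSize α ≤ T)
    (hα : Good (pairs lam α))
    (hP : ∀ z ∈ P, ¬ Good (pairs lam
      (Function.update α (loc lam q).2.1 (some (edge q.1 (loc lam q).2.2 z))))) :
    P.card ≤ (3 * T + 3) * k := by
  have hE := (card_pairs_le lam α).trans hT
  set E := pairs lam α with hEdef
  rcases q with ⟨_ | _, x⟩
  · set b := (loc lam (false, x)).2.1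
    set i := (loc lam (false, x)).2.2
    -- A forward query has to avoid these at most 2T + 2 capacities and the at most T + 1 rates in
    -- `K'`. Each value occurs at most `k` times in the output block.
    set K : Finset (Bits c) := insert 0 (insert (cap (lam false (b, i)))
      (E.image (fun e => cap e.1) ∪ E.image fun e => cap e.2)) with hK
    set K' : Finset (Bits r) := insert 0 (E.image fun e => rate e.2) with hK'
    have hKc : K.card ≤ 2 * T + 2 := by
      have h1 := Finset.card_insert_le (0 : Bits c) (insert (cap (lam false (b, i)))
        (E.image (fun e => cap e.1) ∪ E.image fun e => cap e.2))
      have h2 := Finset.card_insert_le (cap (lam false (b, i)))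
        (E.image (fun e => cap e.1) ∪ E.image fun e => cap e.2)
      have h3 := Finset.card_union_le (E.image fun e => cap e.1) (E.image fun e => cap e.2)
      have h4 := Finset.card_image_le (s := E) (f := fun e => cap e.1)
      have h5 := Finset.card_image_le (s := E) (f := fun e => cap e.2)
      rw [← hK] at h1
      omega
    have hKc' : K'.card ≤ T + 1 := by
      have h1 := Finset.card_insert_le (0 : Bits r) (E.image fun e => rate e.2)
      have h5 := Finset.card_image_le (s := E) (f := fun e => rate e.2)
      rw [← hK'] at h1
      omega
    have hsub : P ⊆ (Finset.univ.filter fun z => cap (lam true (b, z)) ∈ K) ∪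
        (Finset.univ.filter fun z => rate (lam true (b, z)) ∈ K') := by
      intro z hz
      by_contra hcon
      simp only [Finset.mem_union, Finset.mem_filter, Finset.mem_univ, true_and, not_or, hK, hK',
        Finset.mem_insert, Finset.mem_image, not_exists, not_and] at hcon
      obtain ⟨⟨h1, h2, h3, h4⟩, h5, h6⟩ := hcon
      refine hP z hz (Good.mono (pairs_update_some_subset _ _ _ _) ?_)
      exact hα.insert_output h1 h2 (fun e he h => h3 e he h.symm) (fun e he h => h4 e he h.symm)
        h5 fun e he h => h6 e he h.symm
    calc P.card ≤ K.card * k + K'.card * k :=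
          (Finset.card_le_card hsub).trans ((Finset.card_union_le _ _).trans
            (add_le_add (card_le_of_load cap (lam true) b (hcap true b) K)
              (card_le_of_load rate (lam true) b (hrate true b) K')))
      _ ≤ (2 * T + 2) * k + (T + 1) * k :=
          add_le_add (Nat.mul_le_mul_right _ hKc) (Nat.mul_le_mul_right _ hKc')
      _ = _ := by ring
  · set b := (loc lam (true, x)).2.1
    set K : Finset (Bits c) := insert 0 (E.image fun e => cap e.2) with hK
    have hKc : K.card ≤ T + 1 := by
      have h1 := Finset.card_insert_le (0 : Bits c) (E.image fun e => cap e.2)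
      have h5 := Finset.card_image_le (s := E) (f := fun e => cap e.2)
      rw [← hK] at h1
      omega
    have hsub : P ⊆ Finset.univ.filter fun z => cap (lam false (b, z)) ∈ K := by
      intro z hz
      by_contra hcon
      simp only [Finset.mem_filter, Finset.mem_univ, true_and, not_or, hK,
        Finset.mem_insert, Finset.mem_image, not_exists, not_and] at hcon
      obtain ⟨h1, h2⟩ := hcon
      refine hP z hz (Good.mono (pairs_update_some_subset _ _ _ _) ?_)
      exact hα.insert_input h1 fun e he h => h2 e he h.symm
    calc P.card ≤ K.card * k :=
          (Finset.card_le_card hsub).trans (card_le_of_load cap (lam false) b (hcap false b) K)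
      _ ≤ (T + 1) * k := Nat.mul_le_mul_right _ hKc
      _ ≤ _ := Nat.mul_le_mul_right _ (by omega)

end Sponge

/-! ### Verification of the output by a deterministic sequence of queries. -/

section Verification

open Classical in
/-- An element that satisfies a predicate, if there is one. -/
noncomputable def pick {ι : Type*} (p : ι → Prop) : Option ι :=
  if h : ∃ i, p i then some h.choose else none

lemma pick_spec {ι : Type*} {p : ι → Prop} {i : ι} (h : pick p = some i) : p i := by
  unfold pick at h
  split_ifs at h with h'
  rw [← Option.some.inj h]
  exact h'.choose_spec

lemma pick_eq_none {ι : Type*} {p : ι → Prop} (h : pick p = none) (i : ι) : ¬ p i := by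
  unfold pick at h
  split_ifs at h with h'
  exact fun hi => h' ⟨i, hi⟩

/-- A step that does not involve an additional register. -/
def QStep.extend {X V : Type*} [Fintype V] (Q : QStep X V) (Z : Type*) [Fintype Z] :
    QStep X (Z × V) where
  qry p := Q.qry p.2
  act o := Equiv.prodCongr (Equiv.refl Z) (Q.act o)
  qry_act y p := Q.qry_act y p.2
  U :=
    { toFun := Q.liftU
      map_add' := Q.liftU_add
      map_smul' := fun a f => by
        ext p
        exact congrFun (Q.U.map_smul a fun v => f (p.1, v)) p.2 }
  l2_U := Q.l2_liftU

variable {X V : Type*} [Fintype X] [AddCommGroup X] [Fintype V] {L : ℕ}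

/-- A deterministic sequence of queries, each of which depends on the previous answers. -/
structure Procedure (X V : Type*) (L : ℕ) where
  input : Fin L → (Fin L → X) → V → X
  input_update : ∀ i j, i ≤ j → ∀ z w v, input i (Function.update z j w) v = input i z v

namespace Procedure

variable (x : Procedure X V L)

/-- An earlier query with the same input. -/
noncomputable def earlier (i : Fin L) (p : (Fin L → X) × V) : Option (Fin L) :=
  pick fun j => j < i ∧ x.input j p.1 p.2 = x.input i p.1 p.2

lemma earlier_update (i : Fin L) (z : Fin L → X) (w : X) (v : V) :
    x.earlier i (Function.update z i w, v) = x.earlier i (z, v) := by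
  unfold earlier
  congr 1
  ext j
  refine and_congr_right fun hj => ?_
  rw [x.input_update j i hj.le, x.input_update i i le_rfl]

/-- The answer to a query, which is not repeated if it has already been made. -/
noncomputable def reply (i : Fin L) (o : Option X) (p : (Fin L → X) × V) : X :=
  o.getD ((x.earlier i p).elim 0 p.1)

/-- The reply does not depend on the cell to which it is added, which makes the action of a step
invertible. -/
lemma reply_update (i : Fin L) (o : Option X) (z : Fin L → X) (w : X) (v : V) :
    x.reply i o (Function.update z i w, v) = x.reply i o (z, v) := by
  unfold reply
  rw [earlier_update]
  rcases h : x.earlier i (z, v) with _ | j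
  · rfl
  · simp only [Option.elim_some]
    rw [Function.update_of_ne (pick_spec h).1.ne]

/-- A query of a deterministic sequence. -/
noncomputable def step (i : Fin L) : QStep X ((Fin L → X) × V) where
  -- A repeated input is not queried again but its answer is copied from the earlier cell: a second
  -- `expand` would spread the recorded answer over other values.
  qry p := (x.earlier i p).elim (some (false, x.input i p.1 p.2)) fun _ => none
  act o :=
    { toFun := fun p => (Function.update p.1 i (p.1 i + x.reply i o p), p.2)
      invFun := fun p => (Function.update p.1 i (p.1 i - x.reply i o p), p.2)
      left_inv := fun p => by simp [reply_update]
      right_inv := fun p => by simp [reply_update] }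
  qry_act o p := by
    rcases p with ⟨z, v⟩
    simp only [Equiv.coe_fn_mk, earlier_update, x.input_update i i le_rfl]
  U := LinearMap.id
  l2_U _ := rfl

lemma step_act_symm (i : Fin L) (o : Option X) (p : (Fin L → X) × V) :
    ((x.step i).act o).symm p = (Function.update p.1 i (p.1 i - x.reply i o p), p.2) := rfl

lemma step_act (i : Fin L) (o : Option X) (p : (Fin L → X) × V) :
    (x.step i).act o p = (Function.update p.1 i (p.1 i + x.reply i o p), p.2) := rfl

lemma step_qry_of_none {i : Fin L} {p : (Fin L → X) × V} (h : x.earlier i p = none) :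
    (x.step i).qry p = some (false, x.input i p.1 p.2) := by
  simp [step, h]

lemma step_qry_of_some {i j : Fin L} {p : (Fin L → X) × V} (h : x.earlier i p = some j) :
    (x.step i).qry p = none := by
  simp [step, h]

/-- The steps of an algorithm, followed by a deterministic sequence of queries. -/
noncomputable def append (Q : ℕ → QStep X V) (T : ℕ) (t : ℕ) : QStep X ((Fin L → X) × V) :=
  if h : T ≤ t ∧ t - T < L then x.step ⟨t - T, h.2⟩ else (Q t).extend (Fin L → X)

lemma append_of_lt (Q : ℕ → QStep X V) {T t : ℕ} (h : t < T) :
    x.append Q T t = (Q t).extend (Fin L → X) :=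
  dif_neg fun h' => by omega

lemma append_add (Q : ℕ → QStep X V) (T : ℕ) (i : Fin L) : x.append Q T (T + i) = x.step i := by
  rw [append, dif_pos ⟨Nat.le_add_right _ _, by simp⟩]
  congr 1
  ext
  simp

open Classical in
/-- The initial state, with an additional register that is set to zero. -/
noncomputable def start (init : V → ℂ) : (Fin L → X) × V → ℂ :=
  fun p => if p.1 = 0 then init p.2 else 0

lemma l2_start (init : V → ℂ) : l2 (start (X := X) (L := L) init) = l2 init := by
  classical
  simp only [l2, start, Fintype.sum_prod_type_right]
  congr 1
  refine Finset.sum_congr rfl fun v _ => ?_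
  rw [Finset.sum_eq_single 0]
  · simp
  · intro z _ hz
    simp [hz]
  · simp

open Classical in
lemma run_append_of_le (Q : ℕ → QStep X V) (init : V → ℂ) (φ : Equiv.Perm X) {T t : ℕ}
    (ht : t ≤ T) : run (x.append Q T) (start init) φ t = start (run Q init φ t) := by
  induction t with
  | zero => rfl
  | succ t ih =>
    rw [run, ih (by omega), append_of_lt x Q (by omega)]
    ext ⟨z, v⟩
    change (Q t).U _ v = if z = 0 then (Q t).U _ v else 0
    split_ifs with hz
    · subst hz
      refine congrFun (congrArg (Q t).U (funext fun v => ?_)) v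
      simp [QStep.askPerm, start, QStep.extend]
    · have : (fun v => (((Q t).extend (Fin L → X)).askPerm φ (start (run Q init φ t))) (z, v)) =
          0 := by
        ext v
        simp [QStep.askPerm, start, QStep.extend, hz]
      rw [this, map_zero]
      rfl

open Classical in
/-- With a fixed permutation, the sequence of queries writes down the answers. -/
lemma exists_run_append_add (Q : ℕ → QStep X V) (init : V → ℂ) (φ : Equiv.Perm X) (T i : ℕ)
    (hi : i ≤ L) : ∃ tr : V → Fin L → X,
      (∀ v (j : Fin L), i ≤ j → tr v j = 0) ∧
      (∀ v (j : Fin L), (j : ℕ) < i → tr v j = φ (x.input j (tr v) v)) ∧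
      run (x.append Q T) (start init) φ (T + i) =
        fun p => if p.1 = tr p.2 then run Q init φ T p.2 else 0 := by
  induction i with
  | zero =>
    refine ⟨fun _ => 0, fun _ _ _ => rfl, fun _ _ h => absurd h (Nat.not_lt_zero _), ?_⟩
    rw [add_zero, run_append_of_le x Q init φ le_rfl]
    rfl
  | succ i ih =>
    obtain ⟨tr, h0, h1, h2⟩ := ih (by omega)
    set k : Fin L := ⟨i, hi⟩ with hk
    have hr : ∀ v, x.reply k (((x.step k).qry (tr v, v)).map (answer φ)) (tr v, v) =
        φ (x.input k (tr v) v) := by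
      intro v
      rcases he : x.earlier k (tr v, v) with _ | j
      · rw [step_qry_of_none x he]
        simp [reply, answer]
      -- The earlier cell holds the answer to the same input, by the induction hypothesis.
      · rw [step_qry_of_some x he, reply, he]
        obtain ⟨hj, hjk⟩ := pick_spec he
        simp only [Option.map_none, Option.getD_none, Option.elim_some]
        rw [h1 v j hj, hjk]
    refine ⟨fun v => Function.update (tr v) k (φ (x.input k (tr v) v)), ?_, ?_, ?_⟩
    · intro v j hj
      beta_reduce
      rw [Function.update_of_ne, h0 v j (by omega)]
      rintro rfl
      simp [hk] at hj
    · intro v j hj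
      beta_reduce
      by_cases hjk : j = k
      · subst hjk
        rw [Function.update_self, x.input_update k k le_rfl]
      · have hj' : (j : ℕ) < i := by
          have : (j : ℕ) ≠ i := fun h => hjk (Fin.ext h)
          omega
        rw [Function.update_of_ne hjk, h1 v j hj', x.input_update j k]
        exact hj'.le
    · rw [← add_assoc, run, h2, show T + i = T + (k : ℕ) from rfl, append_add]
      ext p
      rw [show (x.step k).U = LinearMap.id from rfl, LinearMap.id_apply]
      simp only [QStep.askPerm]
      set p' := ((x.step k).act (((x.step k).qry p).map (answer φ))).symm p with hp'
      have hp : p = (x.step k).act (((x.step k).qry p').map (answer φ)) p' := by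
        rw [hp', QStep.qry_act_symm, Equiv.apply_symm_apply]
      have hp2 : p'.2 = p.2 := rfl
      rw [hp2]
      have hiff : p'.1 = tr p.2 ↔
          p.1 = Function.update (tr p.2) k (φ (x.input k (tr p.2) p.2)) := by
        constructor
        · intro h
          have e : p' = (tr p.2, p.2) := Prod.ext h rfl
          rw [e, step_act, hr] at hp
          simp only [h0 p.2 k le_rfl, zero_add] at hp
          exact congrArg Prod.fst hp
        · intro h
          have e : p = (x.step k).act (((x.step k).qry (tr p.2, p.2)).map (answer φ))
              (tr p.2, p.2) := by
            rw [step_act, hr]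
            simp only [h0 p.2 k le_rfl, zero_add]
            exact Prod.ext h rfl
          have : p' = (tr p.2, p.2) := by
            rw [hp', Equiv.symm_apply_eq]
            conv_rhs => rw [e, QStep.qry_act]
            exact e
          rw [this]
      simp only [hiff]

end Procedure

end Verification

/-! ### Verification queries stay recorded in the simulation. -/

section SimulatedVerification

variable {β S X V : Type*} [Fintype β] [DecidableEq β] [Fintype S] [DecidableEq S] [Fintype X]
  [DecidableEq X] [AddCommGroup X] [Fintype V] {L : ℕ} (x : Procedure X V L)

namespace Procedure

/-- The first queries of the sequence are recorded in the database, with their answers. -/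
def Recorded (lam : Bool → (β × S ≃ X)) (i : ℕ) (α : DB β S) (z : Fin L → X) (v : V) : Prop :=
  (∀ j : Fin L, i ≤ j → z j = 0) ∧
    ∀ j : Fin L, (j : ℕ) < i → (x.input j z v, z j) ∈ pairs lam α

/-- Cell `i` is zero before the step, so afterwards it holds the reply. If the query is made, the
reply is the answer just recorded; if not, it is an earlier cell whose pair is still recorded. -/
lemma simAsk_step (lam : Bool → (β × S ≃ X)) (i : Fin L)
    {χ : DB β S × ((Fin L → X) × V) → ℂ}
    (hχ : ∀ α z v, χ (α, (z, v)) ≠ 0 → x.Recorded lam i α z v) {α : DB β S} {z : Fin L → X} {v : V}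
    (h : simAsk (x.step i) lam χ (α, (z, v)) ≠ 0) :
    x.Recorded lam (i + 1) α z v ∧ ∀ q, (x.step i).qry (z, v) = some q →
      ∃ w, α (loc lam q).2.1 = some (edge q.1 (loc lam q).2.2 w) ∧
        lam (!q.1) ((loc lam q).2.1, w) = z i := by
  have hin : ∀ (j : Fin L) w, j ≤ i → x.input j (Function.update z i w) v = x.input j z v :=
    fun j w hj => x.input_update j i hj z w v
  have hz : ∀ (α' : DB β S) o, χ (α', ((x.step i).act o).symm (z, v)) ≠ 0 →
      z i = x.reply i o (z, v) ∧ (∀ j : Fin L, i + 1 ≤ (j : ℕ) → z j = 0) ∧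
      ∀ j : Fin L, (j : ℕ) < i → (x.input j z v, z j) ∈ pairs lam α' := by
    intro α' o h
    rw [step_act_symm] at h
    obtain ⟨h1, h2⟩ := hχ _ _ _ h
    refine ⟨?_, fun j hj => ?_, fun j hj => ?_⟩
    · have := h1 i le_rfl
      rw [Function.update_self] at this
      exact sub_eq_zero.1 this
    · have := h1 j (by omega)
      rwa [Function.update_of_ne] at this
      rintro rfl
      omega
    · have := h2 j hj
      rw [hin j _ hj.le, Function.update_of_ne] at this
      · exact this
      · rintro rfl
        omega
  rcases he : x.earlier i (z, v) with _ | j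
  · have hq := step_qry_of_none x he
    set q : Bool × X := (false, x.input i z v) with hqdef
    obtain ⟨w, hα, hw⟩ := exists_of_simAsk_ne_zero (x.step i) lam hq h
    have hw' : ∃ o, (o = none ∨ ∃ w', o = some (edge q.1 (loc lam q).2.2 w')) ∧
        χ (Function.update α (loc lam q).2.1 o,
          ((x.step i).act (some (lam (!q.1) ((loc lam q).2.1, w)))).symm (z, v)) ≠ 0 := by
      rcases hw with hw | ⟨w', hw⟩
      · exact ⟨none, .inl rfl, hw⟩
      · exact ⟨_, .inr ⟨w', rfl⟩, hw⟩
    obtain ⟨o, ho, hw'⟩ := hw'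
    obtain ⟨h1, h2, h3⟩ := hz _ _ hw'
    have h1' : z i = lam (!q.1) ((loc lam q).2.1, w) := h1
    have hx : lam false ((loc lam q).2.1, (loc lam q).2.2) = x.input i z v := by
      simp [loc, hqdef]
    refine ⟨⟨h2, fun j hj => ?_⟩, ?_⟩
    · by_cases hji : j = i
      · subst hji
        exact mem_pairs.2 ⟨_, _, _, hα, hx.symm, h1'⟩
      · have hj' : (j : ℕ) < i := by
          have : (j : ℕ) ≠ i := fun h => hji (Fin.ext h)
          omega
        obtain ⟨b, k, w', hb, e1, e2⟩ := mem_pairs.1 (h3 j hj')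
        by_cases hbb : b = (loc lam q).2.1
        -- The pair of an earlier verification query cannot lie in the queried block: before the
        -- query, a surviving database has there either nothing or the queried input itself, and the
        -- latter would be a repetition.
        · exfalso
          subst hbb
          rw [Function.update_self] at hb
          rcases ho with rfl | ⟨w'', rfl⟩
          · simp at hb
          · simp only [hqdef, edge, Bool.false_eq_true, if_false, Option.some.injEq,
              Prod.mk.injEq] at hb
            exact pick_eq_none he j ⟨hj', e1.trans ((congrArg
              (fun k => lam false ((loc lam q).2.1, k)) hb.1.symm).trans hx)⟩
        · rw [Function.update_of_ne hbb] at hb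
          exact mem_pairs.2 ⟨b, k, w', hb, e1, e2⟩
    · intro q' hq'
      rw [hq, Option.some.injEq] at hq'
      subst hq'
      exact ⟨w, hα, h1'.symm⟩
  · have hq := step_qry_of_some x he
    rw [simAsk_of_none (x.step i) lam hq] at h
    obtain ⟨h1, h2, h3⟩ := hz _ _ h
    obtain ⟨hj, hji⟩ := pick_spec he
    refine ⟨⟨h2, fun j' hj' => ?_⟩, fun q hq' => by simp [hq] at hq'⟩
    by_cases hji' : j' = i
    · subst hji'
      have := h3 j hj
      rw [h1, reply, he]
      simp only [Option.getD_none, Option.elim_some]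
      simp only at hji
      rwa [← hji]
    · have : (j' : ℕ) ≠ i := fun h => hji' (Fin.ext h)
      exact h3 j' (by omega)

/-- The steps in which the sequence of queries is made. -/
def isVer (L T t : ℕ) : Bool := decide (T ≤ t ∧ t - T < L)

lemma simRun_append_of_le (lam : Bool → (β × S ≃ X)) (Q : ℕ → QStep X V) (init : V → ℂ)
    {T t : ℕ} (ht : t ≤ T) {α : DB β S} {z : Fin L → X} {v : V}
    (h : simRun (x.append Q T) lam (isVer L T) (start init) t (α, (z, v)) ≠ 0) : z = 0 := by
  induction t generalizing α v with
  | zero =>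
    by_contra hz
    exact h (by simp [simRun, start, hz])
  | succ t ih =>
    have hver : isVer L T t = false := by
      simp only [isVer, decide_eq_false_iff_not]
      omega
    have ih' : ∀ {α : DB β S} {v : V}, z ≠ 0 →
        simRun (x.append Q T) lam (isVer L T) (start init) t (α, (z, v)) = 0 := by
      intro α v hz
      by_contra h
      exact hz (ih (by omega) h)
    by_contra hz
    rw [simRun, hver, append_of_lt x Q (by omega)] at h
    simp only [simStep, Bool.false_eq_true, if_false] at h
    set χ := simRun (x.append Q T) lam (isVer L T) (start init) t with hχ
    have h1 : ∀ α v, simAsk ((Q t).extend (Fin L → X)) lam χ (α, (z, v)) = 0 := by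
      intro α v
      by_contra h
      rcases hq : ((Q t).extend (Fin L → X)).qry (z, v) with _ | q
      · rw [simAsk_of_none _ lam hq] at h
        exact h (ih' hz)
      · obtain ⟨w, -, h | ⟨w', h⟩⟩ := exists_of_simAsk_ne_zero _ lam hq h
        · exact h (ih' hz)
        · exact h (ih' hz)
    have h2 : ∀ α v, ((Q t).extend (Fin L → X)).onLoc lam fold id
        (simAsk ((Q t).extend (Fin L → X)) lam χ) (α, (z, v)) = 0 := by
      intro α v
      by_contra h
      rcases hq : ((Q t).extend (Fin L → X)).qry (z, v) with _ | q
      · rw [QStep.onLoc_of_none _ _ _ _ _ _ hq] at h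
        exact h (h1 _ _)
      · rw [QStep.onLoc_of_some _ _ _ _ _ _ hq] at h
        obtain ⟨α', h', -⟩ := dbSize_of_fold_ne_zero h
        exact h' (h1 _ _)
    refine h ?_
    change (Q t).U (fun v => ((Q t).extend (Fin L → X)).onLoc lam fold id
        (simAsk ((Q t).extend (Fin L → X)) lam χ) (α, (z, v))) v = 0
    simp only [h2]
    exact congrFun (map_zero (Q t).U) v

lemma recorded_of_simRun_ne_zero (lam : Bool → (β × S ≃ X)) (Q : ℕ → QStep X V) (init : V → ℂ)
    (T : ℕ) {i : ℕ} (hi : i ≤ L) {α : DB β S} {z : Fin L → X} {v : V}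
    (h : simRun (x.append Q T) lam (isVer L T) (start init) (T + i) (α, (z, v)) ≠ 0) :
    x.Recorded lam i α z v := by
  induction i generalizing α z v with
  | zero =>
    have := x.simRun_append_of_le lam Q init le_rfl h
    subst this
    exact ⟨fun _ _ => rfl, fun _ h => absurd h (Nat.not_lt_zero _)⟩
  | succ i ih =>
    set k : Fin L := ⟨i, hi⟩ with hk
    have hver : isVer L T (T + i) = true := by
      simp only [isVer, decide_eq_true_eq]
      omega
    rw [← add_assoc, simRun, hver, show T + i = T + (k : ℕ) from rfl, append_add] at h
    simp only [simStep, if_true] at h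
    exact (x.simAsk_step lam k (fun α z v h => ih (by omega) h) h).1

lemma append_U (Q : ℕ → QStep X V) (T t : ℕ) (h : isVer L T t = true) :
    (x.append Q T t).U = LinearMap.id := by
  rw [append, dif_pos (of_decide_eq_true h)]
  rfl

/-- The recorded answer can be read off from the register cell, so in each row at most one database
has nonzero amplitude. -/
lemma append_unique (lam : Bool → (β × S ≃ X)) (Q : ℕ → QStep X V) (init : V → ℂ)
    (T t : ℕ) (h : isVer L T t = true) (α : DB β S) (v : (Fin L → X) × V) (q : Bool × X)
    (hq : (x.append Q T t).qry v = some q) (z z' : S)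
    (hz : simAsk (x.append Q T t) lam
      (simRun (x.append Q T) lam (isVer L T) (start init) t)
      (Function.update α (loc lam q).2.1 (some (edge q.1 (loc lam q).2.2 z)), v) ≠ 0)
    (hz' : simAsk (x.append Q T t) lam
      (simRun (x.append Q T) lam (isVer L T) (start init) t)
      (Function.update α (loc lam q).2.1 (some (edge q.1 (loc lam q).2.2 z')), v) ≠ 0) :
    z = z' := by
  have h' := of_decide_eq_true h
  obtain ⟨i, rfl⟩ := Nat.exists_eq_add_of_le h'.1
  set k : Fin L := ⟨i, by simpa using h'.2⟩ with hk
  rw [show T + i = T + (k : ℕ) from rfl, append_add] at hq hz hz'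
  rcases v with ⟨y, v⟩
  have key : ∀ z, simAsk (x.step k) lam
      (simRun (x.append Q T) lam (isVer L T) (start init) (T + k))
      (Function.update α (loc lam q).2.1 (some (edge q.1 (loc lam q).2.2 z)), (y, v)) ≠ 0 →
      lam (!q.1) ((loc lam q).2.1, z) = y k := by
    intro z hz
    obtain ⟨w, hw, hy⟩ := (x.simAsk_step lam k
      (fun α z v h => x.recorded_of_simRun_ne_zero lam Q init T k.2.le h) hz).2 q hq
    rw [Function.update_self, Option.some.injEq] at hw
    have : z = w := by
      have h2 := congrArg (rowVal q.1 (loc lam q).2.2) (congrArg some hw)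
      simpa using h2
    rw [this, hy]
  have := (key z hz).trans (key z' hz').symm
  simpa using this

end Procedure

end SimulatedVerification

/-! ### The given algorithm as a sequence of steps, followed by the hashing of its output. -/

section Algorithm

lemma l2_ofLp {ι : Type*} [Fintype ι] (f : EuclideanSpace ℂ ι) : l2 f.ofLp = ‖f‖ := by
  rw [l2, EuclideanSpace.norm_eq]

/-- A step of a query algorithm: a query followed by a unitary. -/
noncomputable def QueryAlgorithm.step {n : ℕ} {W : Type} [Fintype W] {Out : Type}
    (A : QueryAlgorithm n W Out) (t : ℕ) : QStep (Bits n) (Reg n W) where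
  qry v := some (v.1, v.2.1)
  act o :=
    { toFun := fun v => (v.1, v.2.1, v.2.2.1 + o.getD 0, v.2.2.2)
      invFun := fun v => (v.1, v.2.1, v.2.2.1 - o.getD 0, v.2.2.2)
      left_inv := fun v => by simp
      right_inv := fun v => by simp }
  qry_act _ _ := rfl
  U := (WithLp.linearEquiv 2 ℂ (Reg n W → ℂ)).toLinearMap ∘ₗ
    (A.unitary (t + 1)).toLinearEquiv.toLinearMap ∘ₗ
      (WithLp.linearEquiv 2 ℂ (Reg n W → ℂ)).symm.toLinearMap
  l2_U f := by
    change l2 (A.unitary (t + 1) (WithLp.toLp 2 f)).ofLp = l2 (WithLp.toLp 2 f).ofLp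
    rw [l2_ofLp, l2_ofLp, LinearIsometryEquiv.norm_map]

lemma QueryAlgorithm.run_step {n : ℕ} {W : Type} [Fintype W] {Out : Type}
    (A : QueryAlgorithm n W Out) (φ : Equiv.Perm (Bits n)) (t : ℕ) :
    run A.step (A.unitary 0 A.init).ofLp φ t = (A.state φ t).ofLp := by
  induction t with
  | zero => rfl
  | succ t ih =>
    rw [run, ih, QueryAlgorithm.state]
    change (A.unitary (t + 1) (WithLp.toLp 2 ((A.step t).askPerm φ (A.state φ t).ofLp))).ofLp = _
    congr 2

end Algorithm

namespace Sponge

variable {r c : ℕ}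

lemma Path.eq_absorb {E : Finset (Bits (r + c) × Bits (r + c))} {φ : Equiv.Perm (Bits (r + c))}
    (hE : ∀ x y, (x, y) ∈ E → y = φ x) {m s} (h : Path E m s) : s = absorb φ m := by
  induction h with
  | nil => rfl
  | snoc _ h2 ih =>
    rw [hE _ _ h2, absorb, List.foldl_append, List.foldl_cons, List.foldl_nil, absorbBlock, ih]
    rfl

/-- The state before the `j`-th block, if the states are written down from position `o` on. -/
def before {L : ℕ} (z : Fin L → Bits (r + c)) (o j : ℕ) : Bits (r + c) :=
  if j = 0 then 0 else if h : o + j - 1 < L then z ⟨o + j - 1, h⟩ else 0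

lemma before_update {L : ℕ} (z : Fin L → Bits (r + c)) (o j : ℕ) (k : Fin L) (w : Bits (r + c))
    (h : o + j ≤ k) : before (Function.update z k w) o j = before z o j := by
  unfold before
  split_ifs with h1 h2
  · rfl
  · rw [Function.update_of_ne]
    rintro rfl
    simp only at h
    omega
  · rfl

/-- Cell `o + j` holds the answer to the query for block `j`, hence the state before block `j + 1`;
the state before block 0 is zero and is not stored. -/
lemma path_take {L : ℕ} {E : Finset (Bits (r + c) × Bits (r + c))} {z : Fin L → Bits (r + c)}
    {o l : ℕ} (hL : o + l ≤ L) {m : List (Bits r)} (hm : m.length ≤ l)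
    (h : ∀ j (hj : j < l), (before z o j + pad (m.getD j 0), z ⟨o + j, by omega⟩) ∈ E)
    (j : ℕ) (hj : j ≤ m.length) : Path E (m.take j) (before z o j) := by
  induction j with
  | zero => simpa [before] using Path.nil
  | succ j ih =>
    have h1 : m.take (j + 1) = m.take j ++ [m.getD j 0] := by
      rw [List.take_succ_eq_append_getElem (by omega), List.getD_eq_getElem _ _ (by omega)]
    have h2 : before z o (j + 1) = z ⟨o + j, by omega⟩ := by
      rw [before, if_neg (Nat.succ_ne_zero j), dif_pos (by omega)]
      congr 1
    rw [h1, h2]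
    exact (ih (by omega)).snoc (h j (by omega))

variable {V : Type*} (out : V → List (Bits r) × List (Bits r)) (l : ℕ)

/-- The queries needed to compute the hashes of two messages of at most `l` blocks. -/
def hashing : Procedure (Bits (r + c)) V (l + l) where
  -- The first `l` cells serve the first message, the others the second. Beyond the end of a message
  -- the block defaults to 0: the number of queries is then fixed, and the cells up to the length of
  -- the message are unaffected.
  input i z v := if (i : ℕ) < l then before z 0 i + pad ((out v).1.getD i 0)
    else before z l (i - l) + pad ((out v).2.getD (i - l) 0)
  input_update i j hij z w v := by
    have hij' : (i : ℕ) ≤ j := hij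
    split_ifs with h
    · rw [before_update _ _ _ _ _ (by omega)]
    · rw [before_update _ _ _ _ _ (by omega)]

lemma path_of_hashing {E : Finset (Bits (r + c) × Bits (r + c))}
    {z : Fin (l + l) → Bits (r + c)} {v : V}
    (h : ∀ j, ((hashing out l).input j z v, z j) ∈ E)
    (h1 : (out v).1.length ≤ l) (h2 : (out v).2.length ≤ l) :
    Path E (out v).1 (before z 0 (out v).1.length) ∧
      Path E (out v).2 (before z l (out v).2.length) := by
  constructor
  · have := path_take (E := E) (z := z) (o := 0) (l := l) (by omega) h1 (fun j hj => by
      have := h ⟨j, by omega⟩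
      simp only [hashing, if_pos hj] at this
      convert this using 3
      simp) _ le_rfl
    rwa [List.take_length] at this
  · have := path_take (E := E) (z := z) (o := l) (l := l) le_rfl h2 (fun j hj => by
      have := h ⟨l + j, by omega⟩
      simpa [hashing] using this) _ le_rfl
    rwa [List.take_length] at this

/-- The states that are written down show a collision. -/
def ShowsCollision (p : (Fin (l + l) → Bits (r + c)) × V) : Prop :=
  (out p.2).1.length ≤ l ∧ (out p.2).2.length ≤ l ∧ (out p.2).1 ≠ (out p.2).2 ∧
    rate (before p.1 0 (out p.2).1.length) = rate (before p.1 l (out p.2).2.length)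

/-- The recorded queries form paths for both messages, and good pairs exclude equal final rates of
different messages. -/
lemma not_good_of_showsCollision {E : Finset (Bits (r + c) × Bits (r + c))}
    {z : Fin (l + l) → Bits (r + c)} {v : V}
    (h : ∀ j, ((hashing out l).input j z v, z j) ∈ E) (hz : ShowsCollision out l (z, v)) :
    ¬ Good E := by
  intro hE
  obtain ⟨h1, h2, h3, h4⟩ := hz
  obtain ⟨p1, p2⟩ := path_of_hashing out l h h1 h2
  exact h3 (p1.eq_of_rate hE p2 h4)

/-- With the whole graph of `φ` as the set of pairs, the written paths are those of absorption. -/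
lemma showsCollision_iff {φ : Equiv.Perm (Bits (r + c))}
    {z : Fin (l + l) → Bits (r + c)} {v : V}
    (h : ∀ j, z j = φ ((hashing out l).input j z v)) :
    ShowsCollision out l (z, v) ↔ IsCollision l φ (out v) := by
  set E : Finset (Bits (r + c) × Bits (r + c)) := Finset.univ.image fun x => (x, φ x) with hE
  have hE' : ∀ x y, (x, y) ∈ E → y = φ x := by
    intro x y hxy
    simp only [hE, Finset.mem_image, Finset.mem_univ, true_and, Prod.mk.injEq] at hxy
    obtain ⟨a, rfl, rfl⟩ := hxy
    rfl
  have hz : ∀ j, ((hashing out l).input j z v, z j) ∈ E := by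
    intro j
    rw [h j]
    exact Finset.mem_image_of_mem _ (Finset.mem_univ _)
  refine and_congr_right fun h1 => and_congr_right fun h2 => and_congr_right fun _ => ?_
  obtain ⟨p1, p2⟩ := path_of_hashing out l hz h1 h2
  simp only [hash]
  rw [p1.eq_absorb hE', p2.eq_absorb hE']

end Sponge

/-! ### From block permutations back to a uniform permutation. -/

section Average

variable {β S X V : Type*} [Fintype β] [DecidableEq β] [Fintype S] [DecidableEq S]
  [Fintype X] [DecidableEq X] [Fintype V]

lemma norm_permNorm_sq :
    ‖permNorm β S‖ ^ 2 = (Fintype.card (β → Equiv.Perm S) : ℝ)⁻¹ := by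
  rw [permNorm, Complex.norm_real, Real.norm_of_nonneg (by positivity), inv_pow,
    Real.sq_sqrt (by positivity)]

lemma sum_boolFun {M : Type*} [NonAssocSemiring M] {Y : Type*} [Fintype Y] [DecidableEq Y]
    (d : Bool) (F : Y → M) :
    ∑ f : Bool → Y, F (f d) = Fintype.card Y * ∑ y, F y := by
  rw [← Equiv.sum_comp (Equiv.boolArrowEquivProd Y).symm]
  cases d
  · rw [Fintype.sum_prod_type, Finset.mul_sum]
    refine Finset.sum_congr rfl fun y _ => ?_
    simp
  · rw [Fintype.sum_prod_type_right, Finset.mul_sum]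
    refine Finset.sum_congr rfl fun y _ => ?_
    simp

/-- For a fixed division, the squared norm is the mean probability of `R` over the block
permutations; `sum_blockPerm` then gives the sum over all permutations. -/
lemma sum_l2_blockRun_sq (Q : ℕ → QStep X V) (init : V → ℂ) (T : ℕ) (R : V → Prop)
    [DecidablePred R] :
    ∑ lam : Bool → (β × S ≃ X),
      l2 (fun p => if R p.2 then blockRun Q lam init T p else 0) ^ 2 =
      Fintype.card (β × S ≃ X) * ∑ φ : Equiv.Perm X,
        l2 (fun v => if R v then run Q init φ T v else 0) ^ 2 := by
  have hH : (Fintype.card (β → Equiv.Perm S) : ℝ) ≠ 0 := by simp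
  have h : ∀ lam : Bool → (β × S ≃ X),
      l2 (fun p => if R p.2 then blockRun Q lam init T p else 0) ^ 2 =
      (Fintype.card (β → Equiv.Perm S) : ℝ)⁻¹ * ∑ h, l2 (fun v => if R v then
        run Q init (blockPerm lam h) T v else 0) ^ 2 := by
    intro lam
    rw [l2_sq, Fintype.sum_prod_type, Finset.mul_sum]
    refine Finset.sum_congr rfl fun h _ => ?_
    rw [l2_sq, Finset.mul_sum]
    refine Finset.sum_congr rfl fun v _ => ?_
    by_cases hv : R v
    · simp only [hv, if_true, blockRun, norm_mul, mul_pow, norm_permNorm_sq]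
    · simp [hv]
  simp only [h]
  rw [← Finset.mul_sum, sum_blockPerm true fun _ φ =>
    l2 (fun v => if R v then run Q init φ T v else 0) ^ 2, nsmul_eq_mul, ← mul_assoc,
    inv_mul_cancel₀ hH, one_mul, Finset.sum_const, Finset.card_univ, nsmul_eq_mul]

lemma l2_blockRun (Q : ℕ → QStep X V) (lam : Bool → (β × S ≃ X)) (init : V → ℂ) (t : ℕ) :
    l2 (blockRun Q lam init t) = l2 init := by
  have hH : (Fintype.card (β → Equiv.Perm S) : ℝ) ≠ 0 := by simp
  rw [← sq_eq_sq₀ (l2_nonneg _) (l2_nonneg _), l2_sq, Fintype.sum_prod_type]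
  simp only [blockRun, norm_mul, mul_pow, norm_permNorm_sq, ← Finset.mul_sum, ← l2_sq, l2_run,
    Finset.sum_const, Finset.card_univ, nsmul_eq_mul]
  rw [← mul_assoc, inv_mul_cancel₀ hH, one_mul]

end Average

-- For a fixed permutation the verification maps each label to a single trace and keeps its
-- amplitude, and the trace shows a collision exactly if the output is one.
open Classical in
lemma QueryAlgorithm.outputProb_eq {r c : ℕ} {W : Type} [Fintype W]
    (A : QueryAlgorithm (r + c) W (List (Bits r) × List (Bits r))) (l : ℕ)
    (φ : Equiv.Perm (Bits (r + c))) :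
    A.outputProb φ (Sponge.IsCollision l φ) =
      l2 (fun p => if Sponge.ShowsCollision A.output l p then
        run ((Sponge.hashing A.output l).append A.step A.numQueries)
          (Procedure.start (A.unitary 0 A.init).ofLp) φ (A.numQueries + (l + l)) p else 0) ^ 2 := by
  obtain ⟨tr, -, h1, h2⟩ := (Sponge.hashing A.output l).exists_run_append_add A.step
    (A.unitary 0 A.init).ofLp φ A.numQueries (l + l) le_rfl
  rw [h2, l2_sq, Fintype.sum_prod_type_right, QueryAlgorithm.outputProb]
  refine Finset.sum_congr rfl fun v _ => ?_
  rw [Finset.sum_eq_single (tr v)]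
  · have := Sponge.showsCollision_iff A.output l (φ := φ) (z := tr v) (v := v)
      fun j => h1 v j j.2
    simp only [if_true, A.run_step]
    by_cases hc : Sponge.IsCollision l φ (A.output v)
    · rw [if_pos hc, if_pos (this.2 hc)]
    · rw [if_neg hc, if_neg (fun h => hc (this.1 h))]
      simp
  · intro z _ hz
    simp [hz]
  · simp

/-! ### The collision probability for a fixed division, and crowded divisions. -/

section Bound

variable {β S : Type*} [Fintype β] [DecidableEq β] [Fintype S] [DecidableEq S] {r c : ℕ}
  {W : Type} [Fintype W] (A : QueryAlgorithm (r + c) W (List (Bits r) × List (Bits r))) (l : ℕ)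

namespace Sponge

/-- The steps of the algorithm, followed by the computation of the hashes of its output. -/
noncomputable abbrev game :
    ℕ → QStep (Bits (r + c)) ((Fin (l + l) → Bits (r + c)) × Reg (r + c) W) :=
  (hashing A.output l).append A.step A.numQueries

/-- The initial state of the game. -/
noncomputable abbrev gameInit : (Fin (l + l) → Bits (r + c)) × Reg (r + c) W → ℂ :=
  Procedure.start (A.unitary 0 A.init).ofLp

lemma l2_gameInit : l2 (gameInit A l) = 1 := by
  rw [gameInit, Procedure.l2_start, l2_ofLp, LinearIsometryEquiv.norm_map, A.norm_init]

open Classical in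
/-- The probability of a collision, for a fixed division into blocks. -/
noncomputable def collisionProb (lam : Bool → (β × S ≃ Bits (r + c))) : ℝ :=
  l2 (fun p => if ShowsCollision A.output l p.2 then
    blockRun (game A l) lam (gameInit A l) (A.numQueries + (l + l)) p else 0) ^ 2

lemma collisionProb_le_one (lam : Bool → (β × S ≃ Bits (r + c))) : collisionProb A l lam ≤ 1 := by
  refine pow_le_one₀ (l2_nonneg _) (le_trans (l2_mono fun p => ?_)
    ((l2_blockRun (game A l) lam (gameInit A l) (A.numQueries + (l + l))).trans
      (l2_gameInit A l)).le)
  split_ifs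
  · exact le_rfl
  · simp

/-- The error of the simulation in one step. -/
noncomputable def stepErr (lam : Bool → (β × S ≃ Bits (r + c))) (t : ℕ) : ℝ :=
  l2 (blockRun (game A l) lam (gameInit A l) t -
    (game A l t).onLoc lam resample id (blockRun (game A l) lam (gameInit A l) t))

/-- `l2_blockRun_le` with the databases that are not good as the bad ones, squared by (D + a + b)² ≤
3(D² + a² + b²). The three terms are the resampling errors, the lost parts and the bad weight. -/
lemma collisionProb_le (lam : Bool → (β × S ≃ Bits (r + c))) {k : ℕ}
    (hrate : ∀ d b a, load rate (lam d) b a ≤ k) (hcap : ∀ d b a, load cap (lam d) b a ≤ k)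
    {T : ℕ} (hT : T = A.numQueries + (l + l)) (hS : 1 < Fintype.card S)
    (hT4 : ((Fintype.card S : ℝ) / ((Fintype.card S : ℝ) - 1)) ^ T ≤ 4) :
    collisionProb A l lam ≤ 3 * T * ∑ t ∈ Finset.range T, stepErr A l lam t ^ 2 +
      (72 * T ^ 2 + 324 * T ^ 2 * (T + 1) * k) / Fintype.card S := by
  classical
  have hs : (2 : ℝ) ≤ Fintype.card S := by exact_mod_cast hS
  set s : ℝ := (Fintype.card S : ℝ) with hsdef
  set ε : ℝ := ((3 * T + 3) * k) / s with hεdef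
  have hε : 0 ≤ ε := by positivity
  have main := l2_blockRun_le (game A l) lam (Procedure.isVer (l + l) A.numQueries)
    (gameInit A l) (l2_gameInit A l) ((hashing A.output l).append_U A.step A.numQueries) hS T hT4
    (fun t h α v q hq z z' => (hashing A.output l).append_unique lam A.step _ A.numQueries t h
      α v q hq z z') (fun α => ¬ Good (pairs lam α))
    (by rw [pairs_none]; exact not_not.2 good_empty) ε hε
    (fun α b h h' => h (h'.mono (pairs_update_none_subset lam α b)))
    (fun α q P h1 _ h2 h3 => by
      have := card_le_of_not_good lam hrate hcap α q P h1 (not_not.1 h2) h3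
      rw [hεdef, div_mul_cancel₀ _ (by linarith)]
      exact_mod_cast this)
    (ShowsCollision A.output l) (by
      rintro α ⟨z, v⟩ h hz
      rw [hT] at h
      exact not_good_of_showsCollision A.output l (fun j =>
        ((hashing A.output l).recorded_of_simRun_ne_zero lam A.step _ A.numQueries le_rfl h).2
          j j.2) hz)
  rw [collisionProb, ← hT]
  set D := ∑ t ∈ Finset.range T, stepErr A l lam t with hD
  set a := (T : ℝ) * (2 * (Real.sqrt (s - 1))⁻¹ + 2 * (Real.sqrt s)⁻¹) with ha
  set b := 2 * ((T : ℝ) * (3 * Real.sqrt ε)) with hb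
  have hD2 : D ^ 2 ≤ T * ∑ t ∈ Finset.range T, stepErr A l lam t ^ 2 := by
    have := sq_sum_le_card_mul_sum_sq (s := Finset.range T) (f := stepErr A l lam)
    rwa [Finset.card_range] at this
  have ha2 : a ^ 2 ≤ 24 * T ^ 2 / s := by
    -- Uses s ≥ 2, so that 1/(s - 1) ≤ 2/s.
    have h1 : (Real.sqrt (s - 1))⁻¹ ^ 2 ≤ 2 / s := by
      rw [inv_pow, Real.sq_sqrt (by linarith), ← one_div, div_le_div_iff₀ (by linarith)
        (by linarith)]
      linarith
    have h2 : (Real.sqrt s)⁻¹ ^ 2 = 1 / s := by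
      rw [inv_pow, Real.sq_sqrt (by linarith), one_div]
    set u := (Real.sqrt (s - 1))⁻¹
    set w := (Real.sqrt s)⁻¹
    have h3 : (2 * u + 2 * w) ^ 2 ≤ 24 * (1 / s) := by
      have : 2 / s = 2 * (1 / s) := by ring
      nlinarith [sq_nonneg (u - w)]
    calc a ^ 2 = (T : ℝ) ^ 2 * (2 * u + 2 * w) ^ 2 := by rw [ha, mul_pow]
      _ ≤ (T : ℝ) ^ 2 * (24 * (1 / s)) := by gcongr
      _ = _ := by ring
  have hb2 : b ^ 2 = 108 * T ^ 2 * (T + 1) * k / s := by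
    rw [hb, mul_pow, mul_pow, mul_pow, Real.sq_sqrt hε, hεdef]
    ring
  calc _ ≤ (D + a + b) ^ 2 := pow_le_pow_left₀ (l2_nonneg _) main 2
    _ ≤ 3 * (D ^ 2 + a ^ 2 + b ^ 2) := by
        nlinarith [sq_nonneg (D - a), sq_nonneg (D - b), sq_nonneg (a - b)]
    _ ≤ 3 * (T * ∑ t ∈ Finset.range T, stepErr A l lam t ^ 2 + 24 * T ^ 2 / s +
          108 * T ^ 2 * (T + 1) * k / s) := by
        rw [hb2]
        gcongr
    _ = _ := by ring

/-- A division into blocks in which a value of the rate or of the capacity is frequent. -/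
def Crowded (k : ℕ) (m : β × S ≃ Bits (r + c)) : Prop :=
  (∃ b a, k ≤ load rate m b a) ∨ ∃ b a, k ≤ load cap m b a

-- A given rate or capacity is expected at most once in a block, so 3n occurrences have probability
-- at most 1/(3n)! for each block and value. The union bound over at most 2^(2n) pairs leaves
-- 2^(-n), once for the rate and once for the capacity.
open Classical in
lemma card_crowded_le (hS : Fintype.card S ≤ 2 ^ min r c) (hβ : Fintype.card β ≤ 2 ^ (r + c))
    (hr : 2 ≤ r + c) :
    (Finset.univ.filter fun m : β × S ≃ Bits (r + c) => Crowded (3 * (r + c)) m).card *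
      2 ^ (r + c) ≤ 2 * Fintype.card (β × S ≃ Bits (r + c)) := by
  set n := r + c with hn
  have hfact : ∀ k, 4 ≤ k → 2 ^ k ≤ k.factorial := by
    intro k hk
    induction k, hk using Nat.le_induction with
    | base => decide
    | succ k hk ih =>
      rw [pow_succ, Nat.factorial_succ, mul_comm]
      exact Nat.mul_le_mul (by omega) ih
  have hf := hfact (3 * n) (by omega)
  have hX : Fintype.card (Bits n) = 2 ^ n := by simp [ZMod.card]
  have hSr : Fintype.card S ≤ 2 ^ r :=
    hS.trans (Nat.pow_le_pow_right two_pos (min_le_left _ _))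
  have hSc : Fintype.card S ≤ 2 ^ c :=
    hS.trans (Nat.pow_le_pow_right two_pos (min_le_right _ _))
  have key : ∀ N D G : ℕ, G ≤ 2 ^ n → N * (3 * n).factorial ≤ Fintype.card β * G * D →
      N * 2 ^ n ≤ D := by
    intro N D G hG h
    have h0 : 0 < 2 ^ n * 2 ^ n := by positivity
    refine Nat.le_of_mul_le_mul_right ?_ h0
    calc N * 2 ^ n * (2 ^ n * 2 ^ n) = N * 2 ^ (3 * n) := by ring
      _ ≤ N * (3 * n).factorial := Nat.mul_le_mul_left _ hf
      _ ≤ Fintype.card β * G * D := h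
      _ ≤ 2 ^ n * 2 ^ n * D := Nat.mul_le_mul_right _ (Nat.mul_le_mul hβ hG)
      _ = _ := mul_comm _ _
  have h1 := key _ _ _ (by
      rw [show Fintype.card (Bits r) = 2 ^ r by simp [ZMod.card]]
      exact Nat.pow_le_pow_right two_pos (by omega))
    (card_le_load_mul_factorial_le (β := β) (S := S) (rate : Bits n → Bits r) (3 * n) fun a => by
      rw [hX, hn, pow_add]
      exact Nat.mul_le_mul hSr (card_rate_fiber_le a))
  have h2 := key _ _ _ (by
      rw [show Fintype.card (Bits c) = 2 ^ c by simp [ZMod.card]]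
      exact Nat.pow_le_pow_right two_pos (by omega))
    (card_le_load_mul_factorial_le (β := β) (S := S) (cap : Bits n → Bits c) (3 * n) fun a => by
      rw [hX, hn, pow_add, mul_comm (2 ^ r)]
      exact Nat.mul_le_mul hSc (card_cap_fiber_le a))
  have hsub : (Finset.univ.filter fun m : β × S ≃ Bits n => Crowded (3 * n) m) ⊆
      (Finset.univ.filter fun m : β × S ≃ Bits n => ∃ b a,
        3 * n ≤ load (rate : Bits n → Bits r) m b a) ∪
      (Finset.univ.filter fun m : β × S ≃ Bits n => ∃ b a,
        3 * n ≤ load (cap : Bits n → Bits c) m b a) := by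
    intro m hm
    rw [Finset.mem_union, Finset.mem_filter, Finset.mem_filter]
    exact (Finset.mem_filter.1 hm).2.imp (fun h => ⟨Finset.mem_univ _, h⟩)
      fun h => ⟨Finset.mem_univ _, h⟩
  refine (Nat.mul_le_mul_right _ ((Finset.card_le_card hsub).trans
    (Finset.card_union_le _ _))).trans ?_
  rw [add_mul, two_mul]
  convert add_le_add h1 h2

end Sponge

end Bound

/-! ### Averaging the bounds and choosing the constants. -/

section Final

namespace Sponge

variable {β S : Type} [Fintype β] [DecidableEq β] [Fintype S] [DecidableEq S] {r c : ℕ}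
  {W : Type} [Fintype W] (A : QueryAlgorithm (r + c) W (List (Bits r) × List (Bits r))) (l : ℕ)

lemma sum_collisionProb :
    ∑ lam : Bool → (β × S ≃ Bits (r + c)), collisionProb A l lam =
      Fintype.card (β × S ≃ Bits (r + c)) *
        ∑ φ : Equiv.Perm (Bits (r + c)), A.outputProb φ (IsCollision l φ) := by
  classical
  simp only [A.outputProb_eq, collisionProb]
  exact sum_l2_blockRun_sq (β := β) (S := S) _ _ _ _

/-- The base is 1 + 1/(s - 1) ≤ exp(1/(s - 1)), and T ≤ s/2 ≤ s - 1, so the power is at most e. -/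
lemma pow_le_four {s T : ℕ} (hs : 2 ≤ s) (hT : 2 * T ≤ s) : ((s : ℝ) / ((s : ℝ) - 1)) ^ T ≤ 4 := by
  have h2 : (2 : ℝ) ≤ s := by exact_mod_cast hs
  have hT' : (2 : ℝ) * T ≤ s := by exact_mod_cast hT
  have h1 : (s : ℝ) / ((s : ℝ) - 1) ≤ Real.exp (1 / ((s : ℝ) - 1)) := by
    have := Real.add_one_le_exp (1 / ((s : ℝ) - 1))
    refine le_trans (le_of_eq ?_) this
    have : (s : ℝ) - 1 ≠ 0 := by linarith
    field_simp
    ring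
  calc _ ≤ Real.exp (1 / ((s : ℝ) - 1)) ^ T :=
        pow_le_pow_left₀ (div_nonneg (by linarith) (by linarith)) h1 T
    _ = Real.exp (T * (1 / ((s : ℝ) - 1))) := (Real.exp_nat_mul _ _).symm
    _ ≤ Real.exp 1 := by
        refine Real.exp_le_exp.2 ?_
        rw [mul_one_div, div_le_one (by linarith)]
        linarith
    _ ≤ 4 := by linarith [Real.exp_one_lt_d9]

open Classical in
/-- The collision probability, for blocks of size `2 ^ min r c`. -/
lemma successProb_le (hr : 0 < r) (hc : 0 < c) {T : ℕ} (hT : T = A.numQueries + (l + l))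
    (hTs : 2 * T ≤ 2 ^ min r c) :
    A.successProb (IsCollision l) ≤ (48 * (T : ℝ) ^ 4 +
      (72 * T ^ 2 + 324 * T ^ 2 * (T + 1) * (3 * (r + c : ℕ) : ℕ)) + 4) / 2 ^ min r c := by
  -- The block size 2^min(r,c) is the largest power of two for which a given rate or capacity is
  -- expected at most once in a block.
  set S := Bits (min r c) with hSdef
  set β := Bits (max r c) with hβdef
  set X := Bits (r + c) with hXdef
  have cS : Fintype.card S = 2 ^ min r c := by simp [S, ZMod.card]
  have cβ : Fintype.card β = 2 ^ max r c := by simp [β, ZMod.card]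
  have cX : Fintype.card X = 2 ^ (r + c) := by simp [X, ZMod.card]
  have hprod : Fintype.card (β × S) = Fintype.card X := by
    rw [Fintype.card_prod, cS, cβ, cX, ← pow_add, max_add_min]
  have hmin : 1 ≤ min r c := by omega
  have hS2 : 2 ≤ Fintype.card S := by
    rw [cS]
    calc 2 = 2 ^ 1 := rfl
      _ ≤ _ := Nat.pow_le_pow_right two_pos hmin
  have h2 : 2 * Fintype.card S ≤ Fintype.card X := by
    rw [cS, cX, ← pow_succ']
    exact Nat.pow_le_pow_right two_pos (by omega)
  let e : β × S ≃ X := Fintype.equivOfCardEq hprod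
  set M : ℝ := (Fintype.card (β × S ≃ X) : ℝ) with hM
  have hMX : (Fintype.card (Equiv.Perm X) : ℝ) = M := by
    rw [hM, Fintype.card_equiv e, Fintype.card_perm, hprod]
  have hM0 : 0 < M := by
    have : Nonempty (β × S ≃ X) := ⟨e⟩
    rw [hM]
    exact_mod_cast Fintype.card_pos
  have hK : (Fintype.card (Bool → (β × S ≃ X)) : ℝ) = M * M := by
    rw [Fintype.card_fun, Fintype.card_bool, sq]
    push_cast
    rfl
  set s : ℝ := (2 : ℝ) ^ min r c with hs
  have hs0 : 0 < s := by positivity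
  have cS' : (Fintype.card S : ℝ) = s := by rw [cS]; push_cast; rfl
  set B : ℝ := (72 * T ^ 2 + 324 * T ^ 2 * (T + 1) * (3 * (r + c) : ℕ)) / s with hB
  have hB0 : 0 ≤ B := by positivity
  -- A crowded division is charged with the trivial bound 1.
  have hbound : ∀ lam : Bool → (β × S ≃ X), collisionProb A l lam ≤
      3 * T * ∑ t ∈ Finset.range T, stepErr A l lam t ^ 2 + B +
        ∑ d : Bool, if Crowded (3 * (r + c)) (lam d) then (1 : ℝ) else 0 := by
    intro lam
    have hE : 0 ≤ 3 * (T : ℝ) * ∑ t ∈ Finset.range T, stepErr A l lam t ^ 2 := by positivity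
    have hI : ∀ d : Bool, 0 ≤ if Crowded (3 * (r + c)) (lam d) then (1 : ℝ) else 0 := by
      intro d
      split_ifs <;> norm_num
    by_cases h : ∃ d, Crowded (3 * (r + c)) (lam d)
    · obtain ⟨d, hd⟩ := h
      have h1 := Finset.single_le_sum (fun d _ => hI d) (Finset.mem_univ d)
      rw [if_pos hd] at h1
      have := collisionProb_le_one A l lam
      linarith
    · simp only [Crowded, not_exists, not_or, not_le] at h
      have h1 := collisionProb_le A l lam (k := 3 * (r + c)) (fun d b a => ((h d).1 b a).le)
        (fun d b a => ((h d).2 b a).le) hT hS2 (pow_le_four hS2 (by rwa [cS]))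
      rw [cS'] at h1
      have h2 := Finset.sum_nonneg fun d (_ : d ∈ Finset.univ) => hI d
      linarith
  have hstep : ∀ t ∈ Finset.range T, ∑ lam : Bool → (β × S ≃ X), stepErr A l lam t ^ 2 ≤
      M * M * (16 * T ^ 2 * (1 / s)) := by
    intro t ht
    have h1 := sum_l2_sub_resample_sq_le (β := β) (S := S) (game A l) (gameInit A l)
      (l2_gameInit A l) hprod h2 t
    rw [hK, cS', cX] at h1
    refine h1.trans ?_
    have h3 : (t : ℝ) ≤ T := by exact_mod_cast (Finset.mem_range.1 ht).le
    -- The left side is 2^(-max(r,c)).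
    have h4 : s / ((2 ^ (r + c) : ℕ) : ℝ) ≤ 1 / s := by
      rw [div_le_div_iff₀ (by positivity) hs0, one_mul, hs, ← pow_add]
      push_cast
      exact pow_le_pow_right₀ one_le_two (by omega)
    gcongr
  have hcrowd : ∀ d : Bool, ∑ lam : Bool → (β × S ≃ X),
      (if Crowded (3 * (r + c)) (lam d) then (1 : ℝ) else 0) ≤ M * M * (2 / s) := by
    intro d
    rw [sum_boolFun d fun m : β × S ≃ X => if Crowded (3 * (r + c)) m then (1 : ℝ) else 0, mul_assoc,
      Finset.sum_boole]
    refine mul_le_mul_of_nonneg_left ?_ hM0.le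
    have h1 := card_crowded_le (β := β) (S := S) (r := r) (c := c) cS.le
      (cβ.le.trans (Nat.pow_le_pow_right two_pos (by omega))) (by omega)
    have h2 : ((Finset.univ.filter fun m : β × S ≃ X => Crowded (3 * (r + c)) m).card : ℝ) * 2 ^ (r + c) ≤
        2 * M := by
      rw [hM]
      exact_mod_cast h1
    have h3 : s ≤ 2 ^ (r + c) := pow_le_pow_right₀ one_le_two (by omega)
    rw [mul_div_assoc', le_div_iff₀ hs0]
    refine (mul_le_mul_of_nonneg_left h3 (Nat.cast_nonneg _)).trans ?_
    linarith
  have hsum : ∑ lam : Bool → (β × S ≃ X), collisionProb A l lam ≤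
      M * M * (48 * T ^ 4 * (1 / s) + B + 4 / s) := by
    refine (Finset.sum_le_sum fun lam _ => hbound lam).trans ?_
    rw [Finset.sum_add_distrib, Finset.sum_add_distrib, ← Finset.mul_sum,
      Finset.sum_comm (t := Finset.range T), Finset.sum_const, Finset.card_univ, nsmul_eq_mul, hK,
      Finset.sum_comm (t := (Finset.univ : Finset Bool))]
    have h1 := Finset.sum_le_sum hstep
    rw [Finset.sum_const, Finset.card_range, nsmul_eq_mul] at h1
    have h3 := Finset.sum_le_sum fun d (_ : d ∈ (Finset.univ : Finset Bool)) => hcrowd d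
    rw [Finset.sum_const, Finset.card_univ, Fintype.card_bool, nsmul_eq_mul] at h3
    have h4 := mul_le_mul_of_nonneg_left h1 (show (0 : ℝ) ≤ 3 * T by positivity)
    refine (add_le_add (add_le_add h4 le_rfl) h3).trans (le_of_eq ?_)
    push_cast
    ring
  rw [sum_collisionProb A l] at hsum
  rw [QueryAlgorithm.successProb, hMX, div_le_iff₀ hM0]
  have h5 := le_of_mul_le_mul_left (hsum.trans_eq (mul_assoc _ _ _)) hM0
  refine h5.trans (le_of_eq ?_)
  rw [hB]
  ring

lemma successProb_le_one : A.successProb (IsCollision l) ≤ 1 := by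
  classical
  rw [QueryAlgorithm.successProb]
  refine div_le_one_of_le₀ ?_ (Nat.cast_nonneg _)
  have h : ∀ φ : Equiv.Perm (Bits (r + c)), A.outputProb φ (IsCollision l φ) ≤ 1 := by
    intro φ
    have h1 : l2 (A.state φ A.numQueries).ofLp = 1 := by
      rw [← A.run_step, l2_run, l2_ofLp, LinearIsometryEquiv.norm_map, A.norm_init]
    have h2 := l2_sq (A.state φ A.numQueries).ofLp
    rw [h1, one_pow] at h2
    rw [h2, QueryAlgorithm.outputProb]
    refine Finset.sum_le_sum fun v _ => ?_
    split_ifs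
    · exact le_rfl
    · exact sq_nonneg _
  refine (Finset.sum_le_sum fun φ _ => h φ).trans ?_
  simp

/-- Only the empty message has no blocks. This settles q = 0, where the claimed bound is zero. -/
lemma successProb_eq_zero : A.successProb (IsCollision 0) = 0 := by
  have h : ∀ (φ : Equiv.Perm (Bits (r + c))) p, ¬ IsCollision 0 φ p := by
    rintro φ p ⟨h1, h2, h3, -⟩
    refine h3 ?_
    rw [List.eq_nil_of_length_eq_zero (Nat.le_zero.1 h1),
      List.eq_nil_of_length_eq_zero (Nat.le_zero.1 h2)]
  simp [QueryAlgorithm.successProb, QueryAlgorithm.outputProb, h]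

end Sponge

end Final

theorem mainTheorem2 :
    ∃ C : ℝ, 0 < C ∧
      ∀ (r c : ℕ), 0 < r → 0 < c →
        ∀ (q l : ℕ), l ≤ q →
          ∀ (W : Type) [Fintype W]
            (A : QueryAlgorithm (r + c) W (List (Bits r) × List (Bits r))),
            A.numQueries ≤ q →
              A.successProb (Sponge.IsCollision l) ≤
                C * ((q : ℝ) ^ 5 * ((r + c : ℕ) : ℝ) * ((2 : ℝ) ^ min r c)⁻¹) := by
  -- With T ≤ 3q and T + 1 ≤ 4q, the coefficients add up to 3888 + 648 + 34992 + 4 = 39532.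
  refine ⟨40000, by norm_num, fun r c hr hc q l hl W _ A hA => ?_⟩
  rcases q.eq_zero_or_pos with rfl | hq
  · obtain rfl : l = 0 := by omega
    rw [Sponge.successProb_eq_zero]
    positivity
  have hq1 : (1 : ℝ) ≤ q := by exact_mod_cast hq
  have hn1 : (1 : ℝ) ≤ ((r + c : ℕ) : ℝ) := by exact_mod_cast (by omega : 1 ≤ r + c)
  set n : ℝ := ((r + c : ℕ) : ℝ) with hn
  set s : ℝ := (2 : ℝ) ^ min r c with hs
  have hs0 : 0 < s := by positivity
  have e : 40000 * ((q : ℝ) ^ 5 * n * s⁻¹) = 40000 * (q ^ 5 * n) / s := by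
    rw [div_eq_mul_inv]
    ring
  rw [e]
  -- If the condition fails, then s ≤ 6q, the right side is at least 1, and the trivial bound
  -- suffices.
  by_cases h : 2 * (A.numQueries + (l + l)) ≤ 2 ^ min r c
  · refine (Sponge.successProb_le A l hr hc rfl h).trans ?_
    refine div_le_div_of_nonneg_right ?_ hs0.le
    set T : ℝ := ((A.numQueries + (l + l) : ℕ) : ℝ) with hT
    have hT0 : 0 ≤ T := Nat.cast_nonneg _
    have hT3 : T ≤ 3 * q := by
      have : A.numQueries + (l + l) ≤ 3 * q := by omega
      rw [hT]
      exact_mod_cast this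
    have hn3 : ((3 * (r + c) : ℕ) : ℝ) = 3 * n := by
      rw [hn]
      push_cast
      ring
    rw [hn3]
    have p : ∀ k ≤ 5, (q : ℝ) ^ k ≤ q ^ 5 * n := by
      intro k hk
      calc (q : ℝ) ^ k ≤ q ^ 5 * 1 := by
            rw [mul_one]
            exact pow_le_pow_right₀ hq1 hk
        _ ≤ q ^ 5 * n := by gcongr
    have p3 : (q : ℝ) ^ 3 * n ≤ q ^ 5 * n := by
      exact mul_le_mul_of_nonneg_right (pow_le_pow_right₀ hq1 (by norm_num)) (by positivity)
    calc _ ≤ 48 * (3 * (q : ℝ)) ^ 4 +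
          (72 * (3 * q) ^ 2 + 324 * (3 * q) ^ 2 * (3 * q + q) * (3 * n)) + 4 := by gcongr
      _ = 3888 * (q : ℝ) ^ 4 + 648 * q ^ 2 + 34992 * (q ^ 3 * n) + 4 * q ^ 0 := by ring
      _ ≤ 40000 * (q ^ 5 * n) := by
          have h4 := p 4 (by norm_num)
          have h2 := p 2 (by norm_num)
          have h0 := p 0 (by norm_num)
          linarith
  · refine (Sponge.successProb_le_one A l).trans ?_
    rw [le_div_iff₀ hs0, one_mul]
    have h1 : s ≤ 6 * q := by
      have : 2 ^ min r c ≤ 6 * q := by omega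
      rw [hs]
      exact_mod_cast this
    have h2 : (q : ℝ) ≤ q ^ 5 * n := by
      calc (q : ℝ) = q ^ 1 * 1 := by ring
        _ ≤ q ^ 5 * n := by
          exact mul_le_mul (pow_le_pow_right₀ hq1 (by norm_num)) hn1 zero_le_one (by positivity)
    linarith
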